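/- Let $\theta>0$, and for each $n$ let the symmetric group $S_n$ carry the Ewens measure with parameter $\theta$, i.e. $\mathbb{P}_\theta(\sigma)=\theta^{\ell(\sigma)}/\bigl(\theta(\theta+1)\cdots(\theta+n-1)\bigr)$, where $\ell(\sigma)$ is the number of cycles of $\sigma$, fixed points included. Let $S^1=\{z\in\mathbb{C}:|z|=1\}$, let $f:S^1\to\mathbb{C}$ be real analytic, and let $x\in S^1$. Let $C_m^{(n)}(\sigma)$ be the number of cycles of length $m$ of $\sigma\in S_n$, let $\log$ be the principal branch of the logarithm, with $\log(-y)=\log y+i\pi$ for $y>0$, and put $$w^n(f)(x)(\sigma)=\sum_{m=1}^n C_m^{(n)}(\sigma)\,\log\bigl(f(x^m)\bigr).$$ Put $m(f)(x)=\frac1p\sum_{m=1}^p\log\bigl(f(x^m)\bigr)$ if $x$ is a root of unity of order $p$ (that is, $p\ge 1$ is minimal with $x^p=1$), and $m(f)(x)=\int_0^1\log\bigl(f(e^{2\pi i s})\bigr)\,ds$ if $x$ is not a root of unity. The point $x=e^{2\pi i t}$ is of finite type if there are $K,\gamma>0$ such that the distance from $mt$ to the nearest integer is greater than $K/|m|^\gamma$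 for all $m\in\mathbb{Z}\setminus\{0\}$. A complex normal random variable is one whose real and imaginary parts are jointly Gaussian, possibly degenerate. (a) Suppose that $x$ is not a root of unity, that $x$ is of finite type, and that all zeros of $f$ are roots of unity. Then $\log f(e^{2\pi i s})$ and $\log^2 f(e^{2\pi i s})$ are integrable on $[0,1]$, and, as $n\to\infty$, $$\frac{w^n(f)(x)}{\sqrt{\log n}}-\theta\sqrt{\log n}\;m(f)(x)\xrightarrow{d}\mathcal N$$ for a complex normal random variable $\mathcal N$. The covariance of the real and the imaginary part of $\mathcal N$ is $$\frac{\theta}{2}\,\operatorname{Im}\left(\int_0^1\log^2\bigl(f(e^{2\pi i s})\bigr)\,ds\right),$$ and the real and the imaginary part of $\mathcal N$ are independent if and only if this covariance is $0$. (b) Suppose that $x$ is a root of unity of order $p$ and that $f(x^m)\neq0$ for all $1\le m\le p$. Then, as $n\to\infty$, $$\frac{w^n(f)(x)}{\sqrt{\log n}}-\theta\sqrt{\log n}\;m(f)(x)\xrightarrow{d}\mathcal N$$ for a complex normal random variable $\mathcal N$. The covariance of the real and the imaginary part of $\mathcal N$ is $$\frac{\theta}{2}\,\operatorname{Im}\left(\frac1p\sum_{m=1}^p\log^2\bigl(f(x^m)\bigr)\right),$$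 and the real and the imaginary part of $\mathcal N$ are independent if and only if this covariance is $0$. -/

import Mathlib

open MeasureTheory ProbabilityTheory Filter Topology
open scoped Manifold ContDiff

namespace EwensCLT

/-! ### Normalisation of the Ewens weights -/

theorem card_parts_partition_swap_mul {α : Type*} [Fintype α] [DecidableEq α]
    (g : Equiv.Perm α) (a b : α) (ha : g a = a) (hab : a ≠ b) :
    Multiset.card (Equiv.swap a b * g).partition.parts + 1 = Multiset.card g.partition.parts := by
  have hle : ∀ h : Equiv.Perm α, h.support.card ≤ Fintype.card α := fun h => Finset.card_le_univ _
  simp only [Equiv.Perm.parts_partition, Multiset.card_add, Multiset.card_replicate]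
  by_cases hb : g b = b
  · have hd : Equiv.Perm.Disjoint (Equiv.swap a b) g := by
      intro z
      by_cases h1 : z = a
      · right; rw [h1, ha]
      · by_cases h2 : z = b
        · right; rw [h2, hb]
        · left; exact Equiv.swap_apply_of_ne_of_ne h1 h2
    have h1 := hle (Equiv.swap a b * g)
    rw [hd.card_support_mul, Equiv.Perm.card_support_swap hab] at h1
    rw [hd.cycleType_mul, hd.card_support_mul, (Equiv.Perm.isCycle_swap hab).cycleType,
      Equiv.Perm.card_support_swap hab, Multiset.card_add, Multiset.card_singleton]
    omega
  · have hbs : b ∈ g.support := Equiv.Perm.mem_support.2 hb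
    obtain ⟨l, hl⟩ : ∃ l, g.toList b = b :: l := by
      have h0 := Equiv.Perm.length_toList_pos_of_mem_support g b hbs
      have h1 := Equiv.Perm.toList_getElem_zero g b hbs
      cases h : g.toList b with
      | nil => simp [h] at h0
      | cons y l => simp only [h, List.getElem_cons_zero] at h1; exact ⟨l, by rw [h1]⟩
    have hnd := g.nodup_toList b
    have hlen := Equiv.Perm.two_le_length_toList_iff_mem_support.2 hbs
    have hc := g.formPerm_toList b
    have hac : a ∉ g.toList b := by
      rw [Equiv.Perm.mem_toList_iff]
      rintro ⟨h, -⟩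
      exact hb (h.apply_eq_self_iff.2 ha)
    have hsc : (g.cycleOf b).support = (g.toList b).toFinset := by
      rw [← hc, List.support_formPerm_of_nodup _ hnd (fun x => g.toList_ne_singleton b x)]
    set c := g.cycleOf b with hcdef
    rw [hl] at hnd hlen hc hac hsc
    have hr : Equiv.Perm.Disjoint (g * c⁻¹) c :=
      Equiv.Perm.disjoint_mul_inv_of_mem_cycleFactorsFinset
        (Equiv.Perm.cycleOf_mem_cycleFactorsFinset_iff.2 hbs)
    have hg : g = c * (g * c⁻¹) := by
      rw [← hr.commute.eq]; simp
    set r := g * c⁻¹ with hrdef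
    have hd' : (Equiv.swap a b * c) = (a :: b :: l).formPerm := by
      rw [List.formPerm_cons_cons, hc]
    have hnd' : (a :: b :: l).Nodup := List.nodup_cons.2 ⟨hac, hnd⟩
    have hs' : (Equiv.swap a b * c).support = (a :: b :: l).toFinset := by
      rw [hd', List.support_formPerm_of_nodup _ hnd' (by simp)]
    have hcard : (Equiv.swap a b * c).support.card = c.support.card + 1 := by
      rw [hs', hsc, List.toFinset_cons, Finset.card_insert_of_notMem (by simpa using hac)]
    have hcyc : (Equiv.swap a b * c).IsCycle := by
      rw [hd']; exact List.isCycle_formPerm hnd' (by simp)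
    have hcyc' : c.IsCycle := by
      rw [← hc]; exact List.isCycle_formPerm hnd hlen
    have hca : c a = a := by
      rw [← Equiv.Perm.notMem_support, hsc]; simpa using hac
    have hra : r a = a := by
      have : c⁻¹ a = a := by rw [Equiv.Perm.inv_eq_iff_eq, hca]
      rw [hrdef, Equiv.Perm.mul_apply, this, ha]
    have hdis : Equiv.Perm.Disjoint (Equiv.swap a b * c) r := by
      rw [Equiv.Perm.disjoint_iff_disjoint_support, hs', List.toFinset_cons, ← hsc,
        Finset.disjoint_insert_left]
      exact ⟨by simpa using hra, Equiv.Perm.disjoint_iff_disjoint_support.1 hr.symm⟩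
    have e1 : Equiv.swap a b * g = (Equiv.swap a b * c) * r := by
      rw [mul_assoc, ← hg]
    have h1 := hle (Equiv.swap a b * g)
    rw [e1, hdis.card_support_mul, hcard] at h1
    rw [e1, hdis.cycleType_mul, hdis.card_support_mul, hcyc.cycleType, hcard]
    conv_rhs => rw [hg, hr.symm.cycleType_mul, hr.symm.card_support_mul, hcyc'.cycleType]
    simp only [Multiset.card_add, Multiset.card_singleton]
    omega

theorem card_parts_partition_decomposeFin {n : ℕ} (p : Fin (n + 1)) (e : Equiv.Perm (Fin n)) :
    Multiset.card (Equiv.Perm.decomposeFin.symm (p, e)).partition.parts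
      = Multiset.card e.partition.parts + if p = 0 then 1 else 0 := by
  have h0 : Equiv.Perm.decomposeFin.symm (0, e) = e.extendDomain (finSuccAboveEquiv 0) := by
    ext i
    refine Fin.cases ?_ (fun j => ?_) i
    · rw [Equiv.Perm.extendDomain_apply_not_subtype _ _ (by simp)]; simp
    · have := Equiv.Perm.extendDomain_apply_image e (finSuccAboveEquiv (0 : Fin (n+1))) j
      simp only [finSuccAboveEquiv_apply, Fin.succAbove_zero] at this
      rw [this]; simp
  have hz : Multiset.card (Equiv.Perm.decomposeFin.symm (0, e)).partition.parts
      = Multiset.card e.partition.parts + 1 := by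
    have : e.support.card ≤ n := by simpa using Finset.card_le_univ e.support
    rw [h0]
    simp only [Equiv.Perm.parts_partition, Multiset.card_add, Multiset.card_replicate,
      Equiv.Perm.cycleType_extendDomain, Equiv.Perm.card_support_extend_domain, Fintype.card_fin]
    omega
  split_ifs with hp
  · rw [hp, hz]
  · have hs : Equiv.Perm.decomposeFin.symm (p, e)
        = Equiv.swap 0 p * Equiv.Perm.decomposeFin.symm (0, e) := by
      ext i
      refine Fin.cases ?_ (fun j => ?_) i <;> simp
    have := card_parts_partition_swap_mul (Equiv.Perm.decomposeFin.symm (0, e)) 0 p (by simp)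
      (Ne.symm hp)
    rw [← hs, hz] at this
    omega

theorem sum_pow_card_parts_partition (θ : ℝ) (n : ℕ) :
    ∑ σ : Equiv.Perm (Fin n), θ ^ Multiset.card σ.partition.parts
      = ∏ i ∈ Finset.range n, (θ + i) := by
  induction n with
  | zero => simp [Equiv.Perm.parts_partition]
  | succ n ih =>
    rw [← Equiv.Perm.decomposeFin.symm.sum_comp, Fintype.sum_prod_type, Fin.sum_univ_succ,
      Finset.prod_range_succ, ← ih]
    simp only [card_parts_partition_decomposeFin, Fin.succ_ne_zero, if_true, if_false, pow_succ,
      add_zero, Finset.sum_const, Finset.card_univ, Fintype.card_fin, nsmul_eq_mul,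
      ← Finset.sum_mul]
    ring

/-! ### Cycle counts and the Ewens measure -/

/-- `cycleCount σ m` is the number of cycles of length `m` of `σ`; fixed points are cycles of
length one (`σ.partition` is the full cycle type of `σ`, fixed points included). -/
def cycleCount {n : ℕ} (σ : Equiv.Perm (Fin n)) (m : ℕ) : ℕ :=
  σ.partition.parts.count m

/-- The total number of cycles of `σ`, fixed points included. -/
def numCycles {n : ℕ} (σ : Equiv.Perm (Fin n)) : ℕ :=
  Multiset.card σ.partition.parts

/-- The symmetric group carries the discrete `σ`-algebra. -/
instance permMeasurableSpace (n : ℕ) : MeasurableSpace (Equiv.Perm (Fin n)) := ⊤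

instance permDiscreteMeasurableSpace (n : ℕ) :
    DiscreteMeasurableSpace (Equiv.Perm (Fin n)) := ⟨fun _ => trivial⟩

/-- The Ewens weight `θ ^ ℓ(σ) / (θ (θ + 1) ⋯ (θ + n - 1))`, where `ℓ(σ)` is the number of
cycles. -/
noncomputable def ewensWeight (θ : ℝ) {n : ℕ} (σ : Equiv.Perm (Fin n)) : ℝ :=
  θ ^ numCycles σ / ∏ i ∈ Finset.range n, (θ + i)

/-- The Ewens measure on `S_n` with parameter `θ > 0`. -/
noncomputable def ewensMeasure (θ : ℝ) (_hθ : 0 < θ) (n : ℕ) : Measure (Equiv.Perm (Fin n)) :=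
  ∑ σ : Equiv.Perm (Fin n), ENNReal.ofReal (ewensWeight θ σ) • Measure.dirac σ

instance isProbabilityMeasure_ewensMeasure (θ : ℝ) (hθ : 0 < θ) (n : ℕ) :
    IsProbabilityMeasure (ewensMeasure θ hθ n) := by
  have hpos : 0 < ∏ i ∈ Finset.range n, (θ + i) := Finset.prod_pos fun i _ => by positivity
  have hnn : ∀ σ : Equiv.Perm (Fin n), 0 ≤ ewensWeight θ σ := fun σ => by
    unfold ewensWeight; positivity
  constructor
  simp only [ewensMeasure, Measure.coe_finsetSum, Finset.sum_apply, Measure.smul_apply,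
    measure_univ, smul_eq_mul, mul_one]
  rw [← ENNReal.ofReal_sum_of_nonneg fun σ _ => hnn σ]
  simp only [ewensWeight, numCycles, ← Finset.sum_div, sum_pow_card_parts_partition]
  rw [div_self hpos.ne', ENNReal.ofReal_one]

/-! ### Multiplicative class functions -/

/-- `f` is real analytic on the unit circle, seen as a real analytic manifold. -/
def RealAnalyticOnCircle (f : Circle → ℂ) : Prop :=
  ContMDiff (𝓡 1) 𝓘(ℝ, ℂ) ω f

/-- `w^n(f)(x)(σ) = ∑_{m=1}^n C_m(σ) log (f (x ^ m))`, the logarithm of the multiplicative class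
function `∏_{m=1}^n f (x ^ m) ^ C_m(σ)`. Here `Complex.log` is the principal branch, with
`log (-y) = log y + i π` for `y > 0`. It is only used where `f (x ^ m) ≠ 0`. -/
noncomputable def logClassFun (f : Circle → ℂ) (x : Circle) {n : ℕ}
    (σ : Equiv.Perm (Fin n)) : ℂ :=
  ∑ m ∈ Finset.Icc 1 n, (cycleCount σ m : ℂ) * Complex.log (f (x ^ m))

/-- The function `s ↦ log (f (exp (2 π i s)))`. -/
noncomputable def logOnCircle (f : Circle → ℂ) (s : ℝ) : ℂ :=
  Complex.log (f (Circle.exp (2 * Real.pi * s)))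

open Classical in
/-- The logarithmic Mahler measure `m(f)(x)`: the mean of `log f` over the closed subgroup
generated by `x`, that is, over the powers of `x` if `x` is a root of unity, and over the whole
circle otherwise. It is only used where the sum has no term `log 0`, respectively where the
integral converges. -/
noncomputable def logMahler (f : Circle → ℂ) (x : Circle) : ℂ :=
  if IsOfFinOrder x then
    (1 / (orderOf x : ℂ)) * ∑ m ∈ Finset.Icc 1 (orderOf x), Complex.log (f (x ^ m))
  else ∫ s in (0 : ℝ)..1, logOnCircle f s

/-- The random variable `w^n(f)(x) / √(log n) - θ √(log n) m(f)(x)` on `S_n`. -/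
noncomputable def normalizedLog (θ : ℝ) (f : Circle → ℂ) (x : Circle) (n : ℕ)
    (σ : Equiv.Perm (Fin n)) : ℂ :=
  logClassFun f x σ / (√(Real.log n) : ℂ) - (θ : ℂ) * (√(Real.log n) : ℂ) * logMahler f x

/-! ### Finite type -/

/-- The distance of `s` to the nearest integer. -/
noncomputable def distNearestInt (s : ℝ) : ℝ :=
  min (Int.fract s) (1 - Int.fract s)

/-- `x = exp (2 π i t)` is of finite type: for some `K, γ > 0`, the distance of `m t` to the
nearest integer exceeds `K / |m| ^ γ` for all integers `m ≠ 0`. -/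
def IsFiniteType (x : Circle) : Prop :=
  ∃ t : ℝ, x = Circle.exp (2 * Real.pi * t) ∧
    ∃ K γ : ℝ, 0 < K ∧ 0 < γ ∧
      ∀ m : ℤ, m ≠ 0 → K / |(m : ℝ)| ^ γ < distNearestInt (m * t)

end EwensCLT

/-! The proof computes characteristic functions. For a real linear form `φ` on `ℂ`, put `c m = φ
(log (f (x ^ m)))`. The Ewens mean of `exp (i α ∑ C_m c_m)` is a mean `φ_n` of `∏ t_m ^ C_m` with
`t_m = exp (i α c_m)`. With `p_n = θ (θ + 1) ⋯ (θ + n - 1) / n!`, Cauchy's count of permutations of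
given cycle type yields the renewal equation `n p_n φ_n = θ ∑_{j < n} p_j t_{n - j} φ_j`
(`ewensMean_rec`). For a constant weight `s` its solution is the explicit product `∏ (θ s + j) / (θ
+ j)`, which is close to `exp ((s - 1) H_n)`, where `H_n = θ log n + O(1)` is the mean number of
cycles.

Let `μ` and `ν` be the limiting averages of `c` and `c ^ 2`, and let `s` agree with `1 + i α μ - α ^
2 ν / 2` up to `O(α ^ 3)`. The weights `t_m` then fit `s` on average, and a discrete Gronwall
argument (`norm_ewensMean_sub_le`) bounds the total error by `O(|α| + |α| ^ 3 (1 + H_n))`, provided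
that the averages of `c`, `c ^ 2`, `c ^ 4` converge with a power saving and `c` grows more slowly
than every power. At `α = u / √(log n)` the error vanishes and the product gives the drift `i u θ μ
√(log n)` and the Gaussian factor `exp (-θ ν u ^ 2 / 2)` (`tendsto_exp_mul_ewensMean`). The
uncentred moment `ν` appears because the number of cycles itself fluctuates.

At a root of unity `c` is periodic and the hypotheses on `c` are immediate. At a point of finite
type, Dirichlet approximations `a / q` to `t` have denominators bounded below by a power of `N`,
which gives equidistribution with a power saving for Lipschitz functions (`exists_abs_sum_sub_le`).
The function `log f` is singular at zeros of `f` and at crossings of the branch cut; it is cut off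
near the zeros of the gauge `|F · Im F|` (`|F|` if `F` is real), whose small negative powers are
integrable (`IsTame.hasPowerMean`). Since the zeros of `f` are roots of unity, finite type keeps `f
(x ^ m)` above a negative power of `m`, so `log f (x ^ m)` grows subpolynomially.

All forms `φ` together determine the Gaussian limit; its covariance is `θ` times the mean of `Re log
f · Im log f = Im (log² f) / 2`. -/

namespace EwensCLT

/-! ### The recursion for multiplicative statistics of the cycle type -/

/-- The weight `∏ (a m / m) ^ c_m / c_m!` of a multiset with multiplicities `c_m`. -/
noncomputable def cycleWeight (a : ℕ → ℂ) (s : Multiset ℕ) : ℂ :=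
  ∏ m ∈ s.toFinset, (a m / m) ^ s.count m / (s.count m).factorial

/-- One more copy of `m` multiplies the weight by `a m / m` and divides it by the new multiplicity;
the prefactor cancels both denominators. -/
theorem cycleWeight_cons (a : ℕ → ℂ) {m : ℕ} (hm : m ≠ 0) (s : Multiset ℕ) :
    ((m ::ₘ s).count m * m : ℂ) * cycleWeight a (m ::ₘ s) = a m * cycleWeight a s := by
  have h1 : cycleWeight a s
      = ∏ i ∈ insert m s.toFinset, (a i / i) ^ s.count i / (s.count i).factorial := by
    refine Finset.prod_subset (Finset.subset_insert _ _) fun i _ hi => ?_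
    have : s.count i = 0 := by simpa using hi
    simp [this]
  have h2 : cycleWeight a (m ::ₘ s)
      = (a m / m) ^ (s.count m + 1) / (s.count m + 1).factorial
        * ∏ i ∈ s.toFinset.erase m, (a i / i) ^ s.count i / (s.count i).factorial := by
    rw [cycleWeight, Multiset.toFinset_cons, ← Finset.mul_prod_erase _ _ (Finset.mem_insert_self m _),
      Finset.erase_insert_eq_erase]
    congr 1
    · simp
    · refine Finset.prod_congr rfl fun i hi => ?_
      rw [Multiset.count_cons_of_ne (Finset.ne_of_mem_erase hi)]
  rw [h1, h2, ← Finset.mul_prod_erase _ _ (Finset.mem_insert_self m _),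
    Finset.erase_insert_eq_erase, Multiset.count_cons_self, Nat.factorial_succ]
  have hm' : (m : ℂ) ≠ 0 := by exact_mod_cast hm
  have ha : a m = a m / m * m := (div_mul_cancel₀ _ hm').symm
  have hf : ((s.count m).factorial : ℂ) ≠ 0 := by exact_mod_cast (Nat.factorial_ne_zero _)
  have hc : ((s.count m : ℂ) + 1) ≠ 0 := by exact_mod_cast (Nat.succ_ne_zero (s.count m))
  generalize a m / m = q at *
  rw [ha, pow_succ]
  push_cast
  field_simp

/-- Adding a part to a partition. -/
def consPartition {n m : ℕ} (hm : m ∈ Finset.Icc 1 n) (ν : (n - m).Partition) : n.Partition where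
  parts := m ::ₘ ν.parts
  parts_pos {i} hi := by
    rcases Multiset.mem_cons.1 hi with rfl | h
    · exact (Finset.mem_Icc.1 hm).1
    · exact ν.parts_pos h
  parts_sum := by
    rw [Multiset.sum_cons, ν.parts_sum]
    have := Finset.mem_Icc.1 hm
    omega

/-- Adding a part `m` is a bijection onto the partitions of `n` that contain `m`, and all other
partitions have multiplicity zero on the left. -/
theorem sum_count_mul_cycleWeight (a : ℕ → ℂ) {n m : ℕ} (hm : m ∈ Finset.Icc 1 n) :
    ∑ p : n.Partition, (p.parts.count m * m : ℂ) * cycleWeight a p.parts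
      = a m * ∑ ν : (n - m).Partition, cycleWeight a ν.parts := by
  have hm' := Finset.mem_Icc.1 hm
  rw [Finset.mul_sum]
  symm
  refine Finset.sum_of_injOn (consPartition hm) ?_ (by simp) ?_ ?_
  · intro ν _ ν' _ h
    have := congrArg Nat.Partition.parts h
    exact Nat.Partition.ext ((Multiset.cons_inj_right m).1 this)
  · intro p _ hp
    have : m ∉ p.parts := by
      intro hmp
      refine hp ⟨⟨p.parts.erase m, fun hi => p.parts_pos (Multiset.mem_of_mem_erase hi), ?_⟩,
        by simp, ?_⟩
      · have h := congrArg Multiset.sum (Multiset.cons_erase hmp)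
        rw [Multiset.sum_cons, p.parts_sum] at h
        omega
      · ext1
        exact Multiset.cons_erase hmp
    rw [Multiset.count_eq_zero_of_notMem this]
    simp
  · intro ν _
    exact (cycleWeight_cons a (by omega) ν.parts).symm

/-- Sum the preceding identity over `m` and use `∑ m c_m = n`. In generating functions this is `z G'
= (∑ a_m z ^ m) G` for `G = exp (∑ a_m z ^ m / m)`. -/
theorem nat_mul_sum_cycleWeight (a : ℕ → ℂ) (n : ℕ) :
    (n : ℂ) * ∑ p : n.Partition, cycleWeight a p.parts
      = ∑ m ∈ Finset.Icc 1 n, a m * ∑ ν : (n - m).Partition, cycleWeight a ν.parts := by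
  rw [Finset.sum_congr rfl fun m hm => (sum_count_mul_cycleWeight a hm).symm, Finset.sum_comm,
    Finset.mul_sum]
  refine Finset.sum_congr rfl fun p _ => ?_
  rw [← Finset.sum_mul]
  congr 1
  have h : (∑ m ∈ Finset.Icc 1 n, p.parts.count m * m) = n := by
    conv_rhs => rw [← p.parts_sum, Finset.sum_multiset_count]
    symm
    simp only [smul_eq_mul]
    refine Finset.sum_subset (fun i hi => ?_) fun i _ hi => ?_
    · have hi' := Multiset.mem_toFinset.1 hi
      exact Finset.mem_Icc.2 ⟨p.parts_pos hi', Nat.Partition.le_of_mem_parts hi'⟩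
    · rw [Multiset.count_eq_zero_of_notMem (by simpa using hi), zero_mul]
  exact_mod_cast h.symm

/-! ### Cauchy's formula for the number of permutations with a given cycle type -/

/-- `cycleType` forgets the fixed points, but their number is recovered from the total size. -/
theorem partition_eq_iff_cycleType_eq {α : Type*} [Fintype α] [DecidableEq α]
    (p : (Fintype.card α).Partition) (σ : Equiv.Perm α) :
    σ.partition = p ↔ σ.cycleType = p.parts.filter (2 ≤ ·) := by
  constructor
  · rintro rfl
    exact (Equiv.Perm.filter_parts_partition_eq_cycleType).symm
  · intro h
    have h2 : p.parts.filter (fun i => ¬ 2 ≤ i)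
        = Multiset.replicate (Multiset.card (p.parts.filter (fun i => ¬ 2 ≤ i))) 1 := by
      refine Multiset.eq_replicate_card.2 fun b hb => ?_
      have hb' := Multiset.mem_filter.1 hb
      have := p.parts_pos hb'.1
      omega
    have h3 := Multiset.filter_add_not (fun i => 2 ≤ i) p.parts
    have h4 := congrArg Multiset.sum h3
    rw [Multiset.sum_add, p.parts_sum, h2, Multiset.sum_replicate] at h4
    ext1
    rw [Equiv.Perm.parts_partition, ← Equiv.Perm.sum_cycleType, h]
    conv_rhs => rw [← h3, h2]
    congr 2
    simp only [smul_eq_mul, mul_one] at h4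
    omega

theorem card_partition_eq_mul {α : Type*} [Fintype α] [DecidableEq α]
    (p : (Fintype.card α).Partition) :
    (Finset.univ.filter fun σ : Equiv.Perm α => σ.partition = p).card *
      (p.parts.prod * ∏ i ∈ p.parts.toFinset, (p.parts.count i).factorial)
      = (Fintype.card α).factorial := by
  set s := p.parts.filter (2 ≤ ·) with hs
  have key := Equiv.Perm.card_of_cycleType_mul_eq (α := α) s
  have h2 : p.parts.filter (fun i => ¬ 2 ≤ i)
      = Multiset.replicate (p.parts.count 1) 1 := by
    have : ∀ b ∈ p.parts, (¬ 2 ≤ b ↔ b = 1) := fun b hb => by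
      have := p.parts_pos hb
      omega
    rw [Multiset.filter_congr this, Multiset.filter_eq']
  have h3 : s + Multiset.replicate (p.parts.count 1) 1 = p.parts := by
    rw [← h2]
    exact Multiset.filter_add_not _ p.parts
  have hsum : s.sum + p.parts.count 1 = Fintype.card α := by
    have := congrArg Multiset.sum h3
    rw [Multiset.sum_add, p.parts_sum, Multiset.sum_replicate] at this
    simpa using this
  have hprod : s.prod = p.parts.prod := by
    have := congrArg Multiset.prod h3
    rw [Multiset.prod_add, Multiset.prod_replicate] at this
    simpa using this
  have hcount : (p.parts.count 1).factorial * ∏ i ∈ s.toFinset, (s.count i).factorial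
      = ∏ i ∈ p.parts.toFinset, (p.parts.count i).factorial := by
    have hsub : ∏ i ∈ p.parts.toFinset, (p.parts.count i).factorial
        = ∏ i ∈ insert 1 s.toFinset, (p.parts.count i).factorial := by
      refine Finset.prod_subset (fun i hi => ?_) fun i _ hi => ?_
      · have hi' := Multiset.mem_toFinset.1 hi
        have := p.parts_pos hi'
        by_cases h : i = 1
        · simp [h]
        · refine Finset.mem_insert_of_mem (Multiset.mem_toFinset.2
            (Multiset.mem_filter.2 ⟨hi', by omega⟩))
      · rw [Multiset.count_eq_zero_of_notMem (by simpa using hi), Nat.factorial_zero]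
    have h1s : 1 ∉ s.toFinset := by simp [hs]
    rw [hsub, Finset.prod_insert h1s]
    congr 1
    refine Finset.prod_congr rfl fun i hi => ?_
    rw [hs, Multiset.count_filter_of_pos (Multiset.mem_filter.1 (Multiset.mem_toFinset.1 hi)).2]
  rw [if_pos ⟨by omega, fun a ha => (Multiset.mem_filter.1 ha).2⟩,
    show Fintype.card α - s.sum = p.parts.count 1 by omega] at key
  rw [← key, ← hcount, hprod]
  simp only [partition_eq_iff_cycleType_eq, ← hs]
  ring

/-- The summand depends only on the partition, whose fibre has `n! / ∏ m ^ c_m c_m!` elements by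
Cauchy's formula. -/
theorem sum_prod_map_parts {α : Type*} [Fintype α] [DecidableEq α] (a : ℕ → ℂ) :
    ∑ σ : Equiv.Perm α, (σ.partition.parts.map a).prod
      = (Fintype.card α).factorial *
        ∑ p : (Fintype.card α).Partition, cycleWeight a p.parts := by
  rw [← Finset.sum_fiberwise_of_maps_to (s := Finset.univ) (t := Finset.univ)
    (g := fun σ : Equiv.Perm α => σ.partition) (fun _ _ => Finset.mem_univ _), Finset.mul_sum]
  refine Finset.sum_congr rfl fun p _ => ?_
  rw [Finset.sum_congr rfl (g := fun _ => (p.parts.map a).prod)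
    (fun σ hσ => by rw [(Finset.mem_filter.1 hσ).2]), Finset.sum_const, nsmul_eq_mul,
    ← card_partition_eq_mul p, cycleWeight, Finset.prod_div_distrib]
  have hf : (∏ i ∈ p.parts.toFinset, ((p.parts.count i).factorial : ℂ)) ≠ 0 :=
    Finset.prod_ne_zero_iff.2 fun i _ => by exact_mod_cast Nat.factorial_ne_zero _
  have hp : ((p.parts.prod : ℕ) : ℂ) ≠ 0 := by
    have : p.parts.prod ≠ 0 := Multiset.prod_ne_zero fun h => (p.parts_pos h).ne' rfl
    exact_mod_cast this
  have h1 : ∏ i ∈ p.parts.toFinset, (a i / i) ^ p.parts.count i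
      = (p.parts.map a).prod / (p.parts.prod : ℕ) := by
    simp only [div_pow, Finset.prod_div_distrib]
    rw [Finset.prod_multiset_map_count, Finset.prod_multiset_count p.parts]
    push_cast
    rfl
  rw [h1, Nat.cast_mul, Nat.cast_mul, Nat.cast_prod]
  field_simp

/-- `∏_{j < n} (θ + j) / (j + 1)`, the coefficient of `z ^ n` in `(1 - z) ^ (-θ)`. -/
noncomputable def risingBinom (θ : ℝ) (n : ℕ) : ℝ := ∏ j ∈ Finset.range n, (θ + j) / (j + 1)

theorem risingBinom_pos {θ : ℝ} (hθ : 0 < θ) (n : ℕ) : 0 < risingBinom θ n :=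
  Finset.prod_pos fun _ _ => by positivity

theorem risingBinom_eq (θ : ℝ) (n : ℕ) :
    risingBinom θ n = (∏ j ∈ Finset.range n, (θ + j)) / n.factorial := by
  rw [risingBinom, Finset.prod_div_distrib, ← Finset.prod_range_add_one_eq_factorial]
  push_cast
  rfl

/-- The expectation of `∏ t_m ^ C_m` under the Ewens measure. -/
noncomputable def ewensMean (θ : ℝ) (t : ℕ → ℂ) (n : ℕ) : ℂ :=
  ∑ σ : Equiv.Perm (Fin n), (ewensWeight θ σ : ℂ) * (σ.partition.parts.map t).prod

/-- The factor `θ ^ ℓ(σ)` is absorbed into the cycle weights, and `risingBinom` is the Ewens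
normalisation over `n!`. -/
theorem risingBinom_mul_ewensMean {θ : ℝ} (hθ : 0 < θ) (t : ℕ → ℂ) (n : ℕ) :
    (risingBinom θ n : ℂ) * ewensMean θ t n
      = ∑ p : n.Partition, cycleWeight (fun m => θ * t m) p.parts := by
  have h := sum_prod_map_parts (α := Fin n) (fun m => θ * t m)
  -- The type of partitions depends on `Fintype.card (Fin n)`, so the equality with `n` is
  -- eliminated in a general form.
  have hcard : ∀ k, k = n → (k.factorial : ℂ) *
      ∑ p : k.Partition, cycleWeight (fun m => θ * t m) p.parts
      = n.factorial * ∑ p : n.Partition, cycleWeight (fun m => θ * t m) p.parts := by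
    rintro _ rfl
    rfl
  rw [hcard _ (Fintype.card_fin n)] at h
  have hpos : 0 < ∏ i ∈ Finset.range n, (θ + i) := Finset.prod_pos fun i _ => by positivity
  have hP : (((∏ i ∈ Finset.range n, (θ + i) : ℝ)) : ℂ) ≠ 0 := by exact_mod_cast hpos.ne'
  have hn : ((n.factorial : ℕ) : ℂ) ≠ 0 := by exact_mod_cast n.factorial_ne_zero
  have h2 : ewensMean θ t n = (∑ σ : Equiv.Perm (Fin n),
      (σ.partition.parts.map (fun m => θ * t m)).prod) / (∏ i ∈ Finset.range n, (θ + i) : ℝ) := by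
    rw [ewensMean, Finset.sum_div]
    refine Finset.sum_congr rfl fun σ _ => ?_
    rw [Multiset.prod_map_mul, Multiset.map_const', Multiset.prod_replicate, ewensWeight, numCycles]
    push_cast
    ring
  rw [h2, h, risingBinom_eq]
  rw [Complex.ofReal_div, Complex.ofReal_natCast]
  field_simp

theorem ewensMean_zero (θ : ℝ) (t : ℕ → ℂ) : ewensMean θ t 0 = 1 := by
  simp [ewensMean, ewensWeight, numCycles, Equiv.Perm.parts_partition]

/-- Removing a cycle: `n p_n φ_n = θ ∑_{j < n} p_j t_{n - j} φ_j`. -/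
theorem ewensMean_rec {θ : ℝ} (hθ : 0 < θ) (t : ℕ → ℂ) (n : ℕ) :
    (n * risingBinom θ n : ℂ) * ewensMean θ t n
      = θ * ∑ j ∈ Finset.range n, (risingBinom θ j : ℂ) * (t (n - j) * ewensMean θ t j) := by
  rw [mul_assoc, risingBinom_mul_ewensMean hθ, nat_mul_sum_cycleWeight, Finset.mul_sum]
  refine Finset.sum_bij' (fun m _ => n - m) (fun j _ => n - j) ?_ ?_ ?_ ?_ ?_
  · intro m hm
    have := Finset.mem_Icc.1 hm
    exact Finset.mem_range.2 (by omega)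
  · intro j hj
    have := Finset.mem_range.1 hj
    exact Finset.mem_Icc.2 (by omega)
  · intro m hm
    have := Finset.mem_Icc.1 hm
    omega
  · intro j hj
    have := Finset.mem_range.1 hj
    omega
  · intro m hm
    have := Finset.mem_Icc.1 hm
    rw [← risingBinom_mul_ewensMean hθ, show n - (n - m) = m by omega]
    ring


/-! ### Weighted averages with the cycle length weights -/

theorem exists_pos_bounds_of_tendsto {u : ℕ → ℝ} {l : ℝ} (hu : ∀ n, 0 < u n) (hl : 0 < l)
    (h : Tendsto u atTop (𝓝 l)) : ∃ c₁ c₂, 0 < c₁ ∧ 0 < c₂ ∧ ∀ n, c₁ ≤ u n ∧ u n ≤ c₂ := by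
  obtain ⟨b, hb⟩ := h.bddAbove_range
  obtain ⟨b', hb'⟩ := (h.inv₀ hl.ne').bddAbove_range
  have h1 : ∀ n, u n ≤ b := fun n => hb ⟨n, rfl⟩
  have h2 : ∀ n, (u n)⁻¹ ≤ b' := fun n => hb' ⟨n, rfl⟩
  have hb0 : 0 < b := (hu 0).trans_le (h1 0)
  have hb0' : 0 < b' := (inv_pos.2 (hu 0)).trans_le (h2 0)
  exact ⟨b'⁻¹, b, inv_pos.2 hb0', hb0, fun n => ⟨(inv_le_comm₀ (hu n) hb0').1 (h2 n), h1 n⟩⟩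

/-- Euler's limit for the Gamma function gives `p_n n ^ (1 - θ) → 1 / Γ(θ) > 0`, and a positive
sequence with a positive limit lies between two positive constants. -/
theorem exists_risingBinom_bounds {θ : ℝ} (hθ : 0 < θ) :
    ∃ c₁ c₂, 0 < c₁ ∧ 0 < c₂ ∧ ∀ n : ℕ, n ≠ 0 →
      c₁ * (n : ℝ) ^ (θ - 1) ≤ risingBinom θ n ∧ risingBinom θ n ≤ c₂ * (n : ℝ) ^ (θ - 1) := by
  have hG : Tendsto (fun n : ℕ => (((n : ℝ) / (n + 1)) ^ θ) / Real.GammaSeq θ n) atTop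
      (𝓝 (1 ^ θ / Real.Gamma θ)) :=
    ((tendsto_natCast_div_add_atTop (1 : ℝ)).rpow_const (Or.inl one_ne_zero)).div
      (Real.GammaSeq_tendsto_Gamma θ) (Real.Gamma_pos_of_pos hθ).ne'
  -- `GammaSeq θ n` has `n + 1` factors in its denominator, hence the shift to `p_{n+1}` and the
  -- correction `(n / (n + 1)) ^ θ`.
  have heq : ∀ᶠ n : ℕ in atTop, (((n : ℝ) / (n + 1)) ^ θ) / Real.GammaSeq θ n
      = risingBinom θ (n + 1) / ((n + 1 : ℕ) : ℝ) ^ (θ - 1) := by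
    filter_upwards [eventually_gt_atTop 0] with n hn
    have hn' : (0 : ℝ) < n := by exact_mod_cast hn
    have hpos : 0 < ∏ i ∈ Finset.range (n + 1), (θ + i) := Finset.prod_pos fun i _ => by positivity
    have hf : (0 : ℝ) < n.factorial := by exact_mod_cast n.factorial_pos
    rw [risingBinom_eq, Real.GammaSeq, Real.div_rpow hn'.le (by positivity), Nat.factorial_succ]
    push_cast
    rw [Real.rpow_sub_one (by positivity)]
    have h1 : (0 : ℝ) < (n : ℝ) ^ θ := by positivity
    have h2 : (0 : ℝ) < ((n : ℝ) + 1) ^ θ := by positivity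
    field_simp
  obtain ⟨c₁, c₂, h1, h2, h⟩ := exists_pos_bounds_of_tendsto
    (u := fun n : ℕ => risingBinom θ (n + 1) / ((n + 1 : ℕ) : ℝ) ^ (θ - 1))
    (fun n => div_pos (risingBinom_pos hθ _) (by positivity))
    (by have := Real.Gamma_pos_of_pos hθ; positivity) (hG.congr' heq)
  refine ⟨c₁, c₂, h1, h2, fun n hn => ?_⟩
  obtain ⟨m, rfl⟩ := Nat.exists_eq_succ_of_ne_zero hn
  have hp : (0 : ℝ) < ((m + 1 : ℕ) : ℝ) ^ (θ - 1) := by positivity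
  exact ⟨(le_div_iff₀ hp).1 (h m).1, (div_le_iff₀ hp).1 (h m).2⟩

theorem risingBinom_succ (θ : ℝ) (n : ℕ) :
    risingBinom θ (n + 1) = risingBinom θ n * ((θ + n) / (n + 1)) :=
  Finset.prod_range_succ _ _

theorem succ_mul_risingBinom_succ (θ : ℝ) (n : ℕ) :
    ((n + 1 : ℕ) : ℝ) * risingBinom θ (n + 1) = (θ + n) * risingBinom θ n := by
  rw [risingBinom_succ]
  push_cast
  field_simp

/-- This makes the weights in `cycleAvg` sum to one. -/
theorem mul_sum_risingBinom (θ : ℝ) (n : ℕ) :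
    θ * ∑ j ∈ Finset.range n, risingBinom θ j = n * risingBinom θ n := by
  induction n with
  | zero => simp
  | succ n ih =>
    rw [Finset.sum_range_succ, mul_add, ih, succ_mul_risingBinom_succ]
    ring

/-- Summation by parts. -/
theorem sum_Ico_mul_sub (P R : ℕ → ℂ) {J k : ℕ} (h : J ≤ k) :
    ∑ j ∈ Finset.Ico J k, P j * (R j - R (j + 1))
      = P J * R J - P k * R k + ∑ j ∈ Finset.Ico J k, (P (j + 1) - P j) * R (j + 1) := by
  induction k, h using Nat.le_induction with
  | base => simp
  | succ k hk ih =>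
    rw [Finset.sum_Ico_succ_top hk, Finset.sum_Ico_succ_top hk, ih]
    ring

/-- The averages of `c` over `{1, …, N}` tend to `μ` with a power saving. -/
def HasPowerMean (c : ℕ → ℝ) (μ : ℝ) : Prop :=
  ∃ δ C : ℝ, 0 < δ ∧ δ < 1 ∧ ∀ N : ℕ, 1 ≤ N →
    |∑ m ∈ Finset.Icc 1 N, c m - N * μ| ≤ C * (N : ℝ) ^ (1 - δ)

/-- `c` grows more slowly than every power. -/
def IsSubpoly (c : ℕ → ℝ) : Prop :=
  ∀ ε : ℝ, 0 < ε → ∃ C : ℝ, ∀ m : ℕ, 1 ≤ m → |c m| ≤ C * (m : ℝ) ^ ε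

/-- Admissible modulating factors: bounded by one, and such that `p_j Φ_j` varies slowly. -/
def IsSlow (θ : ℝ) (Φ : ℕ → ℂ) : Prop :=
  (∀ j, ‖Φ j‖ ≤ 1) ∧ ∀ j : ℕ, ‖(risingBinom θ (j + 1) : ℂ) * Φ (j + 1) - risingBinom θ j * Φ j‖
    ≤ (θ + 1) * risingBinom θ j / (j + 1)

/-- The average `θ / (n p_n) ∑_{j < n} p_j F_j` of `F` over the size of a random permutation from
which a random cycle has been removed. -/
noncomputable def cycleAvg (θ : ℝ) (F : ℕ → ℂ) (n : ℕ) : ℂ :=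
  (θ / (n * risingBinom θ n) : ℝ) * ∑ j ∈ Finset.range n, (risingBinom θ j : ℂ) * F j

/-- Summation by parts moves the oscillation of `g` into its partial sums, leaving the boundary term
at `J` and the variation of `p_j Φ_j`, which `IsSlow` controls. -/
theorem norm_sum_Ico_le {θ : ℝ} (hθ : 0 < θ) {Φ : ℕ → ℂ} (hΦ : IsSlow θ Φ) {g : ℕ → ℝ}
    {B : ℝ} {J n : ℕ} (hJ : J ≤ n)
    (hB : ∀ j ≤ n, |∑ m ∈ Finset.Icc 1 j, g m| ≤ B) :
    ‖∑ j ∈ Finset.Ico J n, (risingBinom θ j : ℂ) * ((g (n - j) : ℂ) * Φ j)‖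
      ≤ B * (risingBinom θ J + ∑ j ∈ Finset.Ico J n, (θ + 1) * risingBinom θ j / (j + 1)) := by
  have hB0 : 0 ≤ B := (abs_nonneg _).trans (hB 0 (Nat.zero_le _))
  -- As `g` is evaluated at `n - j`, its partial sums run down to the empty sum `R n = 0`, so the
  -- upper boundary term disappears.
  set R : ℕ → ℂ := fun j => ((∑ m ∈ Finset.Icc 1 (n - j), g m : ℝ) : ℂ) with hR
  have hRn : ∀ j, ‖R j‖ ≤ B := fun j => by
    rw [hR, Complex.norm_real]
    exact hB _ (Nat.sub_le _ _)
  have h1 : ∑ j ∈ Finset.Ico J n, (risingBinom θ j : ℂ) * ((g (n - j) : ℂ) * Φ j)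
      = ∑ j ∈ Finset.Ico J n, (risingBinom θ j * Φ j) * (R j - R (j + 1)) := by
    refine Finset.sum_congr rfl fun j hj => ?_
    have hj' := Finset.mem_Ico.1 hj
    have : n - j = n - (j + 1) + 1 := by omega
    simp only [hR]
    rw [this, Finset.sum_Icc_succ_top (by omega)]
    push_cast
    ring
  rw [h1, sum_Ico_mul_sub (fun j => (risingBinom θ j * Φ j : ℂ)) R hJ]
  have hRn0 : R n = 0 := by simp [hR]
  rw [hRn0, mul_zero, sub_zero]
  refine (norm_add_le _ _).trans ?_
  rw [mul_add]
  refine add_le_add ?_ ?_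
  · rw [norm_mul, norm_mul, Complex.norm_real, Real.norm_of_nonneg (risingBinom_pos hθ J).le,
      mul_comm B]
    refine mul_le_mul ?_ (hRn J) (norm_nonneg _) (risingBinom_pos hθ J).le
    exact mul_le_of_le_one_right (risingBinom_pos hθ J).le (hΦ.1 J)
  · rw [Finset.mul_sum]
    refine (norm_sum_le _ _).trans (Finset.sum_le_sum fun j _ => ?_)
    rw [norm_mul, mul_comm B]
    exact mul_le_mul (hΦ.2 j) (hRn _) (norm_nonneg _)
      (by have := risingBinom_pos hθ j; positivity)

theorem norm_sum_range_le {θ : ℝ} (hθ : 0 < θ) {Φ : ℕ → ℂ} (hΦ : IsSlow θ Φ) {g : ℕ → ℝ}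
    {B : ℝ} {J n : ℕ} (hJ : J ≤ n) (hB : ∀ m ∈ Finset.Icc 1 n, |g m| ≤ B) :
    ‖∑ j ∈ Finset.range J, (risingBinom θ j : ℂ) * ((g (n - j) : ℂ) * Φ j)‖
      ≤ B * (J * risingBinom θ J / θ) := by
  rw [← mul_sum_risingBinom, mul_div_cancel_left₀ _ hθ.ne', Finset.mul_sum]
  refine (norm_sum_le _ _).trans (Finset.sum_le_sum fun j hj => ?_)
  have hj' := Finset.mem_range.1 hj
  have h1 := hB (n - j) (Finset.mem_Icc.2 (by omega))
  have h2 := risingBinom_pos hθ j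
  rw [norm_mul, norm_mul, Complex.norm_real, Complex.norm_real, Real.norm_of_nonneg h2.le,
    Real.norm_eq_abs, mul_comm B]
  refine mul_le_mul_of_nonneg_left ?_ h2.le
  calc |g (n - j)| * ‖Φ j‖ ≤ B * 1 :=
        mul_le_mul h1 (hΦ.1 j) (norm_nonneg _) ((abs_nonneg _).trans h1)
    _ = B := mul_one B

/-- Split at `J ≈ n ^ (1 - κ)`. Above `J`, summation by parts gains `n ^ (-δ)` and loses at most `n
^ (2 κ)`. Below `J` the weights have mass `O(n ^ (-κ θ))`, which beats the subpolynomial size of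
`g`. The constants do not depend on `Φ`; this matters because `Φ` will vary with `α`. -/
theorem exists_norm_cycleAvg_le {θ : ℝ} (hθ : 0 < θ) {g : ℕ → ℝ} (hg : HasPowerMean g 0)
    (hs : IsSubpoly g) :
    ∃ δ C : ℝ, 0 < δ ∧ 0 ≤ C ∧ ∀ Φ : ℕ → ℂ, IsSlow θ Φ → ∀ n : ℕ, 1 ≤ n →
      ‖cycleAvg θ (fun j => (g (n - j) : ℂ) * Φ j) n‖ ≤ C * (n : ℝ) ^ (-δ) := by
  obtain ⟨δ, C₀, hδ, hδ1, hC₀⟩ := hg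
  obtain ⟨c₁, c₂, hc₁, hc₂, hp⟩ := exists_risingBinom_bounds hθ
  -- The loss `2 κ` uses half of the saving `δ`; likewise the growth exponent `κ θ / 2` below uses
  -- half of the small mass `n ^ (-κ θ)`.
  set κ := δ / 4 with hκ
  have hκ0 : 0 < κ := by positivity
  obtain ⟨C₁, hC₁⟩ := hs (κ * θ / 2) (by positivity)
  have hC₀n : 0 ≤ C₀ := by
    have := (abs_nonneg _).trans (hC₀ 1 le_rfl)
    simpa using this
  have hC₁n : 0 ≤ C₁ := by
    have := (abs_nonneg _).trans (hC₁ 1 le_rfl)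
    simpa using this
  set δ' := min (δ / 2) (κ * θ / 2) with hδ'
  refine ⟨δ', (θ / c₁) * (C₀ * (c₂ + (θ + 1) * c₂) + C₁ * (c₂ * 2 ^ θ / θ)), by positivity,
    by positivity, fun Φ hΦ n hn => ?_⟩
  have hN1 : (1 : ℝ) ≤ n := by exact_mod_cast hn
  have hN0 : (0 : ℝ) < n := by linarith
  set N : ℝ := (n : ℝ) with hNdef
  set J := ⌈N ^ (1 - κ)⌉₊ with hJdef
  have hX1 : 1 ≤ N ^ (1 - κ) := Real.one_le_rpow hN1 (by linarith)
  have hJX : N ^ (1 - κ) ≤ J := Nat.le_ceil _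
  have hJ1 : (1 : ℝ) ≤ J := hX1.trans hJX
  have hJ0 : (0 : ℝ) < J := by linarith
  have hJne : J ≠ 0 := by exact_mod_cast hJ0.ne'
  have hJn : J ≤ n := by
    refine Nat.ceil_le.2 ?_
    calc N ^ (1 - κ) ≤ N ^ (1 : ℝ) := Real.rpow_le_rpow_of_exponent_le hN1 (by linarith)
      _ = n := Real.rpow_one _
  have hJ2 : (J : ℝ) ≤ 2 * N ^ (1 - κ) := by
    have := Nat.ceil_lt_add_one (zero_le_one.trans hX1)
    linarith
  have hJN : (J : ℝ) ≤ N := Nat.cast_le.2 hJn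
  have hJp : J * risingBinom θ J ≤ c₂ * (J : ℝ) ^ θ := by
    have h := (hp J hJne).2
    rw [Real.rpow_sub_one hJ0.ne'] at h
    calc J * risingBinom θ J ≤ J * (c₂ * ((J : ℝ) ^ θ / J)) := by gcongr
      _ = c₂ * (J : ℝ) ^ θ := by field_simp
  -- The main part.
  have hmain := norm_sum_Ico_le hθ hΦ (g := g) (B := C₀ * N ^ (1 - δ)) hJn (fun j hj => by
    rcases Nat.eq_zero_or_pos j with rfl | hj0
    · simp; positivity
    · have := hC₀ j hj0
      rw [mul_zero, sub_zero] at this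
      refine this.trans ?_
      have : (j : ℝ) ≤ N := Nat.cast_le.2 hj
      gcongr)
  have htail := norm_sum_range_le hθ hΦ (g := g) (B := C₁ * N ^ (κ * θ / 2)) hJn (fun m hm => by
    have hm' := Finset.mem_Icc.1 hm
    refine (hC₁ m hm'.1).trans ?_
    have : (m : ℝ) ≤ N := Nat.cast_le.2 hm'.2
    gcongr)
  have hA : risingBinom θ J ≤ c₂ * N ^ (θ - 1 + κ) := by
    have h := (hp J hJne).2
    rw [Real.rpow_sub_one hJ0.ne'] at h
    refine h.trans ?_
    refine mul_le_mul_of_nonneg_left ?_ hc₂.le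
    calc (J : ℝ) ^ θ / J ≤ N ^ θ / N ^ (1 - κ) := by gcongr
      _ = N ^ (θ - 1 + κ) := by rw [← Real.rpow_sub hN0]; ring_nf
  have hS : ∑ j ∈ Finset.Ico J n, (θ + 1) * risingBinom θ j / (j + 1)
      ≤ (θ + 1) * c₂ * N ^ (θ - 1 + 2 * κ) := by
    have : ∀ j ∈ Finset.Ico J n, (θ + 1) * risingBinom θ j / (j + 1)
        ≤ (θ + 1) * c₂ * N ^ (θ - 2 + 2 * κ) := by
      intro j hj
      have hj' := Finset.mem_Ico.1 hj
      have hjJ : (J : ℝ) ≤ j := by exact_mod_cast hj'.1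
      have hj0 : (0 : ℝ) < j := by linarith
      have hjN : (j : ℝ) ≤ N := Nat.cast_le.2 hj'.2.le
      have h := (hp j (by exact_mod_cast hj0.ne')).2
      rw [Real.rpow_sub_one hj0.ne'] at h
      have hjX : N ^ (1 - κ) ≤ j := hJX.trans hjJ
      calc (θ + 1) * risingBinom θ j / (j + 1)
          ≤ (θ + 1) * (c₂ * ((j : ℝ) ^ θ / j)) / j := by gcongr; linarith
        _ ≤ (θ + 1) * (c₂ * (N ^ θ / N ^ (1 - κ))) / N ^ (1 - κ) := by gcongr
        _ = (θ + 1) * c₂ * (N ^ θ / (N ^ (1 - κ)) ^ 2) := by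
            field_simp
        _ = (θ + 1) * c₂ * N ^ (θ - 2 + 2 * κ) := by
            rw [← Real.rpow_natCast, ← Real.rpow_mul hN0.le, ← Real.rpow_sub hN0]
            push_cast
            ring_nf
    refine (Finset.sum_le_sum this).trans ?_
    rw [Finset.sum_const, Nat.card_Ico, nsmul_eq_mul]
    have hcard : ((n - J : ℕ) : ℝ) ≤ N := Nat.cast_le.2 (Nat.sub_le n J)
    calc ((n - J : ℕ) : ℝ) * ((θ + 1) * c₂ * N ^ (θ - 2 + 2 * κ))
        ≤ N * ((θ + 1) * c₂ * N ^ (θ - 2 + 2 * κ)) := by gcongr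
      _ = (θ + 1) * c₂ * (N ^ (1 : ℝ) * N ^ (θ - 2 + 2 * κ)) := by rw [Real.rpow_one]; ring
      _ = _ := by rw [← Real.rpow_add hN0]; ring_nf
  have hpn : c₁ * N ^ θ ≤ n * risingBinom θ n := by
    have h := (hp n (by omega)).1
    rw [Real.rpow_sub_one hN0.ne'] at h
    calc c₁ * N ^ θ = N * (c₁ * (N ^ θ / N)) := by field_simp
      _ ≤ _ := by gcongr
  have hmono : ∀ a : ℝ, a ≤ θ - δ' → N ^ a ≤ N ^ (θ - δ') := fun a ha =>
    Real.rpow_le_rpow_of_exponent_le hN1 ha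
  have hm1 : C₀ * N ^ (1 - δ) * (risingBinom θ J +
      ∑ j ∈ Finset.Ico J n, (θ + 1) * risingBinom θ j / (j + 1))
      ≤ C₀ * (c₂ + (θ + 1) * c₂) * N ^ (θ - δ') := by
    have e1 : N ^ (1 - δ) * N ^ (θ - 1 + κ) ≤ N ^ (θ - δ') := by
      rw [← Real.rpow_add hN0]
      refine hmono _ ?_
      have := min_le_left (δ / 2) (κ * θ / 2)
      linarith
    have e2 : N ^ (1 - δ) * N ^ (θ - 1 + 2 * κ) ≤ N ^ (θ - δ') := by
      rw [← Real.rpow_add hN0]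
      refine hmono _ ?_
      have := min_le_left (δ / 2) (κ * θ / 2)
      linarith
    calc _ ≤ C₀ * N ^ (1 - δ) * (c₂ * N ^ (θ - 1 + κ) + (θ + 1) * c₂ * N ^ (θ - 1 + 2 * κ)) := by
          gcongr
      _ = C₀ * (c₂ * (N ^ (1 - δ) * N ^ (θ - 1 + κ))
            + (θ + 1) * c₂ * (N ^ (1 - δ) * N ^ (θ - 1 + 2 * κ))) := by ring
      _ ≤ C₀ * (c₂ * N ^ (θ - δ') + (θ + 1) * c₂ * N ^ (θ - δ')) := by gcongr
      _ = _ := by ring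
  have hm2 : C₁ * N ^ (κ * θ / 2) * (J * risingBinom θ J / θ)
      ≤ C₁ * (c₂ * 2 ^ θ / θ) * N ^ (θ - δ') := by
    have e1 : N ^ (κ * θ / 2) * (N ^ (1 - κ)) ^ θ ≤ N ^ (θ - δ') := by
      rw [← Real.rpow_mul hN0.le, ← Real.rpow_add hN0]
      refine hmono _ ?_
      have := min_le_right (δ / 2) (κ * θ / 2)
      nlinarith
    calc _ ≤ C₁ * N ^ (κ * θ / 2) * (c₂ * (2 * N ^ (1 - κ)) ^ θ / θ) := by
          have : J * risingBinom θ J ≤ c₂ * (2 * N ^ (1 - κ)) ^ θ := hJp.trans (by gcongr)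
          gcongr
      _ = C₁ * (c₂ * 2 ^ θ / θ) * (N ^ (κ * θ / 2) * (N ^ (1 - κ)) ^ θ) := by
          rw [Real.mul_rpow (by norm_num) (by positivity)]
          ring
      _ ≤ _ := by gcongr
  have hfin := (norm_add_le (∑ j ∈ Finset.range J, (risingBinom θ j : ℂ) * ((g (n - j) : ℂ) * Φ j))
    (∑ j ∈ Finset.Ico J n, (risingBinom θ j : ℂ) * ((g (n - j) : ℂ) * Φ j))).trans
      (add_le_add (htail.trans hm2) (hmain.trans hm1))
  rw [Finset.sum_range_add_sum_Ico _ hJn] at hfin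
  rw [cycleAvg, norm_mul, Complex.norm_real, Real.norm_of_nonneg
    (by have := risingBinom_pos hθ n; positivity)]
  calc _ ≤ θ / (c₁ * N ^ θ) * (C₁ * (c₂ * 2 ^ θ / θ) * N ^ (θ - δ')
        + C₀ * (c₂ + (θ + 1) * c₂) * N ^ (θ - δ')) := by gcongr
    _ = _ := by
      rw [show θ - δ' = θ + -δ' by ring, Real.rpow_add hN0]
      field_simp
      ring


/-! ### Power means and subpolynomial growth -/

theorem HasPowerMean.tendsto {c : ℕ → ℝ} {μ : ℝ} (h : HasPowerMean c μ) :
    Tendsto (fun N : ℕ => (∑ m ∈ Finset.Icc 1 N, c m) / N) atTop (𝓝 μ) := by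
  obtain ⟨δ, C, hδ, -, hC⟩ := h
  have h0 : Tendsto (fun N : ℕ => C * (N : ℝ) ^ (-δ)) atTop (𝓝 0) := by
    simpa using ((tendsto_rpow_neg_atTop hδ).comp tendsto_natCast_atTop_atTop).const_mul C
  rw [tendsto_iff_norm_sub_tendsto_zero]
  refine squeeze_zero' (Eventually.of_forall fun _ => norm_nonneg _) ?_ h0
  filter_upwards [eventually_ge_atTop 1] with N hN
  have hN' : (0 : ℝ) < N := by exact_mod_cast hN
  have : (∑ m ∈ Finset.Icc 1 N, c m) / N - μ = (∑ m ∈ Finset.Icc 1 N, c m - N * μ) / N := by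
    field_simp
  rw [this, norm_div, Real.norm_eq_abs, Real.norm_of_nonneg hN'.le, div_le_iff₀ hN']
  refine (hC N hN).trans_eq ?_
  rw [mul_assoc, ← Real.rpow_add_one hN'.ne']
  ring_nf

theorem HasPowerMean.sub_const {c : ℕ → ℝ} {μ : ℝ} (h : HasPowerMean c μ) :
    HasPowerMean (fun m => c m - μ) 0 := by
  obtain ⟨δ, C, hδ, hδ1, hC⟩ := h
  refine ⟨δ, C, hδ, hδ1, fun N hN => ?_⟩
  simpa [Finset.sum_sub_distrib] using hC N hN

/-- Cauchy–Schwarz for the averages, passed to the limit. It keeps the comparison weight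
`flatWeight` in the unit disc. -/
theorem HasPowerMean.sq_le {c : ℕ → ℝ} {μ ν : ℝ} (h : HasPowerMean c μ)
    (h2 : HasPowerMean (fun m => c m ^ 2) ν) : μ ^ 2 ≤ ν := by
  refine le_of_tendsto_of_tendsto (h.tendsto.pow 2) h2.tendsto ?_
  filter_upwards [eventually_ge_atTop 1] with N hN
  have hN' : (0 : ℝ) < N := by exact_mod_cast hN
  have := sq_sum_le_card_mul_sum_sq (s := Finset.Icc 1 N) (f := c)
  rw [Nat.card_Icc, Nat.add_sub_cancel] at this
  rw [div_pow, div_le_div_iff₀ (by positivity) hN']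
  nlinarith

theorem IsSubpoly.mul {c d : ℕ → ℝ} (hc : IsSubpoly c) (hd : IsSubpoly d) :
    IsSubpoly (fun m => c m * d m) := by
  intro ε hε
  obtain ⟨C, hC⟩ := hc (ε / 2) (by positivity)
  obtain ⟨D, hD⟩ := hd (ε / 2) (by positivity)
  refine ⟨C * D, fun m hm => ?_⟩
  have hm' : (0 : ℝ) < m := by exact_mod_cast hm
  rw [abs_mul]
  calc |c m| * |d m| ≤ (C * (m : ℝ) ^ (ε / 2)) * (D * (m : ℝ) ^ (ε / 2)) :=
        mul_le_mul (hC m hm) (hD m hm) (abs_nonneg _) ((abs_nonneg _).trans (hC m hm))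
    _ = C * D * ((m : ℝ) ^ (ε / 2) * (m : ℝ) ^ (ε / 2)) := by ring
    _ = _ := by rw [← Real.rpow_add hm']; ring_nf

theorem IsSubpoly.sub_const {c : ℕ → ℝ} (hc : IsSubpoly c) (μ : ℝ) :
    IsSubpoly (fun m => c m - μ) := by
  intro ε hε
  obtain ⟨C, hC⟩ := hc ε hε
  refine ⟨C + |μ|, fun m hm => ?_⟩
  have hm' : (1 : ℝ) ≤ m := by exact_mod_cast hm
  have h1 : (1 : ℝ) ≤ (m : ℝ) ^ ε := Real.one_le_rpow hm' hε.le
  calc |c m - μ| ≤ |c m| + |μ| := abs_sub _ _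
    _ ≤ C * (m : ℝ) ^ ε + |μ| * (m : ℝ) ^ ε :=
        add_le_add (hC m hm) (le_mul_of_one_le_right (abs_nonneg _) h1)
    _ = _ := by ring

theorem IsSubpoly.pow {c : ℕ → ℝ} (hc : IsSubpoly c) {k : ℕ} (hk : k ≠ 0) :
    IsSubpoly (fun m => c m ^ k) := by
  obtain ⟨k, rfl⟩ := Nat.exists_eq_succ_of_ne_zero hk
  clear hk
  induction k with
  | zero => simpa using hc
  | succ k ih =>
    simp only [pow_succ _ (k + 1)]
    exact ih.mul hc

/-! ### Comparison with a constant cycle weight -/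

theorem risingBinom_ne_zero {θ : ℝ} (hθ : 0 < θ) (n : ℕ) : (risingBinom θ n : ℂ) ≠ 0 := by
  exact_mod_cast (risingBinom_pos hθ n).ne'

theorem cycleAvg_const {θ : ℝ} (hθ : 0 < θ) (a : ℂ) {n : ℕ} (hn : n ≠ 0) :
    cycleAvg θ (fun _ => a) n = a := by
  have h := mul_sum_risingBinom θ n
  have h' : ((θ * ∑ j ∈ Finset.range n, risingBinom θ j : ℝ) : ℂ) = (n * risingBinom θ n : ℝ) := by
    rw [h]
  have hp := risingBinom_ne_zero hθ n
  have hn' : (n : ℂ) ≠ 0 := by exact_mod_cast hn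
  push_cast at h'
  rw [cycleAvg, ← Finset.sum_mul]
  push_cast
  rw [← mul_assoc, div_mul_eq_mul_div, h', div_self (mul_ne_zero hn' hp), one_mul]

theorem cycleAvg_add (θ : ℝ) (F G : ℕ → ℂ) (n : ℕ) :
    cycleAvg θ (fun j => F j + G j) n = cycleAvg θ F n + cycleAvg θ G n := by
  simp [cycleAvg, mul_add, Finset.sum_add_distrib]

theorem cycleAvg_const_mul (θ : ℝ) (a : ℂ) (F : ℕ → ℂ) (n : ℕ) :
    cycleAvg θ (fun j => a * F j) n = a * cycleAvg θ F n := by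
  simp only [cycleAvg, Finset.mul_sum]
  exact Finset.sum_congr rfl fun _ _ => by ring

theorem cycleAvg_congr (θ : ℝ) {F G : ℕ → ℂ} {n : ℕ} (h : ∀ j < n, F j = G j) :
    cycleAvg θ F n = cycleAvg θ G n := by
  unfold cycleAvg
  congr 1
  exact Finset.sum_congr rfl fun j hj => by rw [h j (Finset.mem_range.1 hj)]

theorem cycleAvg_succ {θ : ℝ} (hθ : 0 < θ) (F : ℕ → ℂ) (n : ℕ) :
    cycleAvg θ F (n + 1) = (θ / (θ + n)) * F n + (n / (θ + n)) * cycleAvg θ F n := by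
  have h := succ_mul_risingBinom_succ θ n
  have hp := risingBinom_ne_zero hθ n
  have h0 : (θ + n : ℂ) ≠ 0 := by
    have : θ + n ≠ 0 := by positivity
    exact_mod_cast this
  rw [cycleAvg, cycleAvg, h, Finset.sum_range_succ]
  push_cast
  rcases Nat.eq_zero_or_pos n with rfl | hn
  · field_simp
    simp
  · have hn' : (n : ℂ) ≠ 0 := by exact_mod_cast hn.ne'
    field_simp
    ring

theorem norm_cycleAvg_le_sum {θ : ℝ} (hθ : 0 < θ) {F : ℕ → ℂ} {h : ℕ → ℝ} {n : ℕ}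
    (hF : ∀ j < n, ‖F j‖ ≤ h j) :
    ‖cycleAvg θ F n‖ ≤ θ / (n * risingBinom θ n) * ∑ j ∈ Finset.range n, risingBinom θ j * h j := by
  have hp := risingBinom_pos hθ n
  rw [cycleAvg, norm_mul, Complex.norm_real, Real.norm_of_nonneg (by positivity)]
  refine mul_le_mul_of_nonneg_left ?_ (by positivity)
  refine (norm_sum_le _ _).trans (Finset.sum_le_sum fun j hj => ?_)
  have hpj := risingBinom_pos hθ j
  rw [norm_mul, Complex.norm_real, Real.norm_of_nonneg hpj.le]
  exact mul_le_mul_of_nonneg_left (hF j (Finset.mem_range.1 hj)) hpj.le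

theorem norm_cycleAvg_le {θ : ℝ} (hθ : 0 < θ) {F : ℕ → ℂ} {h : ℕ → ℝ} {n : ℕ}
    (hF : ∀ j < n, ‖F j‖ ≤ h j) : ‖cycleAvg θ F n‖ ≤ ‖cycleAvg θ (fun j => (h j : ℂ)) n‖ := by
  refine (norm_cycleAvg_le_sum hθ hF).trans ((le_abs_self _).trans_eq ?_)
  rw [← Real.norm_eq_abs, ← Complex.norm_real, cycleAvg]
  push_cast
  rfl

theorem ewensMean_eq_cycleAvg {θ : ℝ} (hθ : 0 < θ) (t : ℕ → ℂ) {n : ℕ} (hn : n ≠ 0) :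
    ewensMean θ t n = cycleAvg θ (fun j => t (n - j) * ewensMean θ t j) n := by
  have h := ewensMean_rec hθ t n
  have hp := risingBinom_ne_zero hθ n
  have hn' : (n : ℂ) ≠ 0 := by exact_mod_cast hn
  rw [cycleAvg]
  push_cast
  rw [div_mul_eq_mul_div, ← h]
  field_simp

/-- The mean of `s ^ ℓ(σ)` under the Ewens measure. -/
noncomputable def numCyclesGen (θ : ℝ) (s : ℂ) (n : ℕ) : ℂ :=
  ∏ j ∈ Finset.range n, (θ * s + j) / (θ + j)

theorem numCyclesGen_succ (θ : ℝ) (s : ℂ) (n : ℕ) :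
    numCyclesGen θ s (n + 1) = numCyclesGen θ s n * ((θ * s + n) / (θ + n)) :=
  Finset.prod_range_succ _ _

theorem add_natCast_ne_zero {θ : ℝ} (hθ : 0 < θ) (n : ℕ) : (θ + n : ℂ) ≠ 0 := by
  have : θ + n ≠ 0 := by positivity
  exact_mod_cast this

/-- The product solves the renewal equation with constant weight `s`: by `cycleAvg_succ` each step
multiplies `s` times the average by `(θ s + n) / (θ + n)`. -/
theorem numCyclesGen_eq_cycleAvg {θ : ℝ} (hθ : 0 < θ) (s : ℂ) {n : ℕ} (hn : n ≠ 0) :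
    numCyclesGen θ s n = s * cycleAvg θ (numCyclesGen θ s) n := by
  obtain ⟨n, rfl⟩ := Nat.exists_eq_succ_of_ne_zero hn
  clear hn
  have h0 := add_natCast_ne_zero hθ
  induction n with
  | zero =>
    rw [Nat.succ_eq_add_one, cycleAvg_succ hθ, numCyclesGen_succ]
    have : (θ : ℂ) ≠ 0 := by exact_mod_cast hθ.ne'
    simp
    field_simp
  | succ n ih =>
    have h1 := h0 (n + 1)
    rw [Nat.succ_eq_add_one] at *
    rw [cycleAvg_succ hθ, mul_add, mul_left_comm s, mul_left_comm s, ← ih,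
      numCyclesGen_succ θ s (n + 1)]
    field_simp

theorem norm_numCyclesGen_factor_le {θ : ℝ} (hθ : 0 < θ) {s : ℂ} (hs : ‖s‖ ≤ 1) (j : ℕ) :
    ‖(θ * s + j) / (θ + j)‖ ≤ 1 := by
  have h1 : ‖(θ + j : ℂ)‖ = θ + j := by
    have : (θ + j : ℂ) = ((θ + j : ℝ) : ℂ) := by push_cast; rfl
    rw [this, Complex.norm_real, Real.norm_of_nonneg (by positivity)]
  rw [norm_div, h1, div_le_one (by positivity)]
  refine (norm_add_le _ _).trans ?_
  rw [norm_mul, Complex.norm_real, Real.norm_of_nonneg hθ.le, Complex.norm_natCast]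
  nlinarith

theorem norm_numCyclesGen_le {θ : ℝ} (hθ : 0 < θ) {s : ℂ} (hs : ‖s‖ ≤ 1) (n : ℕ) :
    ‖numCyclesGen θ s n‖ ≤ 1 := by
  rw [numCyclesGen, norm_prod]
  exact Finset.prod_le_one (fun _ _ => norm_nonneg _) fun j _ => norm_numCyclesGen_factor_le hθ hs j

/-- The increment of `p_j Φ_j` is exactly `p_j Φ_j (θ s - 1) / (j + 1)`. -/
theorem isSlow_numCyclesGen {θ : ℝ} (hθ : 0 < θ) {s : ℂ} (hs : ‖s‖ ≤ 1) :
    IsSlow θ (numCyclesGen θ s) := by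
  refine ⟨norm_numCyclesGen_le hθ hs, fun j => ?_⟩
  have h0 := add_natCast_ne_zero hθ j
  have hj : (j + 1 : ℂ) ≠ 0 := by exact_mod_cast (Nat.succ_ne_zero j)
  have hp := risingBinom_pos hθ j
  have : (risingBinom θ (j + 1) : ℂ) * numCyclesGen θ s (j + 1)
      - risingBinom θ j * numCyclesGen θ s j
      = numCyclesGen θ s j * (θ * s - 1) * ((risingBinom θ j / (j + 1) : ℝ) : ℂ) := by
    rw [risingBinom_succ, numCyclesGen_succ]
    push_cast
    field_simp
    ring
  rw [this, norm_mul, norm_mul, Complex.norm_real, Real.norm_of_nonneg (by positivity), mul_div_assoc]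
  refine mul_le_mul_of_nonneg_right ?_ (by positivity)
  have h1 : ‖(θ * s - 1 : ℂ)‖ ≤ θ + 1 := by
    refine (norm_sub_le _ _).trans ?_
    rw [norm_mul, Complex.norm_real, Real.norm_of_nonneg hθ.le, norm_one]
    nlinarith
  calc _ ≤ 1 * (θ + 1) := mul_le_mul (norm_numCyclesGen_le hθ hs j) h1 (norm_nonneg _) zero_le_one
    _ = _ := one_mul _

theorem isSlow_one {θ : ℝ} (hθ : 0 < θ) : IsSlow θ (fun _ => 1) := by
  have h : numCyclesGen θ 1 = fun _ => 1 := by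
    funext n
    refine Finset.prod_eq_one fun j _ => ?_
    rw [mul_one, div_self (add_natCast_ne_zero hθ j)]
  rw [← h]
  exact isSlow_numCyclesGen hθ (by simp)

/-- This solves `e_n = ρ_n + (average of e_j over j < n)` in closed form, as the Gronwall argument
requires. -/
theorem mul_sum_risingBinom_mul {θ : ℝ} (hθ : 0 < θ) (ρ : ℕ → ℝ) (n : ℕ) :
    θ * ∑ j ∈ Finset.range n, risingBinom θ j *
        (ρ j + ∑ i ∈ Finset.range j, θ / (θ + i) * ρ i)
      = n * risingBinom θ n * ∑ i ∈ Finset.range n, θ / (θ + i) * ρ i := by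
  induction n with
  | zero => simp
  | succ n ih =>
    have h0 : θ + n ≠ 0 := by positivity
    rw [Finset.sum_range_succ, mul_add, ih, succ_mul_risingBinom_succ, Finset.sum_range_succ]
    field_simp
    ring

/-- The defect of the constant weight `s` in the recursion for the weights `t`. -/
noncomputable def defect (θ : ℝ) (t : ℕ → ℂ) (s : ℂ) (n : ℕ) : ℂ :=
  cycleAvg θ (fun j => (t (n - j) - s) * numCyclesGen θ s j) n

/-- The difference `E` of the two solutions satisfies `E_n = defect_n + cycleAvg (t_{n - j} E_j)`.
Since `|t| ≤ 1`, strong induction bounds it by the explicit solution of the scalar equation with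
source `‖defect‖`. -/
theorem norm_ewensMean_sub_le {θ : ℝ} (hθ : 0 < θ) {t : ℕ → ℂ} (ht : ∀ m, ‖t m‖ ≤ 1) (s : ℂ)
    (n : ℕ) :
    ‖ewensMean θ t n - numCyclesGen θ s n‖
      ≤ ‖defect θ t s n‖ + ∑ i ∈ Finset.range n, θ / (θ + i) * ‖defect θ t s i‖ := by
  induction n using Nat.strong_induction_on with
  | _ n ih =>
    rcases Nat.eq_zero_or_pos n with rfl | hn
    · simp [ewensMean_zero, numCyclesGen]
    have h1 : ewensMean θ t n - numCyclesGen θ s n = defect θ t s n +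
        cycleAvg θ (fun j => t (n - j) * (ewensMean θ t j - numCyclesGen θ s j)) n := by
      rw [defect, ← cycleAvg_add, ewensMean_eq_cycleAvg hθ t hn.ne',
        numCyclesGen_eq_cycleAvg hθ s hn.ne', ← cycleAvg_const_mul, sub_eq_add_neg,
        neg_eq_neg_one_mul, ← cycleAvg_const_mul, ← cycleAvg_add]
      exact cycleAvg_congr θ fun j _ => by ring
    rw [h1]
    refine (norm_add_le _ _).trans (add_le_add le_rfl ?_)
    refine (norm_cycleAvg_le_sum hθ (h := fun j => ‖defect θ t s j‖ +
      ∑ i ∈ Finset.range j, θ / (θ + i) * ‖defect θ t s i‖) fun j hj => ?_).trans_eq ?_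
    · rw [norm_mul]
      calc _ ≤ 1 * ‖ewensMean θ t j - numCyclesGen θ s j‖ :=
            mul_le_mul_of_nonneg_right (ht _) (norm_nonneg _)
        _ ≤ _ := by rw [one_mul]; exact ih j hj
    · have hp := risingBinom_pos hθ n
      have hn' : (0 : ℝ) < n := by exact_mod_cast hn
      rw [div_mul_eq_mul_div, mul_sum_risingBinom_mul hθ]
      field_simp


/-! ### Characteristic functions of additive statistics -/

theorem norm_exp_mul_I_sub_taylor_le (x : ℝ) :
    ‖Complex.exp (x * Complex.I) - (1 + x * Complex.I - x ^ 2 / 2)‖ ≤ 4 * |x| ^ 3 := by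
  have hsum : ∑ m ∈ Finset.range 3, (x * Complex.I) ^ m / (m.factorial : ℂ)
      = 1 + x * Complex.I - x ^ 2 / 2 := by
    simp [Finset.sum_range_succ, Nat.factorial, mul_pow]
    ring
  have hn : ‖(x * Complex.I : ℂ)‖ = |x| := by simp
  rcases le_total |x| 1 with h | h
  · have := Complex.norm_exp_sub_sum_le_norm_mul_exp (x * Complex.I) 3
    rw [hsum, hn] at this
    refine this.trans ?_
    rw [mul_comm]
    refine mul_le_mul_of_nonneg_right ?_ (by positivity)
    -- The constant `4` exceeds `e`; for `|x| ≥ 1` it also exceeds the sum `1 + 1 + 1 + 1 / 2` of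
    -- the coefficients.
    have h1 := Real.exp_le_exp.2 h
    have h2 := Real.exp_one_lt_d9
    linarith
  · have h1 : ‖(1 + x * Complex.I - x ^ 2 / 2 : ℂ)‖ ≤ 1 + |x| + |x| ^ 2 / 2 := by
      refine (norm_sub_le _ _).trans (add_le_add ((norm_add_le _ _).trans ?_) ?_)
      · rw [norm_one, hn]
      · rw [norm_div, norm_pow, Complex.norm_real, Real.norm_eq_abs]
        simp
    refine (norm_sub_le _ _).trans ?_
    rw [Complex.norm_exp_ofReal_mul_I]
    have h2 : |x| ≤ |x| ^ 3 := le_self_pow₀ h (by norm_num)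
    have h3 : |x| ^ 2 ≤ |x| ^ 3 := pow_le_pow_right₀ h (by norm_num)
    linarith

/-- The constant cycle weight with the same first two moments as `exp (i α c)`, where `c` has
mean `μ` and second moment `ν`. -/
noncomputable def flatWeight (μ ν α : ℝ) : ℂ :=
  Complex.exp ((α * μ : ℝ) * Complex.I - (α ^ 2 * (ν - μ ^ 2) / 2 : ℝ))

theorem norm_flatWeight_le {μ ν : ℝ} (h : μ ^ 2 ≤ ν) (α : ℝ) : ‖flatWeight μ ν α‖ ≤ 1 := by
  rw [flatWeight, Complex.norm_exp, Real.exp_le_one_iff, Complex.sub_re, Complex.re_ofReal_mul,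
    Complex.I_re, Complex.ofReal_re]
  have : 0 ≤ ν - μ ^ 2 := by linarith
  have : 0 ≤ α ^ 2 * (ν - μ ^ 2) / 2 := by positivity
  linarith

theorem exists_norm_flatWeight_sub_le (μ ν : ℝ) : ∃ K : ℝ, 0 ≤ K ∧ ∀ α : ℝ, |α| ≤ 1 →
    ‖flatWeight μ ν α - (1 + (α * μ : ℝ) * Complex.I - (α ^ 2 * ν / 2 : ℝ))‖ ≤ K * |α| ^ 3 := by
  set v := ν - μ ^ 2 with hv
  set M := |μ| + |v| with hM
  have hM0 : 0 ≤ M := by positivity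
  refine ⟨M ^ 3 * Real.exp M + (|μ| * |v| + |v| ^ 2), by positivity, fun α hα => ?_⟩
  set w : ℂ := (α * μ : ℝ) * Complex.I - (α ^ 2 * v / 2 : ℝ) with hw
  have ha2 : |α| ^ 2 ≤ |α| := by nlinarith [abs_nonneg α]
  have ha4 : |α| ^ 4 ≤ |α| ^ 3 := pow_le_pow_of_le_one (abs_nonneg _) hα (by norm_num)
  have hwn : ‖w‖ ≤ |α| * M := by
    refine (norm_sub_le _ _).trans ?_
    rw [norm_mul, Complex.norm_I, mul_one, Complex.norm_real, Complex.norm_real, Real.norm_eq_abs,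
      Real.norm_eq_abs, abs_div, abs_mul, abs_mul, abs_pow, abs_two]
    have : |α| ^ 2 * |v| ≤ |α| * |v| := by gcongr
    have : 0 ≤ |α| * |v| := by positivity
    rw [hM]
    linarith
  have hwM : ‖w‖ ≤ M := hwn.trans (mul_le_of_le_one_left hM0 hα)
  have h1 := Complex.norm_exp_sub_sum_le_norm_mul_exp w 3
  have hsum : ∑ m ∈ Finset.range 3, w ^ m / (m.factorial : ℂ) = 1 + w + w ^ 2 / 2 := by
    simp [Finset.sum_range_succ, Nat.factorial]
  rw [hsum] at h1
  -- The square of the drift in `w ^ 2 / 2` turns `ν - μ ^ 2` back into `ν`; only terms of order `α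
  -- ^ 3` and `α ^ 4` remain.
  have h2 : (1 + w + w ^ 2 / 2) - (1 + (α * μ : ℝ) * Complex.I - (α ^ 2 * ν / 2 : ℝ))
      = ((α ^ 4 * v ^ 2 / 8 : ℝ) : ℂ) - ((α ^ 3 * μ * v / 2 : ℝ) : ℂ) * Complex.I := by
    have hI : Complex.I ^ 2 = -1 := Complex.I_sq
    rw [hw, hv]
    push_cast
    linear_combination ((α : ℂ) * μ) ^ 2 / 2 * hI
  have h3 : ‖(1 + w + w ^ 2 / 2) - (1 + (α * μ : ℝ) * Complex.I - (α ^ 2 * ν / 2 : ℝ))‖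
      ≤ (|μ| * |v| + |v| ^ 2) * |α| ^ 3 := by
    rw [h2]
    refine (norm_sub_le _ _).trans ?_
    rw [norm_mul, Complex.norm_I, mul_one, Complex.norm_real, Complex.norm_real, Real.norm_eq_abs,
      Real.norm_eq_abs, abs_div, abs_div, abs_mul, abs_mul, abs_mul, abs_pow, abs_pow, abs_pow,
      abs_two, abs_of_pos (by norm_num : (0 : ℝ) < 8)]
    have e1 : |α| ^ 4 * |v| ^ 2 ≤ |α| ^ 3 * |v| ^ 2 := by gcongr
    have e2 : 0 ≤ |α| ^ 3 * |v| ^ 2 := by positivity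
    have e3 : 0 ≤ |α| ^ 3 * |μ| * |v| := by positivity
    linarith
  have h4 : ‖w‖ ^ 3 * Real.exp ‖w‖ ≤ M ^ 3 * Real.exp M * |α| ^ 3 := by
    calc _ ≤ (|α| * M) ^ 3 * Real.exp M := by gcongr
      _ = _ := by ring
  have h5 : flatWeight μ ν α - (1 + (α * μ : ℝ) * Complex.I - (α ^ 2 * ν / 2 : ℝ))
      = (Complex.exp w - (1 + w + w ^ 2 / 2))
        + ((1 + w + w ^ 2 / 2) - (1 + (α * μ : ℝ) * Complex.I - (α ^ 2 * ν / 2 : ℝ))) := by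
    rw [flatWeight]
    ring
  rw [h5]
  refine (norm_add_le _ _).trans ?_
  linarith

/-- The cycle weight `exp (i α c_m)`. -/
noncomputable def phaseWeight (c : ℕ → ℝ) (α : ℝ) (m : ℕ) : ℂ :=
  Complex.exp ((α * c m : ℝ) * Complex.I)

/-- `∑_{j < n} θ / (θ + j)`, the mean number of cycles. -/
noncomputable def meanCycles (θ : ℝ) (n : ℕ) : ℝ := ∑ j ∈ Finset.range n, θ / (θ + j)

/-- Trades the absolute third moment for a fourth moment, which is a polynomial average and needs no
absolute value. -/
theorem abs_pow_three_le (x : ℝ) : |x| ^ 3 ≤ 1 + x ^ 4 := by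
  have h : x ^ 4 = |x| ^ 4 := by rw [← abs_pow, abs_of_nonneg (by positivity)]
  rw [h]
  nlinarith [sq_nonneg (|x| ^ 2 - |x|), sq_nonneg (|x| - 1), sq_nonneg (|x|^2 - 1), abs_nonneg x]

/-- Expand `t_m - s = i α (c_m - μ) - (α ^ 2 / 2) (c_m ^ 2 - ν) + e_m`. The two centred terms
average to a negative power of `n`, and `e_m = O(|α| ^ 3 (1 + c_m ^ 4))` has bounded average up to
`|α| ^ 3`. -/
theorem exists_norm_defect_le {θ : ℝ} (hθ : 0 < θ) {c : ℕ → ℝ} {μ ν κ : ℝ}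
    (h1 : HasPowerMean c μ) (h2 : HasPowerMean (fun m => c m ^ 2) ν)
    (h4 : HasPowerMean (fun m => c m ^ 4) κ) (hc : IsSubpoly c) :
    ∃ C δ : ℝ, 0 ≤ C ∧ 0 < δ ∧ ∀ α : ℝ, |α| ≤ 1 → ∀ n : ℕ, 1 ≤ n →
      ‖defect θ (phaseWeight c α) (flatWeight μ ν α) n‖
        ≤ C * (|α| * (n : ℝ) ^ (-δ) + |α| ^ 3) := by
  obtain ⟨δ₁, C₁, hδ₁, hC₁, H1⟩ := exists_norm_cycleAvg_le hθ h1.sub_const (hc.sub_const μ)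
  obtain ⟨δ₂, C₂, hδ₂, hC₂, H2⟩ := exists_norm_cycleAvg_le hθ h2.sub_const
    ((hc.pow two_ne_zero).sub_const ν)
  obtain ⟨δ₄, C₄, hδ₄, hC₄, H4⟩ := exists_norm_cycleAvg_le hθ h4.sub_const
    ((hc.pow four_ne_zero).sub_const κ)
  obtain ⟨K, hK0, hK⟩ := exists_norm_flatWeight_sub_le μ ν
  set δ := min δ₁ δ₂ with hδ
  refine ⟨C₁ + C₂ + (4 + K) * (|1 + κ| + C₄), δ, by positivity, by positivity,
    fun α hα n hn => ?_⟩
  have hn1 : (1 : ℝ) ≤ n := by exact_mod_cast hn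
  set s := flatWeight μ ν α with hs
  have hs1 : ‖s‖ ≤ 1 := norm_flatWeight_le (h1.sq_le h2) α
  set Φ := numCyclesGen θ s with hΦdef
  have hΦ : IsSlow θ Φ := isSlow_numCyclesGen hθ hs1
  set e : ℕ → ℂ := fun m => phaseWeight c α m - s - ((α * (c m - μ) : ℝ) * Complex.I
    - (α ^ 2 / 2 * (c m ^ 2 - ν) : ℝ)) with he
  have hen : ∀ m, ‖e m‖ ≤ (4 + K) * |α| ^ 3 * (1 + κ + (c m ^ 4 - κ)) := by
    intro m
    have t1 := norm_exp_mul_I_sub_taylor_le (α * c m)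
    have t2 := hK α hα
    have : e m = (Complex.exp ((α * c m : ℝ) * Complex.I)
        - (1 + (α * c m : ℝ) * Complex.I - ((α * c m : ℝ) : ℂ) ^ 2 / 2))
        - (s - (1 + (α * μ : ℝ) * Complex.I - (α ^ 2 * ν / 2 : ℝ))) := by
      rw [he]
      simp only [phaseWeight]
      push_cast
      ring
    rw [this]
    refine (norm_sub_le _ _).trans ((add_le_add t1 t2).trans ?_)
    rw [abs_mul, mul_pow]
    have t3 := abs_pow_three_le (c m)
    have t4 : 0 ≤ c m ^ 4 := by positivity
    have t5 : 0 ≤ |α| ^ 3 := by positivity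
    calc _ ≤ 4 * (|α| ^ 3 * (1 + c m ^ 4)) + K * |α| ^ 3 * (1 + c m ^ 4) := by
          have t6 : K * |α| ^ 3 ≤ K * |α| ^ 3 * (1 + c m ^ 4) :=
            le_mul_of_one_le_right (by positivity) (by linarith)
          gcongr
      _ = _ := by ring
  have hdec : defect θ (phaseWeight c α) s n
      = (α * Complex.I) * cycleAvg θ (fun j => ((c (n - j) - μ : ℝ) : ℂ) * Φ j) n
        + ((-(α ^ 2 / 2) : ℝ) * cycleAvg θ (fun j => ((c (n - j) ^ 2 - ν : ℝ) : ℂ) * Φ j) n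
        + cycleAvg θ (fun j => e (n - j) * Φ j) n) := by
    rw [defect, ← cycleAvg_const_mul, ← cycleAvg_const_mul, ← cycleAvg_add, ← cycleAvg_add]
    refine cycleAvg_congr θ fun j _ => ?_
    rw [he]
    push_cast
    ring
  have hrem : ‖cycleAvg θ (fun j => e (n - j) * Φ j) n‖ ≤ (4 + K) * (|1 + κ| + C₄) * |α| ^ 3 := by
    refine (norm_cycleAvg_le hθ (h := fun j => (4 + K) * |α| ^ 3
      * (1 + κ + (c (n - j) ^ 4 - κ))) fun j _ => ?_).trans ?_
    · rw [norm_mul]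
      calc _ ≤ ‖e (n - j)‖ * 1 := mul_le_mul_of_nonneg_left (hΦ.1 j) (norm_nonneg _)
        _ ≤ _ := by rw [mul_one]; exact hen _
    · have : cycleAvg θ (fun j => (((4 + K) * |α| ^ 3 * (1 + κ + (c (n - j) ^ 4 - κ)) : ℝ) : ℂ)) n
          = ((4 + K) * |α| ^ 3 : ℝ) * (((1 + κ : ℝ) : ℂ)
            + cycleAvg θ (fun j => ((c (n - j) ^ 4 - κ : ℝ) : ℂ) * 1) n) := by
        rw [← cycleAvg_const hθ ((1 + κ : ℝ) : ℂ) (by omega : n ≠ 0), ← cycleAvg_add,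
          ← cycleAvg_const_mul]
        refine cycleAvg_congr θ fun j _ => ?_
        push_cast
        ring
      rw [this, norm_mul, Complex.norm_real, Real.norm_of_nonneg (by positivity)]
      have hb := H4 _ (isSlow_one hθ) n hn
      have hb' : C₄ * (n : ℝ) ^ (-δ₄) ≤ C₄ :=
        mul_le_of_le_one_right hC₄ (Real.rpow_le_one_of_one_le_of_nonpos hn1 (by linarith))
      have hb2 : ‖((1 + κ : ℝ) : ℂ) + cycleAvg θ (fun j => ((c (n - j) ^ 4 - κ : ℝ) : ℂ) * 1) n‖
          ≤ |1 + κ| + C₄ := by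
        refine (norm_add_le _ _).trans (add_le_add ?_ (hb.trans hb'))
        rw [Complex.norm_real, Real.norm_eq_abs]
      calc _ ≤ (4 + K) * |α| ^ 3 * (|1 + κ| + C₄) := by gcongr
        _ = _ := by ring
  have hd1 : C₁ * (n : ℝ) ^ (-δ₁) ≤ C₁ * (n : ℝ) ^ (-δ) := by
    gcongr
    exact min_le_left _ _
  have hd2 : C₂ * (n : ℝ) ^ (-δ₂) ≤ C₂ * (n : ℝ) ^ (-δ) := by
    gcongr
    exact min_le_right _ _
  have hq : 0 ≤ (n : ℝ) ^ (-δ) := by positivity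
  have ha2 : |α| ^ 2 / 2 ≤ |α| := by nlinarith [abs_nonneg α]
  rw [hdec]
  refine (norm_add_le _ _).trans ?_
  have f1 : ‖(α * Complex.I) * cycleAvg θ (fun j => ((c (n - j) - μ : ℝ) : ℂ) * Φ j) n‖
      ≤ |α| * (C₁ * (n : ℝ) ^ (-δ)) := by
    rw [norm_mul, norm_mul, Complex.norm_I, mul_one, Complex.norm_real, Real.norm_eq_abs]
    exact mul_le_mul_of_nonneg_left ((H1 Φ hΦ n hn).trans hd1) (abs_nonneg _)
  have f2 : ‖((-(α ^ 2 / 2) : ℝ) : ℂ) * cycleAvg θ (fun j => ((c (n - j) ^ 2 - ν : ℝ) : ℂ) * Φ j) n‖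
      ≤ |α| * (C₂ * (n : ℝ) ^ (-δ)) := by
    rw [norm_mul, Complex.norm_real, Real.norm_eq_abs, abs_neg, abs_div, abs_pow, abs_two]
    exact mul_le_mul ha2 ((H2 Φ hΦ n hn).trans hd2) (norm_nonneg _) (abs_nonneg _)
  have f3 := norm_add_le ((-(α ^ 2 / 2) : ℝ) *
    cycleAvg θ (fun j => ((c (n - j) ^ 2 - ν : ℝ) : ℂ) * Φ j) n)
    (cycleAvg θ (fun j => e (n - j) * Φ j) n)
  have g1 : 0 ≤ |α| * (n : ℝ) ^ (-δ) := by positivity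
  have g2 : 0 ≤ |α| ^ 3 := by positivity
  have g3 : 0 ≤ (4 + K) * (|1 + κ| + C₄) := by positivity
  calc _ ≤ |α| * (C₁ * (n : ℝ) ^ (-δ)) + (|α| * (C₂ * (n : ℝ) ^ (-δ))
        + (4 + K) * (|1 + κ| + C₄) * |α| ^ 3) := by
        refine add_le_add f1 (f3.trans (add_le_add f2 hrem))
    _ ≤ _ := by nlinarith [mul_nonneg g3 g1, mul_nonneg hC₁ g2, mul_nonneg hC₂ g2]

/-- The power saving makes `∑ j ^ (-δ - 1)` converge, so the terms linear in `α` add up to `O(|α|)`;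
only the cubic ones are multiplied by the logarithmically growing `meanCycles`. -/
theorem exists_norm_ewensMean_sub_le {θ : ℝ} (hθ : 0 < θ) {c : ℕ → ℝ} {μ ν κ : ℝ}
    (h1 : HasPowerMean c μ) (h2 : HasPowerMean (fun m => c m ^ 2) ν)
    (h4 : HasPowerMean (fun m => c m ^ 4) κ) (hc : IsSubpoly c) :
    ∃ C : ℝ, 0 ≤ C ∧ ∀ α : ℝ, |α| ≤ 1 → ∀ n : ℕ, 1 ≤ n →
      ‖ewensMean θ (phaseWeight c α) n - numCyclesGen θ (flatWeight μ ν α) n‖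
        ≤ C * (|α| + |α| ^ 3 * (1 + meanCycles θ n)) := by
  obtain ⟨C, δ, hC, hδ, H⟩ := exists_norm_defect_le hθ h1 h2 h4 hc
  have hsum : Summable fun j : ℕ => (j : ℝ) ^ (-δ - 1) := Real.summable_nat_rpow.2 (by linarith)
  set S := ∑' j : ℕ, (j : ℝ) ^ (-δ - 1) with hS
  have hS0 : 0 ≤ S := tsum_nonneg fun _ => by positivity
  refine ⟨C * (1 + θ * S), by positivity, fun α hα n hn => ?_⟩
  have hn1 : (1 : ℝ) ≤ n := by exact_mod_cast hn
  set r := fun j => ‖defect θ (phaseWeight c α) (flatWeight μ ν α) j‖ with hr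
  have hstep : ∀ j : ℕ, θ / (θ + j) * r j
      ≤ C * (θ * |α| * (j : ℝ) ^ (-δ - 1) + |α| ^ 3 * (θ / (θ + j))) := by
    intro j
    rcases Nat.eq_zero_or_pos j with rfl | hj
    -- The defect at `0` is an empty sum, so the bound, valid only from `1` on, is not needed there.
    · have : r 0 = 0 := by simp [hr, defect, cycleAvg]
      rw [this, mul_zero]
      positivity
    · have hj0 : (0 : ℝ) < j := by exact_mod_cast hj
      have hb : θ / (θ + j) ≤ θ / j := by gcongr; linarith
      calc _ ≤ θ / (θ + j) * (C * (|α| * (j : ℝ) ^ (-δ) + |α| ^ 3)) := by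
            gcongr
            exact H α hα j hj
        _ = C * (θ / (θ + j) * (|α| * (j : ℝ) ^ (-δ)) + |α| ^ 3 * (θ / (θ + j))) := by ring
        _ ≤ C * (θ / j * (|α| * (j : ℝ) ^ (-δ)) + |α| ^ 3 * (θ / (θ + j))) := by gcongr
        _ = _ := by rw [Real.rpow_sub_one hj0.ne']; ring
  refine (norm_ewensMean_sub_le hθ (fun m => ?_) _ n).trans ?_
  · rw [phaseWeight, Complex.norm_exp_ofReal_mul_I]
  have hA : ∑ i ∈ Finset.range n, θ / (θ + i) * r i
      ≤ C * (θ * |α| * S + |α| ^ 3 * meanCycles θ n) := by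
    refine (Finset.sum_le_sum fun j _ => hstep j).trans ?_
    rw [← Finset.mul_sum, Finset.sum_add_distrib, ← Finset.mul_sum, ← Finset.mul_sum]
    have := hsum.sum_le_tsum (Finset.range n) fun _ _ => by positivity
    rw [meanCycles]
    gcongr
  have hB : r n ≤ C * (|α| + |α| ^ 3) := by
    refine (H α hα n hn).trans ?_
    have : (n : ℝ) ^ (-δ) ≤ 1 := Real.rpow_le_one_of_one_le_of_nonpos hn1 (by linarith)
    gcongr
    exact mul_le_of_le_one_right (abs_nonneg _) this
  have hm : 0 ≤ meanCycles θ n := Finset.sum_nonneg fun _ _ => by positivity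
  have g : 0 ≤ C * (θ * S * (|α| ^ 3 * (1 + meanCycles θ n))) := by positivity
  calc _ ≤ C * (|α| + |α| ^ 3) + C * (θ * |α| * S + |α| ^ 3 * meanCycles θ n) := add_le_add hB hA
    _ ≤ _ := by nlinarith

/-! ### Asymptotics of the constant-weight solution -/

theorem exists_abs_meanCycles_sub_le {θ : ℝ} (hθ : 0 < θ) :
    ∃ C : ℝ, ∀ n : ℕ, 1 ≤ n → |meanCycles θ n - θ * Real.log n| ≤ C := by
  -- Chosen so that `d (j + 1) ≤ θ + j`; comparison with the harmonic series then leaves terms `O((j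
  -- + 1) ^ (-2))`.
  set d := min θ 1 with hd
  have hd0 : 0 < d := by positivity
  have hsum : Summable fun j : ℕ => θ * |1 - θ| / d * (((j + 1 : ℕ) : ℝ) ^ 2)⁻¹ :=
    ((summable_nat_add_iff 1).2 (Real.summable_nat_pow_inv.2 one_lt_two)).mul_left _
  refine ⟨(∑' j : ℕ, θ * |1 - θ| / d * (((j + 1 : ℕ) : ℝ) ^ 2)⁻¹) + θ, fun n hn => ?_⟩
  have h1 : |meanCycles θ n - θ * (harmonic n : ℝ)|
      ≤ ∑' j : ℕ, θ * |1 - θ| / d * (((j + 1 : ℕ) : ℝ) ^ 2)⁻¹ := by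
    refine le_trans ?_ (hsum.sum_le_tsum (Finset.range n) fun _ _ => by positivity)
    rw [meanCycles, harmonic]
    push_cast
    rw [Finset.mul_sum, ← Finset.sum_sub_distrib]
    refine (Finset.abs_sum_le_sum_abs _ _).trans (Finset.sum_le_sum fun j _ => ?_)
    have e : θ / (θ + j) - θ * ((j : ℝ) + 1)⁻¹ = θ * (1 - θ) / ((θ + j) * (j + 1)) := by
      have : θ + j ≠ 0 := by positivity
      field_simp
      ring
    rw [e, abs_div, abs_mul, abs_of_pos hθ, abs_of_pos (by positivity : 0 < (θ + j) * ((j : ℝ) + 1))]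
    have hb : d * ((j : ℝ) + 1) ≤ θ + j := by
      have a1 : d ≤ θ := min_le_left _ _
      have a2 : d ≤ 1 := min_le_right _ _
      have a3 : (0 : ℝ) ≤ j := by positivity
      nlinarith
    calc _ ≤ θ * |1 - θ| / (d * ((j : ℝ) + 1) * (j + 1)) := by gcongr
      _ = _ := by field_simp
  have h2 : |(harmonic n : ℝ) - Real.log n| ≤ 1 := by
    have a1 := harmonic_le_one_add_log n
    have a2 := log_add_one_le_harmonic n
    have a3 : Real.log n ≤ Real.log ((n + 1 : ℕ) : ℝ) :=
      Real.log_le_log (by exact_mod_cast hn) (by push_cast; linarith)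
    rw [abs_le]
    constructor <;> linarith
  have h3 : meanCycles θ n - θ * Real.log n
      = (meanCycles θ n - θ * (harmonic n : ℝ)) + θ * ((harmonic n : ℝ) - Real.log n) := by ring
  rw [h3]
  refine (abs_add_le _ _).trans (add_le_add h1 ?_)
  rw [abs_mul, abs_of_pos hθ]
  exact mul_le_of_le_one_right hθ.le h2

theorem norm_prod_sub_prod_le_sum (a b : ℕ → ℂ) (ha : ∀ j, ‖a j‖ ≤ 1) (hb : ∀ j, ‖b j‖ ≤ 1) (n : ℕ) :
    ‖∏ j ∈ Finset.range n, a j - ∏ j ∈ Finset.range n, b j‖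
      ≤ ∑ j ∈ Finset.range n, ‖a j - b j‖ := by
  induction n with
  | zero => simp
  | succ n ih =>
    rw [Finset.prod_range_succ, Finset.prod_range_succ, Finset.sum_range_succ]
    have e : (∏ j ∈ Finset.range n, a j) * a n - (∏ j ∈ Finset.range n, b j) * b n
        = (∏ j ∈ Finset.range n, a j - ∏ j ∈ Finset.range n, b j) * a n
          + (∏ j ∈ Finset.range n, b j) * (a n - b n) := by ring
    rw [e]
    refine (norm_add_le _ _).trans (add_le_add ?_ ?_)
    · rw [norm_mul]
      exact (mul_le_of_le_one_right (norm_nonneg _) (ha n)).trans ih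
    · rw [norm_mul, norm_prod]
      exact mul_le_of_le_one_left (norm_nonneg _)
        (Finset.prod_le_one (fun _ _ => norm_nonneg _) fun j _ => hb j)

/-- Each factor is `1 + y` with `y = (s - 1) θ / (θ + j)`, and differs from `exp y` by at most `|y|
^ 2`. All factors lie in the unit disc, so the errors add, and they are summable in `j`. -/
theorem exists_norm_numCyclesGen_sub_exp_le {θ : ℝ} (hθ : 0 < θ) :
    ∃ C : ℝ, ∀ s : ℂ, ‖s‖ ≤ 1 → ‖s - 1‖ ≤ 1 → ∀ n : ℕ,
      ‖numCyclesGen θ s n - Complex.exp ((s - 1) * meanCycles θ n)‖ ≤ C * ‖s - 1‖ ^ 2 := by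
  set d := min θ 1 with hd
  have hd0 : 0 < d := by positivity
  have hsum : Summable fun j : ℕ => (θ / d) ^ 2 * (((j + 1 : ℕ) : ℝ) ^ 2)⁻¹ :=
    ((summable_nat_add_iff 1).2 (Real.summable_nat_pow_inv.2 one_lt_two)).mul_left _
  refine ⟨∑' j : ℕ, (θ / d) ^ 2 * (((j + 1 : ℕ) : ℝ) ^ 2)⁻¹, fun s hs hs1 n => ?_⟩
  have hre : (s - 1).re ≤ 0 := by
    have := (Complex.re_le_norm s).trans hs
    simp
    linarith
  have hx : ∀ j : ℕ, (s - 1) * ((θ / (θ + j) : ℝ) : ℂ) = (θ * s + j) / (θ + j) - 1 := by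
    intro j
    have := add_natCast_ne_zero hθ j
    push_cast
    field_simp
    ring
  have hfrac : ∀ j : ℕ, 0 ≤ θ / (θ + j) ∧ θ / (θ + j) ≤ 1 := fun j => by
    refine ⟨by positivity, (div_le_one (by positivity)).2 ?_⟩
    have : (0 : ℝ) ≤ j := by positivity
    linarith
  have hexp : Complex.exp ((s - 1) * meanCycles θ n)
      = ∏ j ∈ Finset.range n, Complex.exp ((s - 1) * ((θ / (θ + j) : ℝ) : ℂ)) := by
    rw [← Complex.exp_sum, ← Finset.mul_sum, meanCycles]
    push_cast
    rfl
  rw [hexp, numCyclesGen]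
  refine (norm_prod_sub_prod_le_sum (fun j => (θ * s + j) / (θ + j))
    (fun j => Complex.exp ((s - 1) * ((θ / (θ + j) : ℝ) : ℂ)))
    (norm_numCyclesGen_factor_le hθ hs) (fun j => ?_) n).trans ?_
  · rw [Complex.norm_exp, Real.exp_le_one_iff, mul_comm, Complex.re_ofReal_mul]
    exact mul_nonpos_of_nonneg_of_nonpos (hfrac j).1 hre
  rw [mul_comm (∑' j : ℕ, _)]
  refine le_trans ?_ (mul_le_mul_of_nonneg_left
    (hsum.sum_le_tsum (Finset.range n) fun _ _ => by positivity) (by positivity))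
  rw [Finset.mul_sum]
  refine Finset.sum_le_sum fun j _ => ?_
  have hn : ‖(s - 1) * ((θ / (θ + j) : ℝ) : ℂ)‖ = ‖s - 1‖ * (θ / (θ + j)) := by
    rw [norm_mul, Complex.norm_real, Real.norm_of_nonneg (hfrac j).1]
  have h1 : ‖(s - 1) * ((θ / (θ + j) : ℝ) : ℂ)‖ ≤ 1 := by
    rw [hn]
    exact mul_le_one₀ hs1 (hfrac j).1 (hfrac j).2
  have h2 := Complex.norm_exp_sub_one_sub_id_le h1
  have h3 : (θ * s + j) / (θ + j) - Complex.exp ((s - 1) * ((θ / (θ + j) : ℝ) : ℂ))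
      = -(Complex.exp ((s - 1) * ((θ / (θ + j) : ℝ) : ℂ)) - 1
        - (s - 1) * ((θ / (θ + j) : ℝ) : ℂ)) := by
    rw [hx j]
    ring
  rw [h3, norm_neg]
  refine h2.trans ?_
  rw [hn, mul_pow]
  refine mul_le_mul_of_nonneg_left ?_ (by positivity)
  have hb : d * ((j : ℝ) + 1) ≤ θ + j := by
    have a1 : d ≤ θ := min_le_left _ _
    have a2 : d ≤ 1 := min_le_right _ _
    have a3 : (0 : ℝ) ≤ j := by positivity
    nlinarith
  calc (θ / (θ + j)) ^ 2 ≤ (θ / (d * ((j : ℝ) + 1))) ^ 2 := by gcongr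
    _ = _ := by push_cast; field_simp


theorem tendsto_meanCycles_div_log {θ : ℝ} (hθ : 0 < θ) :
    Tendsto (fun n : ℕ => meanCycles θ n / Real.log n) atTop (𝓝 θ) := by
  obtain ⟨C, hC⟩ := exists_abs_meanCycles_sub_le hθ
  have hlog : Tendsto (fun n : ℕ => Real.log n) atTop atTop :=
    Real.tendsto_log_atTop.comp tendsto_natCast_atTop_atTop
  rw [tendsto_iff_norm_sub_tendsto_zero]
  refine squeeze_zero' (Eventually.of_forall fun _ => norm_nonneg _) ?_ (hlog.const_div_atTop C)
  filter_upwards [eventually_ge_atTop 1, hlog.eventually_gt_atTop 0] with n hn hl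
  have : meanCycles θ n / Real.log n - θ = (meanCycles θ n - θ * Real.log n) / Real.log n := by
    field_simp
  rw [this, norm_div, Real.norm_eq_abs, Real.norm_of_nonneg hl.le]
  exact div_le_div_of_nonneg_right (hC n hn) hl.le

theorem tendsto_exp_mul_ewensMean {θ : ℝ} (hθ : 0 < θ) {c : ℕ → ℝ} {μ ν κ : ℝ}
    (h1 : HasPowerMean c μ) (h2 : HasPowerMean (fun m => c m ^ 2) ν)
    (h4 : HasPowerMean (fun m => c m ^ 4) κ) (hc : IsSubpoly c) (u : ℝ) :
    Tendsto (fun n : ℕ => Complex.exp (((-(u * θ * μ * √(Real.log n)) : ℝ) : ℂ) * Complex.I)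
      * ewensMean θ (phaseWeight c (u / √(Real.log n))) n) atTop
      (𝓝 (Complex.exp ((-(θ * ν * u ^ 2 / 2) : ℝ) : ℂ))) := by
  have hlog : Tendsto (fun n : ℕ => Real.log n) atTop atTop :=
    Real.tendsto_log_atTop.comp tendsto_natCast_atTop_atTop
  set α : ℕ → ℝ := fun n => u / √(Real.log n) with hα
  set H : ℕ → ℝ := meanCycles θ with hH
  set s : ℕ → ℂ := fun n => flatWeight μ ν (α n) with hs
  have hα0 : Tendsto α atTop (𝓝 0) := (Real.tendsto_sqrt_atTop.comp hlog).const_div_atTop u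
  have haα0 : Tendsto (fun n => |α n|) atTop (𝓝 0) := by simpa using hα0.abs
  have hα1 : ∀ᶠ n in atTop, |α n| ≤ 1 :=
    (haα0.eventually_lt_const zero_lt_one).mono fun _ h => h.le
  have hq : Tendsto (fun n => α n ^ 2 * H n) atTop (𝓝 (u ^ 2 * θ)) := by
    refine ((tendsto_meanCycles_div_log hθ).const_mul (u ^ 2)).congr' ?_
    filter_upwards [hlog.eventually_gt_atTop 0] with n hl
    simp only [hα, hH]
    rw [div_pow, Real.sq_sqrt hl.le]
    ring
  have hq3 : Tendsto (fun n => |α n| ^ 3 * H n) atTop (𝓝 0) := by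
    have := haα0.mul hq
    rw [zero_mul] at this
    refine this.congr fun n => ?_
    rw [← sq_abs (α n)]
    ring
  have hs1 : ∀ n, ‖s n‖ ≤ 1 := fun n => norm_flatWeight_le (h1.sq_le h2) _
  have hst : Tendsto s atTop (𝓝 1) := by
    have hcont : Continuous (flatWeight μ ν) := by
      unfold flatWeight
      fun_prop
    have := (hcont.tendsto 0).comp hα0
    have h0 : flatWeight μ ν 0 = 1 := by simp [flatWeight]
    rw [h0] at this
    exact this
  have hst0 : Tendsto (fun n => ‖s n - 1‖) atTop (𝓝 0) := tendsto_iff_norm_sub_tendsto_zero.1 hst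
  set E : ℕ → ℂ := fun n => Complex.exp (((-(u * θ * μ * √(Real.log n)) : ℝ) : ℂ) * Complex.I)
    with hE
  have hEn : ∀ n, ‖E n‖ = 1 := fun n => Complex.norm_exp_ofReal_mul_I _
  obtain ⟨C, hC0, hC⟩ := exists_norm_ewensMean_sub_le hθ h1 h2 h4 hc
  obtain ⟨D, hD⟩ := exists_norm_numCyclesGen_sub_exp_le hθ
  obtain ⟨K, hK0, hK⟩ := exists_norm_flatWeight_sub_le μ ν
  obtain ⟨B, hB⟩ := exists_abs_meanCycles_sub_le hθ
  -- Three comparisons follow: true weights with the constant weight, the product with its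
  -- exponential, and the exponential with its limit. The phase `E n` has modulus one and costs
  -- nothing.
  have t1 : Tendsto (fun n => E n * (ewensMean θ (phaseWeight c (α n)) n
      - numCyclesGen θ (s n) n)) atTop (𝓝 0) := by
    have hlim : Tendsto (fun n => C * (|α n| + (|α n| ^ 3 + |α n| ^ 3 * H n))) atTop (𝓝 0) := by
      simpa using (haα0.add ((haα0.pow 3).add hq3)).const_mul C
    refine squeeze_zero_norm' ?_ hlim
    filter_upwards [hα1, eventually_ge_atTop 1] with n hn hn1
    rw [norm_mul, hEn, one_mul]
    refine (hC _ hn n hn1).trans_eq ?_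
    ring
  have t2 : Tendsto (fun n => E n * (numCyclesGen θ (s n) n
      - Complex.exp ((s n - 1) * H n))) atTop (𝓝 0) := by
    have hlim : Tendsto (fun n => D * ‖s n - 1‖ ^ 2) atTop (𝓝 0) := by
      simpa using (hst0.pow 2).const_mul D
    refine squeeze_zero_norm' ?_ hlim
    filter_upwards [hst0.eventually_lt_const zero_lt_one] with n hn
    rw [norm_mul, hEn, one_mul]
    exact hD _ (hs1 n) hn.le n
  have t3 : Tendsto (fun n => E n * Complex.exp ((s n - 1) * H n)) atTop
      (𝓝 (Complex.exp ((-(θ * ν * u ^ 2 / 2) : ℝ) : ℂ))) := by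
    simp only [hE, ← Complex.exp_add]
    refine (Complex.continuous_exp.tendsto _).comp ?_
    have a1 : Tendsto (fun n => (s n - (1 + (α n * μ : ℝ) * Complex.I - (α n ^ 2 * ν / 2 : ℝ))) * H n)
        atTop (𝓝 0) := by
      have hlim : Tendsto (fun n => K * (|α n| ^ 3 * H n)) atTop (𝓝 0) := by
        simpa using hq3.const_mul K
      refine squeeze_zero_norm' ?_ hlim
      filter_upwards [hα1] with n hn
      have hH0 : 0 ≤ H n := Finset.sum_nonneg fun _ _ => by positivity
      rw [norm_mul, Complex.norm_real, Real.norm_of_nonneg hH0, ← mul_assoc]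
      exact mul_le_mul_of_nonneg_right (hK _ hn) hH0
    have a2 : Tendsto (fun n => ((μ * (α n * (H n - θ * Real.log n)) : ℝ) : ℂ) * Complex.I)
        atTop (𝓝 0) := by
      have hlim : Tendsto (fun n => |μ| * (|α n| * B)) atTop (𝓝 0) := by
        simpa using (haα0.mul_const B).const_mul |μ|
      refine squeeze_zero_norm' ?_ hlim
      filter_upwards [eventually_ge_atTop 1] with n hn
      rw [norm_mul, Complex.norm_I, mul_one, Complex.norm_real, Real.norm_eq_abs, abs_mul, abs_mul]
      gcongr
      exact hB n hn
    have a3 : Tendsto (fun n => ((-(ν / 2 * (α n ^ 2 * H n)) : ℝ) : ℂ)) atTop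
        (𝓝 ((-(ν / 2 * (u ^ 2 * θ)) : ℝ) : ℂ)) :=
      (Complex.continuous_ofReal.tendsto _).comp (hq.const_mul _).neg
    have := (a1.add a2).add a3
    rw [zero_add, zero_add, show ν / 2 * (u ^ 2 * θ) = θ * ν * u ^ 2 / 2 by ring] at this
    refine this.congr' ?_
    filter_upwards [hlog.eventually_gt_atTop 0] with n hl
    -- With this identity the centring phase cancels the drift `α μ H_n` up to `α μ (H_n - θ log
    -- n)`, the term handled by `a2`.
    have hsq : u * √(Real.log n) = α n * Real.log n := by
      have h0 : 0 < √(Real.log n) := Real.sqrt_pos.2 hl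
      simp only [hα]
      rw [div_mul_eq_mul_div, eq_div_iff h0.ne', mul_assoc, Real.mul_self_sqrt hl.le]
    have hsq' : (u : ℂ) * (√(Real.log n) : ℝ) = α n * (Real.log n : ℝ) := by exact_mod_cast hsq
    generalize Real.log n = l at hsq' ⊢
    push_cast
    linear_combination (θ * μ * Complex.I) * hsq'
  have := (t1.add t2).add t3
  rw [zero_add, zero_add] at this
  refine this.congr fun n => ?_
  ring


/-! ### Equidistribution of `m t` for Lipschitz functions -/

theorem continuous_of_abs_sub_le {h : ℝ → ℝ} {L : ℝ} (hL : ∀ y z, |h y - h z| ≤ L * |y - z|) :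
    Continuous h := by
  refine (LipschitzWith.of_dist_le_mul (K := L.toNNReal) fun y z => ?_).continuous
  rw [Real.dist_eq, Real.dist_eq]
  refine (hL y z).trans ?_
  gcongr
  exact Real.le_coe_toNNReal L

theorem abs_mul_sub_integral_le {h : ℝ → ℝ} {L : ℝ} (hL : ∀ y z, |h y - h z| ≤ L * |y - z|)
    {a d : ℝ} (hd : 0 ≤ d) : |d * h a - ∫ s in a..(a + d), h s| ≤ L * d * d := by
  have hL0 : 0 ≤ L := by simpa using (abs_nonneg _).trans (hL 0 1)
  have hc := continuous_of_abs_sub_le hL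
  have h1 : d * h a - ∫ s in a..(a + d), h s = ∫ s in a..(a + d), (h a - h s) := by
    rw [intervalIntegral.integral_sub (by simp) (hc.intervalIntegrable _ _)]
    simp
  rw [h1, ← Real.norm_eq_abs]
  have := intervalIntegral.norm_integral_le_of_norm_le_const (a := a) (b := a + d)
    (f := fun s => h a - h s) (C := L * d) fun s hs => by
      rw [Set.uIoc_of_le (by linarith)] at hs
      rw [Real.norm_eq_abs]
      refine (hL a s).trans (mul_le_mul_of_nonneg_left ?_ hL0)
      rw [abs_le]
      constructor <;> linarith [hs.1, hs.2]
  simpa [abs_of_nonneg hd] using this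

theorem integral_periodic {h : ℝ → ℝ} (hp : Function.Periodic h 1) (y : ℝ) :
    ∫ s in y..(y + 1), h s = ∫ s in (0 : ℝ)..1, h s := by
  simpa using hp.intervalIntegral_add_eq y 0

/-- A Riemann sum of mesh `1 / q`: each cell errs by at most `L / q ^ 2`, and the factor `q` and the
`q` cells restore `L`. -/
theorem abs_sum_equispaced_sub_le {h : ℝ → ℝ} {L : ℝ} (hp : Function.Periodic h 1)
    (hL : ∀ y z, |h y - h z| ≤ L * |y - z|) (y : ℝ) {q : ℕ} (hq : 0 < q) :
    |∑ j ∈ Finset.range q, h (y + j / q) - q * ∫ s in (0 : ℝ)..1, h s| ≤ L := by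
  have hq' : (0 : ℝ) < q := by exact_mod_cast hq
  have hc := continuous_of_abs_sub_le hL
  have h1 : ∫ s in (0 : ℝ)..1, h s
      = ∑ j ∈ Finset.range q, ∫ s in (y + j / q)..(y + j / q + 1 / q), h s := by
    rw [← integral_periodic hp y]
    have := intervalIntegral.sum_integral_adjacent_intervals (μ := volume) (f := h)
      (a := fun j : ℕ => y + j / q) (n := q) fun k _ => hc.intervalIntegrable _ _
    simp only [Nat.cast_zero, zero_div, add_zero, div_self hq'.ne'] at this
    rw [← this]
    refine Finset.sum_congr rfl fun j _ => ?_
    congr 1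
    push_cast
    ring
  rw [h1, Finset.mul_sum, ← Finset.sum_sub_distrib]
  refine (Finset.abs_sum_le_sum_abs _ _).trans ?_
  calc _ ≤ ∑ j ∈ Finset.range q, L / q := by
        refine Finset.sum_le_sum fun j _ => ?_
        have := abs_mul_sub_integral_le hL (a := y + j / q) (d := 1 / q) (by positivity)
        have e : h (y + j / q) - q * ∫ s in (y + j / q)..(y + j / q + 1 / q), h s
            = q * (1 / q * h (y + j / q) - ∫ s in (y + j / q)..(y + j / q + 1 / q), h s) := by
          field_simp
        rw [e, abs_mul, abs_of_pos hq']
        calc _ ≤ q * (L * (1 / q) * (1 / q)) := by gcongr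
          _ = _ := by field_simp
    _ = L := by
        rw [Finset.sum_const, Finset.card_range, nsmul_eq_mul]
        field_simp

/-- Multiplication by `a` permutes the residues modulo `q`. -/
theorem sum_mul_div_eq_sum_div {h : ℝ → ℝ} (hp : Function.Periodic h 1) (y : ℝ) {q : ℕ} (hq : 0 < q)
    {a : ℤ} (ha : IsCoprime a (q : ℤ)) :
    ∑ j ∈ Finset.range q, h (y + j * (a / q)) = ∑ j ∈ Finset.range q, h (y + j / q) := by
  have hq' : (0 : ℝ) < q := by exact_mod_cast hq
  have hqz : (0 : ℤ) < q := by exact_mod_cast hq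
  have hmaps : Set.MapsTo (fun j : ℕ => ((j * a : ℤ) % q).toNat) (Finset.range q)
      (Finset.range q) := fun j _ => by
    have := Int.emod_lt_of_pos (j * a) hqz
    have := Int.emod_nonneg (j * a) hqz.ne'
    simp only [Finset.coe_range, Set.mem_Iio]
    omega
  have hinj : Set.InjOn (fun j : ℕ => ((j * a : ℤ) % q).toNat) (Finset.range q) := by
    intro i hi j hj hij
    simp only [Finset.coe_range, Set.mem_Iio] at hi hj
    have h1 := Int.emod_nonneg (i * a) hqz.ne'
    have h2 := Int.emod_nonneg (j * a) hqz.ne'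
    have h3 : (i * a : ℤ) % q = (j * a : ℤ) % q := by
      simp only at hij
      omega
    have h4 : (q : ℤ) ∣ ((j : ℤ) - i) * a := by
      rw [sub_mul]
      exact Int.ModEq.dvd h3
    have h5 : (q : ℤ) ∣ (j : ℤ) - i := ha.symm.dvd_of_dvd_mul_right h4
    have h6 : (j : ℤ) - i = 0 := Int.eq_zero_of_abs_lt_dvd h5 (by rw [abs_lt]; omega)
    omega
  refine Finset.sum_nbij (fun j : ℕ => ((j * a : ℤ) % q).toNat) hmaps hinj
    (Finset.surjOn_of_injOn_of_card_le _ hmaps hinj le_rfl) fun j _ => ?_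
  have h2 := Int.emod_nonneg (j * a) hqz.ne'
  have h3 := Int.emod_add_mul_ediv (j * a : ℤ) q
  set r := (j * a : ℤ) % q with hr
  set k := (j * a : ℤ) / q with hk
  have h4 : (j * a : ℝ) = r + q * k := by exact_mod_cast h3.symm
  have h5 : ((r.toNat : ℕ) : ℝ) = r := by exact_mod_cast Int.toNat_of_nonneg h2
  have h6 : y + j * ((a : ℝ) / q) = y + ((r.toNat : ℕ) : ℝ) / q + k * 1 := by
    rw [h5, ← mul_div_assoc, h4]
    field_simp
    ring
  rw [h6]
  exact hp.int_mul k _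

/-- For `j < q` the points `j t` and `j a / q` differ by at most `1 / q`, so passing to equispaced
points costs `L` in total. -/
theorem abs_sum_block_sub_le {h : ℝ → ℝ} {L : ℝ} (hp : Function.Periodic h 1)
    (hL : ∀ y z, |h y - h z| ≤ L * |y - z|) {t : ℝ} {q : ℕ} (hq : 0 < q) {a : ℤ}
    (ha : IsCoprime a (q : ℤ)) (ht : |t - a / q| ≤ 1 / (q : ℝ) ^ 2) (x : ℝ) :
    |∑ j ∈ Finset.range q, h (x + j * t) - q * ∫ s in (0 : ℝ)..1, h s| ≤ 2 * L := by
  have hL0 : 0 ≤ L := by simpa using (abs_nonneg _).trans (hL 0 1)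
  have hq' : (0 : ℝ) < q := by exact_mod_cast hq
  have h1 := abs_sum_equispaced_sub_le hp hL x hq
  rw [← sum_mul_div_eq_sum_div hp x hq ha] at h1
  have h2 : |∑ j ∈ Finset.range q, h (x + j * t) - ∑ j ∈ Finset.range q, h (x + j * (a / q))|
      ≤ L := by
    rw [← Finset.sum_sub_distrib]
    refine (Finset.abs_sum_le_sum_abs _ _).trans ?_
    calc _ ≤ ∑ j ∈ Finset.range q, L / q := by
          refine Finset.sum_le_sum fun j hj => ?_
          have hj' : (j : ℝ) ≤ q := by exact_mod_cast (Finset.mem_range.1 hj).le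
          refine (hL _ _).trans ?_
          have e : x + j * t - (x + j * (a / q)) = j * (t - a / q) := by ring
          rw [e, abs_mul, Nat.abs_cast]
          calc L * (j * |t - a / q|) ≤ L * (q * (1 / (q : ℝ) ^ 2)) := by gcongr
            _ = _ := by field_simp
      _ = L := by
          rw [Finset.sum_const, Finset.card_range, nsmul_eq_mul]
          field_simp
  calc _ ≤ _ + _ := abs_sub_le _ (∑ j ∈ Finset.range q, h (x + j * (a / q))) _
    _ ≤ L + L := add_le_add h2 h1
    _ = 2 * L := by ring

theorem abs_sub_integral_le {h : ℝ → ℝ} {L : ℝ} (hp : Function.Periodic h 1)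
    (hL : ∀ y z, |h y - h z| ≤ L * |y - z|) (x : ℝ) : |h x - ∫ s in (0 : ℝ)..1, h s| ≤ L := by
  have := abs_mul_sub_integral_le hL (a := x) zero_le_one
  rwa [integral_periodic hp, one_mul, mul_one, mul_one] at this

theorem abs_sum_range_sub_le {h : ℝ → ℝ} {L : ℝ} (hp : Function.Periodic h 1)
    (hL : ∀ y z, |h y - h z| ≤ L * |y - z|) {t : ℝ} {q : ℕ} (hq : 0 < q) {a : ℤ}
    (ha : IsCoprime a (q : ℤ)) (ht : |t - a / q| ≤ 1 / (q : ℝ) ^ 2) (N : ℕ) :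
    |∑ m ∈ Finset.Icc 1 N, h (m * t) - N * ∫ s in (0 : ℝ)..1, h s| ≤ L * (2 * (N / q) + q) := by
  have hL0 : 0 ≤ L := by simpa using (abs_nonneg _).trans (hL 0 1)
  have hq' : (0 : ℝ) < q := by exact_mod_cast hq
  set I := ∫ s in (0 : ℝ)..1, h s with hI
  have hshift : ∑ m ∈ Finset.Icc 1 N, h (m * t) = ∑ m ∈ Finset.range N, h (t + m * t) := by
    rw [← Finset.Ico_add_one_right_eq_Icc, Finset.sum_Ico_eq_sum_range, Nat.add_sub_cancel]
    refine Finset.sum_congr rfl fun m _ => ?_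
    push_cast
    ring_nf
  have hblock : ∀ B : ℕ, |∑ m ∈ Finset.range (q * B), h (t + m * t) - (q * B : ℕ) * I|
      ≤ 2 * L * B := by
    intro B
    induction B with
    | zero => simp
    | succ B ih =>
      rw [Nat.mul_succ, Finset.sum_range_add]
      have h1 := abs_sum_block_sub_le hp hL hq ha ht (t + (q * B : ℕ) * t)
      have e : ∑ m ∈ Finset.range (q * B), h (t + m * t)
          + ∑ j ∈ Finset.range q, h (t + (q * B + j : ℕ) * t) - ((q * B + q : ℕ) : ℝ) * I
          = (∑ m ∈ Finset.range (q * B), h (t + m * t) - (q * B : ℕ) * I)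
            + (∑ j ∈ Finset.range q, h (t + (q * B : ℕ) * t + j * t) - q * I) := by
        have : ∀ j : ℕ, t + (q * B + j : ℕ) * t = t + (q * B : ℕ) * t + j * t := fun j => by
          push_cast
          ring
        simp only [this]
        push_cast
        ring
      rw [e]
      refine (abs_add_le _ _).trans ((add_le_add ih h1).trans_eq ?_)
      push_cast
      ring
  have hdm := Nat.div_add_mod N q
  set B := N / q with hB
  set r := N % q with hr
  have hrq : (r : ℝ) ≤ q := by exact_mod_cast (Nat.mod_lt N hq).le
  have hBq : (B : ℝ) ≤ N / q := Nat.cast_div_le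
  have hNr : (N : ℝ) = (q * B : ℕ) + r := by exact_mod_cast hdm.symm
  have hrem : |∑ j ∈ Finset.range r, h (t + (q * B + j : ℕ) * t) - r * I| ≤ r * L := by
    have : ∑ j ∈ Finset.range r, h (t + (q * B + j : ℕ) * t) - r * I
        = ∑ j ∈ Finset.range r, (h (t + (q * B + j : ℕ) * t) - I) := by
      rw [Finset.sum_sub_distrib, Finset.sum_const, Finset.card_range, nsmul_eq_mul]
    rw [this]
    refine (Finset.abs_sum_le_sum_abs _ _).trans ?_
    refine (Finset.sum_le_sum fun j _ => abs_sub_integral_le hp hL _).trans_eq ?_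
    rw [Finset.sum_const, Finset.card_range, nsmul_eq_mul]
  rw [hshift, hNr]
  conv_lhs => rw [← hdm, Finset.sum_range_add]
  have e : ∑ m ∈ Finset.range (q * B), h (t + m * t)
      + ∑ j ∈ Finset.range r, h (t + (q * B + j : ℕ) * t) - (((q * B : ℕ) : ℝ) + r) * I
      = (∑ m ∈ Finset.range (q * B), h (t + m * t) - (q * B : ℕ) * I)
        + (∑ j ∈ Finset.range r, h (t + (q * B + j : ℕ) * t) - r * I) := by ring
  rw [e]
  refine (abs_add_le _ _).trans ((add_le_add (hblock B) hrem).trans ?_)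
  rw [← hNr]
  nlinarith

theorem distNearestInt_le (s : ℝ) (k : ℤ) : distNearestInt s ≤ |s - k| := by
  rw [distNearestInt, ← abs_sub_round_eq_min]
  exact round_le s k

/-- The error `L (2 N / q + q)` saves a power of `N` once `q` is at most `√N` and at least a
positive power of `N`. Dirichlet's theorem gives the upper bound on `q`, finite type the lower one.
-/
theorem exists_abs_sum_sub_le {t K γ : ℝ} (hK : 0 < K) (hγ : 0 < γ)
    (ht : ∀ m : ℤ, m ≠ 0 → K / |(m : ℝ)| ^ γ < distNearestInt (m * t)) :
    ∃ β C : ℝ, 0 < β ∧ β < 1 ∧ 0 ≤ C ∧ ∀ (h : ℝ → ℝ) (L : ℝ), Function.Periodic h 1 →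
      (∀ y z, |h y - h z| ≤ L * |y - z|) → ∀ N : ℕ, 1 ≤ N →
      |∑ m ∈ Finset.Icc 1 N, h (m * t) - N * ∫ s in (0 : ℝ)..1, h s|
        ≤ C * L * (N : ℝ) ^ (1 - β) := by
  set β := min (1 / 2) (1 / (2 * γ)) with hβ
  have hβ1 : β ≤ 1 / 2 := min_le_left _ _
  have hβ2 : β ≤ 1 / (2 * γ) := min_le_right _ _
  refine ⟨β, 2 * (K ^ (1 / γ))⁻¹ + 1, by positivity, by linarith, by positivity,
    fun h L hp hL N hN => ?_⟩
  have hL0 : 0 ≤ L := by simpa using (abs_nonneg _).trans (hL 0 1)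
  have hN1 : (1 : ℝ) ≤ N := by exact_mod_cast hN
  have hN0 : (0 : ℝ) < N := by linarith
  have hn0 : 0 < Nat.sqrt N := Nat.sqrt_pos.2 hN
  obtain ⟨ρ, hρ, hden⟩ := Real.exists_rat_abs_sub_le_and_den_le t hn0
  set q := ρ.den with hq
  have hq0 : 0 < q := ρ.pos
  have hq' : (0 : ℝ) < q := by exact_mod_cast hq0
  have hqn : (q : ℝ) ≤ Nat.sqrt N := by exact_mod_cast hden
  have hρe : (ρ : ℝ) = ρ.num / q := by
    rw [hq, ← Rat.cast_intCast, ← Rat.cast_natCast, ← Rat.cast_div, Rat.num_div_den]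
  have hco : IsCoprime ρ.num (q : ℤ) :=
    Int.isCoprime_iff_gcd_eq_one.2 (by simpa [Int.gcd] using ρ.reduced)
  rw [hρe] at hρ
  have happ : |t - ρ.num / q| ≤ 1 / (q : ℝ) ^ 2 := by
    refine hρ.trans ?_
    rw [sq]
    gcongr
    linarith
  have h1 := abs_sum_range_sub_le hp hL hq0 hco happ N
  have hsq : (N : ℝ) ^ (1 / 2 : ℝ) ≤ (Nat.sqrt N : ℝ) + 1 := by
    rw [← Real.sqrt_eq_rpow, Real.sqrt_le_left (by positivity)]
    have := (Nat.lt_succ_sqrt N).le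
    rw [sq]
    exact_mod_cast this
  have hsq2 : (Nat.sqrt N : ℝ) ≤ (N : ℝ) ^ (1 / 2 : ℝ) := by
    rw [← Real.sqrt_eq_rpow]
    exact Real.nat_sqrt_le_real_sqrt
  -- `q t` is within `1 / (⌊√N⌋ + 1)` of an integer, while finite type keeps it farther than `K / q
  -- ^ γ`.
  have hlow : K ^ (1 / γ) * (N : ℝ) ^ (1 / (2 * γ)) ≤ q := by
    have h2 := (ht q (by exact_mod_cast hq0.ne')).trans_le (distNearestInt_le _ ρ.num)
    have h3 : |((q : ℤ) : ℝ) * t - ρ.num| ≤ 1 / ((Nat.sqrt N : ℝ) + 1) := by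
      have : ((q : ℤ) : ℝ) * t - ρ.num = q * (t - ρ.num / q) := by
        push_cast
        field_simp
      rw [this, abs_mul, abs_of_pos hq']
      calc _ ≤ q * (1 / (((Nat.sqrt N : ℝ) + 1) * q)) := by gcongr
        _ = _ := by field_simp
    have h4 := h2.trans_le h3
    rw [Int.cast_natCast, Nat.abs_cast, div_lt_div_iff₀ (by positivity) (by positivity), one_mul] at h4
    have h5 : K * (N : ℝ) ^ (1 / 2 : ℝ) ≤ (q : ℝ) ^ γ :=
      (mul_le_mul_of_nonneg_left hsq hK.le).trans h4.le
    have h6 := Real.rpow_le_rpow (by positivity) h5 (by positivity : 0 ≤ 1 / γ)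
    rw [Real.mul_rpow hK.le (by positivity), ← Real.rpow_mul hN0.le, ← Real.rpow_mul hq'.le,
      mul_one_div_cancel hγ.ne', Real.rpow_one] at h6
    refine le_trans (le_of_eq ?_) h6
    congr 2
    field_simp
  refine h1.trans ?_
  have e1 : (N : ℝ) / q ≤ (K ^ (1 / γ))⁻¹ * (N : ℝ) ^ (1 - β) := by
    calc (N : ℝ) / q ≤ N / (K ^ (1 / γ) * (N : ℝ) ^ (1 / (2 * γ))) := by gcongr
      _ = (K ^ (1 / γ))⁻¹ * (N : ℝ) ^ (1 - 1 / (2 * γ)) := by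
          rw [Real.rpow_sub hN0, Real.rpow_one]
          field_simp
      _ ≤ _ := by gcongr
  have e2 : (q : ℝ) ≤ (N : ℝ) ^ (1 - β) := by
    refine hqn.trans (hsq2.trans ?_)
    exact Real.rpow_le_rpow_of_exponent_le hN1 (by linarith)
  calc _ ≤ L * (2 * ((K ^ (1 / γ))⁻¹ * (N : ℝ) ^ (1 - β)) + (N : ℝ) ^ (1 - β)) := by gcongr
    _ = _ := by ring


/-! ### Equidistribution for functions with mild singularities -/

/-- `Q` measures the distance to the singularities of the functions that it controls. -/
structure IsGauge (Q : ℝ → ℝ) (Λ η : ℝ) : Prop where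
  periodic : Function.Periodic Q 1
  nonneg : ∀ s, 0 ≤ Q s
  one_le : 1 ≤ Λ
  lipschitz : ∀ y z, |Q y - Q z| ≤ Λ * |y - z|
  exponent_pos : 0 < η
  exponent_le : η ≤ 1
  ae_pos : ∀ᵐ s, 0 < Q s
  integrable : IntervalIntegrable (fun s => Q s ^ (-η)) volume 0 1

/-- `g` is Lipschitz away from the zeros of `Q`, with mild growth near them and along the
multiples of `t`. -/
structure IsTame (Q : ℝ → ℝ) (t : ℝ) (g : ℝ → ℝ) : Prop where
  periodic : Function.Periodic g 1
  measurable : Measurable g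
  bound : ∀ ε : ℝ, 0 < ε → ∃ C : ℝ, 0 ≤ C ∧ ∀ s, 0 < Q s → |g s| ≤ C * Q s ^ (-ε)
  lipschitz : ∃ C A : ℝ, 0 ≤ C ∧ 0 ≤ A ∧ ∀ ρ : ℝ, 0 < ρ → ρ ≤ 1 → ∀ y z,
    (∀ w ∈ Set.uIcc y z, ρ ≤ Q w) → |g y - g z| ≤ C * ρ ^ (-A) * |y - z|
  subpoly : IsSubpoly (fun m => g (m * t))

theorem IsTame.mul {Q : ℝ → ℝ} {t : ℝ} {f g : ℝ → ℝ} (hf : IsTame Q t f) (hg : IsTame Q t g) :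
    IsTame Q t (fun s => f s * g s) where
  periodic := hf.periodic.mul hg.periodic
  measurable := hf.measurable.mul hg.measurable
  bound ε hε := by
    obtain ⟨C, hC, h1⟩ := hf.bound (ε / 2) (by positivity)
    obtain ⟨D, hD, h2⟩ := hg.bound (ε / 2) (by positivity)
    refine ⟨C * D, by positivity, fun s hs => ?_⟩
    rw [abs_mul]
    calc _ ≤ (C * Q s ^ (-(ε / 2))) * (D * Q s ^ (-(ε / 2))) :=
          mul_le_mul (h1 s hs) (h2 s hs) (abs_nonneg _) ((abs_nonneg _).trans (h1 s hs))
      _ = C * D * (Q s ^ (-(ε / 2)) * Q s ^ (-(ε / 2))) := by ring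
      _ = _ := by rw [← Real.rpow_add hs]; ring_nf
  lipschitz := by
    -- Any fixed exponent would do: the sup bound `ρ ^ (-1)` only raises the exponent of the
    -- Lipschitz constant.
    obtain ⟨C, hC, h1⟩ := hf.bound 1 one_pos
    obtain ⟨D, hD, h2⟩ := hg.bound 1 one_pos
    obtain ⟨C', A, hC', hA, h3⟩ := hf.lipschitz
    obtain ⟨D', B, hD', hB, h4⟩ := hg.lipschitz
    refine ⟨C * D' + D * C', A + B + 1, by positivity, by positivity, fun ρ hρ hρ1 y z hQ => ?_⟩
    have hmono : ∀ {q : ℝ}, ρ ≤ q → q ^ (-1 : ℝ) ≤ ρ ^ (-1 : ℝ) := fun h =>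
      Real.rpow_le_rpow_of_nonpos hρ h (by norm_num)
    have hy := hQ y Set.left_mem_uIcc
    have hz := hQ z Set.right_mem_uIcc
    have b1 : |f y| ≤ C * ρ ^ (-1 : ℝ) :=
      (h1 y (hρ.trans_le hy)).trans (mul_le_mul_of_nonneg_left (hmono hy) hC)
    have b2 : |g z| ≤ D * ρ ^ (-1 : ℝ) :=
      (h2 z (hρ.trans_le hz)).trans (mul_le_mul_of_nonneg_left (hmono hz) hD)
    have e1 : ρ ^ (-1 : ℝ) * ρ ^ (-B) ≤ ρ ^ (-(A + B + 1)) := by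
      rw [← Real.rpow_add hρ]
      exact Real.rpow_le_rpow_of_exponent_ge hρ hρ1 (by linarith)
    have e2 : ρ ^ (-1 : ℝ) * ρ ^ (-A) ≤ ρ ^ (-(A + B + 1)) := by
      rw [← Real.rpow_add hρ]
      exact Real.rpow_le_rpow_of_exponent_ge hρ hρ1 (by linarith)
    have e : f y * g y - f z * g z = f y * (g y - g z) + g z * (f y - f z) := by ring
    rw [e]
    refine (abs_add_le _ _).trans ?_
    rw [abs_mul, abs_mul]
    calc _ ≤ (C * ρ ^ (-1 : ℝ)) * (D' * ρ ^ (-B) * |y - z|)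
          + (D * ρ ^ (-1 : ℝ)) * (C' * ρ ^ (-A) * |y - z|) := by
          gcongr
          · exact h4 ρ hρ hρ1 y z hQ
          · exact h3 ρ hρ hρ1 y z hQ
      _ = (C * D' * (ρ ^ (-1 : ℝ) * ρ ^ (-B)) + D * C' * (ρ ^ (-1 : ℝ) * ρ ^ (-A))) * |y - z| := by
          ring
      _ ≤ (C * D' * ρ ^ (-(A + B + 1)) + D * C' * ρ ^ (-(A + B + 1))) * |y - z| := by gcongr
      _ = _ := by ring
  subpoly := hf.subpoly.mul hg.subpoly

theorem IsTame.pow {Q : ℝ → ℝ} {t : ℝ} {g : ℝ → ℝ} (hg : IsTame Q t g) {k : ℕ} (hk : k ≠ 0) :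
    IsTame Q t (fun s => g s ^ k) := by
  obtain ⟨k, rfl⟩ := Nat.exists_eq_succ_of_ne_zero hk
  clear hk
  induction k with
  | zero => simpa using hg
  | succ k ih =>
    simp only [pow_succ _ (k + 1)]
    exact ih.mul hg

/-- The projection of the real line onto `[0, 1]`. -/
noncomputable def clamp (x : ℝ) : ℝ := max 0 (min 1 x)

theorem clamp_nonneg (x : ℝ) : 0 ≤ clamp x := le_max_left _ _

theorem clamp_le_one (x : ℝ) : clamp x ≤ 1 := max_le zero_le_one (min_le_left _ _)

theorem clamp_of_nonpos {x : ℝ} (h : x ≤ 0) : clamp x = 0 :=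
  max_eq_left ((min_le_right _ _).trans h)

theorem clamp_of_one_le {x : ℝ} (h : 1 ≤ x) : clamp x = 1 := by
  rw [clamp, min_eq_left h, max_eq_right zero_le_one]

theorem abs_clamp_sub_le (x y : ℝ) : |clamp x - clamp y| ≤ |x - y| := by
  refine (abs_max_sub_max_le_max _ _ _ _).trans ?_
  rw [sub_self, abs_zero, max_eq_right (abs_nonneg _)]
  refine (abs_min_sub_min_le_max _ _ _ _).trans ?_
  rw [sub_self, abs_zero, max_eq_right (abs_nonneg _)]

/-- A cutoff that vanishes where `Q ≤ ρ` and equals one where `Q ≥ 2 ρ`. -/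
noncomputable def cutoff (Q : ℝ → ℝ) (ρ s : ℝ) : ℝ := clamp (Q s / ρ - 1)

theorem cutoff_nonneg (Q : ℝ → ℝ) (ρ s : ℝ) : 0 ≤ cutoff Q ρ s := clamp_nonneg _

section Cutoff

variable {Q : ℝ → ℝ} {Λ η : ℝ}

theorem cutoff_eq_zero {ρ s : ℝ} (hρ : 0 < ρ) (h : Q s ≤ ρ) : cutoff Q ρ s = 0 :=
  clamp_of_nonpos (by rw [sub_nonpos, div_le_one hρ]; exact h)

theorem cutoff_eq_one {ρ s : ℝ} (hρ : 0 < ρ) (h : 2 * ρ ≤ Q s) : cutoff Q ρ s = 1 :=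
  clamp_of_one_le (by rw [le_sub_iff_add_le, le_div_iff₀ hρ]; linarith)

theorem IsGauge.abs_cutoff_sub_le (hQ : IsGauge Q Λ η) {ρ : ℝ} (hρ : 0 < ρ) (y z : ℝ) :
    |cutoff Q ρ y - cutoff Q ρ z| ≤ Λ / ρ * |y - z| := by
  refine (abs_clamp_sub_le _ _).trans ?_
  have : Q y / ρ - 1 - (Q z / ρ - 1) = (Q y - Q z) / ρ := by ring
  rw [this, abs_div, abs_of_pos hρ, div_mul_eq_mul_div]
  exact div_le_div_of_nonneg_right (hQ.lipschitz y z) hρ.le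

theorem IsGauge.continuous (hQ : IsGauge Q Λ η) : Continuous Q :=
  continuous_of_abs_sub_le hQ.lipschitz

theorem IsGauge.periodic_cutoff (hQ : IsGauge Q Λ η) (ρ : ℝ) :
    Function.Periodic (cutoff Q ρ) 1 := fun s => by
  rw [cutoff, cutoff, hQ.periodic]

/-- `g` cut off near its singularities is Lipschitz. -/
theorem IsTame.exists_lipschitz_mul_cutoff {t : ℝ} {g : ℝ → ℝ} (hQ : IsGauge Q Λ η)
    (hg : IsTame Q t g) :
    ∃ C A : ℝ, 0 ≤ C ∧ 2 ≤ A ∧ ∀ ρ : ℝ, 0 < ρ → ρ ≤ 1 → ∀ y z,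
      |g y * cutoff Q ρ y - g z * cutoff Q ρ z| ≤ C * ρ ^ (-A) * |y - z| := by
  obtain ⟨C, hC, h1⟩ := hg.bound 1 one_pos
  obtain ⟨D, A, hD, hA, h2⟩ := hg.lipschitz
  have hΛ0 : 0 < Λ := zero_lt_one.trans_le hQ.one_le
  refine ⟨4 * C * Λ + D * (2 ^ A) + 2 * C * Λ, A + 2, by positivity, by linarith,
    fun ρ hρ hρ1 => ?_⟩
  have p2 : ρ ^ (-1 : ℝ) / ρ ≤ ρ ^ (-(A + 2)) := by
    rw [← Real.rpow_sub_one hρ.ne']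
    exact Real.rpow_le_rpow_of_exponent_ge hρ hρ1 (by linarith)
  have pA : ρ ^ (-A) ≤ ρ ^ (-(A + 2)) :=
    Real.rpow_le_rpow_of_exponent_ge hρ hρ1 (by linarith)
  have hinv : ∀ {r : ℝ}, r ^ (-1 : ℝ) = r⁻¹ := fun {r} => Real.rpow_neg_one r
  have hbd : ∀ s, |g s * cutoff Q ρ s| ≤ C * ρ ^ (-1 : ℝ) := by
    intro s
    rcases le_or_gt (Q s) ρ with h | h
    · rw [cutoff_eq_zero hρ h, mul_zero, abs_zero]
      positivity
    · have h3 := h1 s (hρ.trans h)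
      have h4 : Q s ^ (-1 : ℝ) ≤ ρ ^ (-1 : ℝ) := Real.rpow_le_rpow_of_nonpos hρ h.le (by norm_num)
      rw [abs_mul, abs_of_nonneg (cutoff_nonneg Q ρ s)]
      calc _ ≤ |g s| * 1 := mul_le_mul_of_nonneg_left (clamp_le_one _) (abs_nonneg _)
        _ ≤ _ := by rw [mul_one]; exact h3.trans (mul_le_mul_of_nonneg_left h4 hC)
  -- Within this distance `Q` drops by at most `ρ / 2`, so the Lipschitz bound applies along the
  -- whole segment. More distant points are treated with the sup bound alone.
  have hclose : ∀ y z, ρ < Q y → |y - z| ≤ ρ / (2 * Λ) →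
      |g y * cutoff Q ρ y - g z * cutoff Q ρ z|
        ≤ (4 * C * Λ + D * (2 ^ A) + 2 * C * Λ) * ρ ^ (-(A + 2)) * |y - z| := by
    intro y z hy hyz
    have hseg : ∀ w ∈ Set.uIcc y z, ρ / 2 ≤ Q w := by
      intro w hw
      have h3 : |y - w| ≤ |y - z| := by
        rw [abs_sub_comm y w, abs_sub_comm y z]
        exact Set.abs_sub_left_of_mem_uIcc hw
      have h4 := (abs_le.1 (hQ.lipschitz y w)).2
      have h5 : Λ * |y - w| ≤ Λ * (ρ / (2 * Λ)) := by gcongr; exact h3.trans hyz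
      have h6 : Λ * (ρ / (2 * Λ)) = ρ / 2 := by field_simp
      linarith
    have hz := hseg z Set.right_mem_uIcc
    have h3 := h2 (ρ / 2) (by positivity) (by linarith) y z hseg
    have h4 : |g z| ≤ C * (2 * ρ ^ (-1 : ℝ)) := by
      refine (h1 z (by linarith)).trans (mul_le_mul_of_nonneg_left ?_ hC)
      have := Real.rpow_le_rpow_of_nonpos (by positivity : 0 < ρ / 2) hz
        (by norm_num : (-1 : ℝ) ≤ 0)
      refine this.trans_eq ?_
      rw [hinv, hinv]
      field_simp
    have h5 : (ρ / 2) ^ (-A) = 2 ^ A * ρ ^ (-A) := by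
      rw [Real.div_rpow hρ.le zero_le_two, Real.rpow_neg zero_le_two]
      field_simp
    rw [h5] at h3
    have e : g y * cutoff Q ρ y - g z * cutoff Q ρ z
        = (g y - g z) * cutoff Q ρ y + g z * (cutoff Q ρ y - cutoff Q ρ z) := by ring
    rw [e]
    refine (abs_add_le _ _).trans ?_
    rw [abs_mul, abs_mul, abs_of_nonneg (cutoff_nonneg Q ρ y)]
    calc _ ≤ (D * (2 ^ A * ρ ^ (-A)) * |y - z|) * 1
          + (C * (2 * ρ ^ (-1 : ℝ))) * (Λ / ρ * |y - z|) := by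
          gcongr
          · exact cutoff_nonneg Q ρ y
          · exact clamp_le_one _
          · exact hQ.abs_cutoff_sub_le hρ y z
      _ = (D * 2 ^ A * ρ ^ (-A) + 2 * C * Λ * (ρ ^ (-1 : ℝ) / ρ)) * |y - z| := by ring
      _ ≤ (D * 2 ^ A * ρ ^ (-(A + 2)) + 2 * C * Λ * ρ ^ (-(A + 2))) * |y - z| := by gcongr
      _ ≤ _ := by
          refine mul_le_mul_of_nonneg_right ?_ (abs_nonneg _)
          have : 0 ≤ 4 * C * Λ * ρ ^ (-(A + 2)) := by positivity
          linarith
  intro y z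
  rcases le_total (|y - z|) (ρ / (2 * Λ)) with h | h
  · rcases lt_or_ge ρ (Q y) with hy | hy
    · exact hclose y z hy h
    · rcases lt_or_ge ρ (Q z) with hz | hz
      · rw [abs_sub_comm, abs_sub_comm y z]
        exact hclose z y hz (by rwa [abs_sub_comm])
      · rw [cutoff_eq_zero hρ hy, cutoff_eq_zero hρ hz]
        simp only [mul_zero, sub_zero, abs_zero]
        positivity
  · have h3 : 1 ≤ 2 * Λ / ρ * |y - z| := by
      calc 1 = 2 * Λ / ρ * (ρ / (2 * Λ)) := by field_simp
        _ ≤ _ := by gcongr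
    calc _ ≤ C * ρ ^ (-1 : ℝ) + C * ρ ^ (-1 : ℝ) :=
          (abs_sub _ _).trans (add_le_add (hbd y) (hbd z))
      _ = 2 * C * ρ ^ (-1 : ℝ) * 1 := by ring
      _ ≤ 2 * C * ρ ^ (-1 : ℝ) * (2 * Λ / ρ * |y - z|) := by gcongr
      _ = 4 * C * Λ * (ρ ^ (-1 : ℝ) / ρ) * |y - z| := by ring
      _ ≤ 4 * C * Λ * ρ ^ (-(A + 2)) * |y - z| := by gcongr
      _ ≤ _ := by
          gcongr
          have : 0 ≤ D * 2 ^ A := by positivity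
          have : 0 ≤ 2 * C * Λ := by positivity
          linarith

theorem IsTame.intervalIntegrable {t : ℝ} {g : ℝ → ℝ} (hQ : IsGauge Q Λ η) (hg : IsTame Q t g) :
    IntervalIntegrable g volume 0 1 := by
  obtain ⟨C, -, h⟩ := hg.bound η hQ.exponent_pos
  refine (hQ.integrable.const_mul C).mono_fun hg.measurable.aestronglyMeasurable
    (ae_restrict_of_ae ?_)
  filter_upwards [hQ.ae_pos] with s hs
  rw [Real.norm_eq_abs]
  exact (h s hs).trans (le_abs_self _)

/-- Markov's inequality in pointwise form. -/
theorem one_sub_cutoff_le {ρ s a : ℝ} (hρ : 0 < ρ) (ha : 0 ≤ a)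
    (hs : 0 < Q s) : 1 - cutoff Q ρ s ≤ (2 * ρ) ^ a * Q s ^ (-a) := by
  rcases le_or_gt (2 * ρ) (Q s) with h | h
  · rw [cutoff_eq_one hρ h, sub_self]
    positivity
  · have h1 : (1 : ℝ) ≤ (2 * ρ) ^ a * Q s ^ (-a) := by
      rw [Real.rpow_neg hs.le, ← div_eq_mul_inv, one_le_div (by positivity)]
      exact Real.rpow_le_rpow hs.le h.le ha
    have h2 : 0 ≤ cutoff Q ρ s := clamp_nonneg _
    linarith

/-- Equidistribution with a power saving along the multiples of a point of finite type. -/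
theorem IsTame.hasPowerMean {t K γ : ℝ} (hK : 0 < K) (hγ : 0 < γ)
    (ht : ∀ m : ℤ, m ≠ 0 → K / |(m : ℝ)| ^ γ < distNearestInt (m * t)) {g : ℝ → ℝ}
    (hQ : IsGauge Q Λ η) (hg : IsTame Q t g) :
    HasPowerMean (fun m => g (m * t)) (∫ s in (0 : ℝ)..1, g s) := by
  obtain ⟨β, B, hβ, hβ1, hB, hE⟩ := exists_abs_sum_sub_le hK hγ ht
  obtain ⟨C, A, hC, hA, hL⟩ := hg.exists_lipschitz_mul_cutoff hQ
  have hη := hQ.exponent_pos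
  have hη1 := hQ.exponent_le
  have hΛ := hQ.one_le
  obtain ⟨D, hD, hDb⟩ := hg.bound (η / 2) (by positivity)
  -- The cutoff at `ρ = N ^ (-κ)` has Lipschitz constant of order `N ^ (κ A) = N ^ (β / 2)`, half of
  -- the saving `β`.
  set κ := β / (2 * A) with hκ
  have hA0 : 0 < A := by linarith
  have hκ0 : 0 < κ := by positivity
  have hκA : κ * A = β / 2 := by rw [hκ]; field_simp
  have hκβ : κ ≤ β / 4 := by nlinarith
  have hκη : κ * η ≤ κ := mul_le_of_le_one_right hκ0.le hη1
  have hκη0 : 0 < κ * η := by positivity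
  obtain ⟨G, hG⟩ := hg.subpoly (κ * η / 2) (by positivity)
  have hG0 : 0 ≤ G := by simpa using (abs_nonneg _).trans (hG 1 le_rfl)
  set I := ∫ s in (0 : ℝ)..1, Q s ^ (-η) with hI
  have hI0 : 0 ≤ I := intervalIntegral.integral_nonneg zero_le_one fun s _ =>
    Real.rpow_nonneg (hQ.nonneg s) _
  refine ⟨κ * η / 2, G * (4 ^ η * I + B * Λ) + B * C + D * (2 ^ (η / 2) * I), by positivity,
    by linarith, fun N hN => ?_⟩
  have hN1 : (1 : ℝ) ≤ N := by exact_mod_cast hN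
  have hN0 : (0 : ℝ) < N := by linarith
  set ρ := (N : ℝ) ^ (-κ) with hρ
  have hρ0 : 0 < ρ := by positivity
  have hρ1 : ρ ≤ 1 := Real.rpow_le_one_of_one_le_of_nonpos hN1 (by linarith)
  set X := (N : ℝ) ^ (1 - κ * η / 2) with hX
  have hmono : ∀ a : ℝ, a ≤ 1 - κ * η / 2 → (N : ℝ) ^ a ≤ X := fun a ha =>
    Real.rpow_le_rpow_of_exponent_le hN1 ha
  have hcont : ∀ r : ℝ, Continuous (cutoff Q r) := fun r => by
    have := hQ.continuous
    unfold cutoff clamp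
    fun_prop
  set h : ℝ → ℝ := fun s => g s * cutoff Q ρ s with hh
  -- A Lipschitz majorant of `1 - cutoff Q ρ` with integral `O(ρ ^ η)`. Equidistribution applied to
  -- `ψ` bounds how often `m t` comes near a singularity, where the values of `g` are at most `G N ^
  -- (κ η / 2)`.
  set ψ : ℝ → ℝ := fun s => 1 - cutoff Q (2 * ρ) s with hψ
  have hψ0 : ∀ s, 0 ≤ ψ s := fun s => sub_nonneg.2 (clamp_le_one _)
  have hcmp : ∀ s, 1 - cutoff Q ρ s ≤ ψ s := by
    intro s
    rcases le_or_gt (Q s) (2 * ρ) with h1 | h1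
    · simp only [hψ]
      rw [cutoff_eq_zero (by positivity : 0 < 2 * ρ) h1]
      have : 0 ≤ cutoff Q ρ s := clamp_nonneg _
      linarith
    · rw [cutoff_eq_one hρ0 h1.le, sub_self]
      exact hψ0 s
  -- The sum of the cut off function.
  have hsumh := hE h (C * ρ ^ (-A)) (hg.periodic.mul (hQ.periodic_cutoff ρ)) (hL ρ hρ0 hρ1) N hN
  have hsumψ := hE ψ (Λ / (2 * ρ)) (fun s => by simp only [hψ]; rw [hQ.periodic_cutoff])
    (fun y z => by
      have := hQ.abs_cutoff_sub_le (by positivity : 0 < 2 * ρ) z y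
      rw [abs_sub_comm z y] at this
      simpa [hψ] using this) N hN
  have hψint : ∫ s in (0 : ℝ)..1, ψ s ≤ (4 * ρ) ^ η * I := by
    rw [hI, ← intervalIntegral.integral_const_mul]
    refine intervalIntegral.integral_mono_ae zero_le_one ?_ (hQ.integrable.const_mul _) ?_
    · exact (continuous_const.sub (hcont _)).intervalIntegrable _ _
    · filter_upwards [hQ.ae_pos] with s hs
      have := one_sub_cutoff_le (by positivity : 0 < 2 * ρ) hη.le hs
      rwa [show 2 * (2 * ρ) = 4 * ρ by ring] at this
  have hgi := hg.intervalIntegrable hQ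
  have hhi : IntervalIntegrable h volume 0 1 := hgi.mul_continuousOn (hcont ρ).continuousOn
  have hgh : |∫ s in (0 : ℝ)..1, (g s - h s)| ≤ D * (2 * ρ) ^ (η / 2) * I := by
    rw [hI, ← intervalIntegral.integral_const_mul, ← Real.norm_eq_abs]
    refine intervalIntegral.norm_integral_le_of_norm_le zero_le_one ?_
      (hQ.integrable.const_mul _)
    filter_upwards [hQ.ae_pos] with s hs _
    have e : g s - h s = g s * (1 - cutoff Q ρ s) := by simp only [hh]; ring
    have h0 : 0 ≤ 1 - cutoff Q ρ s := sub_nonneg.2 (clamp_le_one _)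
    rw [e, norm_mul, Real.norm_eq_abs, Real.norm_of_nonneg h0]
    calc _ ≤ (D * Q s ^ (-(η / 2))) * ((2 * ρ) ^ (η / 2) * Q s ^ (-(η / 2))) :=
          mul_le_mul (hDb s hs) (one_sub_cutoff_le hρ0 (by positivity) hs) h0 (by positivity)
      _ = D * (2 * ρ) ^ (η / 2) * (Q s ^ (-(η / 2)) * Q s ^ (-(η / 2))) := by ring
      _ = _ := by rw [← Real.rpow_add hs]; ring_nf
  have hsumgh : |∑ m ∈ Finset.Icc 1 N, (g (m * t) - h (m * t))|
      ≤ G * (N : ℝ) ^ (κ * η / 2) * (N * ((4 * ρ) ^ η * I)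
        + B * (Λ / (2 * ρ)) * (N : ℝ) ^ (1 - β)) := by
    refine (Finset.abs_sum_le_sum_abs _ _).trans ?_
    have : ∑ m ∈ Finset.Icc 1 N, ψ (m * t)
        ≤ N * ((4 * ρ) ^ η * I) + B * (Λ / (2 * ρ)) * (N : ℝ) ^ (1 - β) := by
      have h1 := (abs_le.1 hsumψ).2
      have h2 := mul_le_mul_of_nonneg_left hψint hN0.le
      linarith
    refine le_trans ?_ (mul_le_mul_of_nonneg_left this (by positivity))
    rw [Finset.mul_sum]
    refine Finset.sum_le_sum fun m hm => ?_
    have hm' := Finset.mem_Icc.1 hm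
    have hmN : (m : ℝ) ≤ N := by exact_mod_cast hm'.2
    have e : g (m * t) - h (m * t) = g (m * t) * (1 - cutoff Q ρ (m * t)) := by
      simp only [hh]
      ring
    have h0 : 0 ≤ 1 - cutoff Q ρ (m * t) := sub_nonneg.2 (clamp_le_one _)
    rw [e, abs_mul, abs_of_nonneg h0]
    refine mul_le_mul ((hG m hm'.1).trans ?_) (hcmp _) h0 (by positivity)
    gcongr
  have hsplit : ∑ m ∈ Finset.Icc 1 N, g (m * t) - N * ∫ s in (0 : ℝ)..1, g s
      = ∑ m ∈ Finset.Icc 1 N, (g (m * t) - h (m * t))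
        + (∑ m ∈ Finset.Icc 1 N, h (m * t) - N * ∫ s in (0 : ℝ)..1, h s)
        - N * ∫ s in (0 : ℝ)..1, (g s - h s) := by
    rw [intervalIntegral.integral_sub hgi hhi, Finset.sum_sub_distrib]
    ring
  rw [hsplit]
  have q1 : (N : ℝ) ^ (κ * η / 2) * (N * (4 * ρ) ^ η) ≤ 4 ^ η * X := by
    rw [Real.mul_rpow (by norm_num) hρ0.le, hρ, ← Real.rpow_mul hN0.le]
    calc _ = 4 ^ η * ((N : ℝ) ^ (κ * η / 2) * ((N : ℝ) ^ (1 : ℝ) * (N : ℝ) ^ (-κ * η))) := by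
          rw [Real.rpow_one]; ring
      _ ≤ 4 ^ η * X := by
          rw [← Real.rpow_add hN0, ← Real.rpow_add hN0]
          gcongr
          exact hmono _ (by linarith)
  have q2 : (N : ℝ) ^ (κ * η / 2) * ((Λ / (2 * ρ)) * (N : ℝ) ^ (1 - β)) ≤ Λ * X := by
    have hρinv : ρ⁻¹ = (N : ℝ) ^ κ := by rw [hρ, Real.rpow_neg hN0.le, inv_inv]
    calc _ = Λ / 2 * ((N : ℝ) ^ (κ * η / 2) * (ρ⁻¹ * (N : ℝ) ^ (1 - β))) := by
          field_simp
      _ ≤ Λ / 2 * X := by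
          rw [hρinv, ← Real.rpow_add hN0, ← Real.rpow_add hN0]
          gcongr
          exact hmono _ (by linarith)
      _ ≤ Λ * X := by gcongr; linarith
  have q3 : ρ ^ (-A) * (N : ℝ) ^ (1 - β) ≤ X := by
    rw [hρ, ← Real.rpow_mul hN0.le, ← Real.rpow_add hN0]
    exact hmono _ (by linarith)
  have q4 : N * (2 * ρ) ^ (η / 2) ≤ 2 ^ (η / 2) * X := by
    rw [Real.mul_rpow (by norm_num) hρ0.le, hρ, ← Real.rpow_mul hN0.le]
    calc _ = 2 ^ (η / 2) * ((N : ℝ) ^ (1 : ℝ) * (N : ℝ) ^ (-κ * (η / 2))) := by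
          rw [Real.rpow_one]; ring
      _ ≤ _ := by
          rw [← Real.rpow_add hN0]
          gcongr
          exact hmono _ (by linarith)
  refine (abs_sub _ _).trans ((add_le_add ((abs_add_le _ _).trans
    (add_le_add hsumgh hsumh)) le_rfl).trans ?_)
  rw [abs_mul, abs_of_pos hN0]
  calc _ ≤ G * (N : ℝ) ^ (κ * η / 2) * (N * ((4 * ρ) ^ η * I)
        + B * (Λ / (2 * ρ)) * (N : ℝ) ^ (1 - β)) + B * (C * ρ ^ (-A)) * (N : ℝ) ^ (1 - β)
        + N * (D * (2 * ρ) ^ (η / 2) * I) := by gcongr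
    _ = G * (((N : ℝ) ^ (κ * η / 2) * (N * (4 * ρ) ^ η)) * I
        + B * ((N : ℝ) ^ (κ * η / 2) * ((Λ / (2 * ρ)) * (N : ℝ) ^ (1 - β))))
        + B * C * (ρ ^ (-A) * (N : ℝ) ^ (1 - β)) + D * ((N * (2 * ρ) ^ (η / 2)) * I) := by ring
    _ ≤ G * ((4 ^ η * X) * I + B * (Λ * X)) + B * C * X + D * ((2 ^ (η / 2) * X) * I) := by
        gcongr
    _ = _ := by ring

end Cutoff


/-! ### Zeros of periodic analytic functions -/

/-- By the identity theorem `P` vanishes to finite order at every point. -/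
theorem exists_pow_mul_le_norm {P : ℝ → ℂ} (hP : AnalyticOnNhd ℝ P Set.univ) {a : ℝ} (ha : P a ≠ 0)
    (s₀ : ℝ) : ∃ (k : ℕ) (c : ℝ), 0 < c ∧ ∀ᶠ s in 𝓝 s₀, c * |s - s₀| ^ k ≤ ‖P s‖ := by
  have hne : ¬ ∀ᶠ s in 𝓝 s₀, P s = 0 := fun h =>
    ha (hP.eqOn_zero_of_preconnected_of_eventuallyEq_zero isPreconnected_univ (Set.mem_univ s₀) h
      (Set.mem_univ a))
  obtain ⟨k, g, hg, hg0, h⟩ :=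
    ((hP s₀ (Set.mem_univ _)).exists_eventuallyEq_pow_smul_nonzero_iff).2 hne
  have hpos : 0 < ‖g s₀‖ := norm_pos_iff.2 hg0
  refine ⟨k, ‖g s₀‖ / 2, by positivity, ?_⟩
  filter_upwards [h, hg.continuousAt.norm.eventually_const_lt (half_lt_self hpos)] with s h1 h2
  rw [h1, norm_smul, norm_pow, Real.norm_eq_abs, mul_comm]
  exact mul_le_mul_of_nonneg_left h2.le (by positivity)

theorem exists_norm_le_of_periodic {E : Type*} [NormedAddCommGroup E] {u : ℝ → E}
    (hp : Function.Periodic u 1) (hc : Continuous u) : ∃ M : ℝ, 1 ≤ M ∧ ∀ s, ‖u s‖ ≤ M := by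
  obtain ⟨M, hM⟩ := (hp.isBounded_of_continuous one_ne_zero hc).exists_norm_le
  exact ⟨max M 1, le_max_right _ _, fun s => (hM _ ⟨s, rfl⟩).trans (le_max_left _ _)⟩

theorem periodic_deriv {P : ℝ → ℂ} (hp : Function.Periodic P 1) :
    Function.Periodic (deriv P) 1 := fun s => by
  rw [← deriv_comp_add_const]
  congr 1
  exact funext hp

/-- On either side of `s₀` the function is dominated by a multiple of `|s - s₀| ^ (-1 / 2)`. -/
theorem intervalIntegrable_rpow_neg_of_le {Q : ℝ → ℝ} (hQ : Continuous Q) (hQ0 : ∀ s, 0 ≤ Q s)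
    {s₀ c r η : ℝ} {k : ℕ} (hc : 0 < c) (hr : 0 < r) (hr1 : r ≤ 1) (hη : 0 < η)
    (hηk : k * η ≤ 1 / 2) (h : ∀ s ∈ Set.Ioo (s₀ - r) (s₀ + r), c * |s - s₀| ^ k ≤ Q s) :
    IntegrableOn (fun s => Q s ^ (-η)) (Set.Ioo (s₀ - r) (s₀ + r)) := by
  have hmeas : Measurable fun s => Q s ^ (-η) := hQ.measurable.pow_const _
  have hbase : IntervalIntegrable (fun x : ℝ => x ^ (-(1 / 2) : ℝ)) volume 0 r :=
    intervalIntegral.intervalIntegrable_rpow' (by norm_num)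
  have key : ∀ s x : ℝ, |s - s₀| = x → 0 < x → x < r → ‖Q s ^ (-η)‖
      ≤ ‖c ^ (-η) * x ^ (-(1 / 2) : ℝ)‖ := by
    intro s x hx hx0 hxr
    have h1 := h s (by
      have := abs_lt.1 (hx.trans_lt hxr)
      constructor <;> linarith)
    rw [hx] at h1
    rw [Real.norm_of_nonneg (Real.rpow_nonneg (hQ0 s) _), Real.norm_of_nonneg (by positivity)]
    calc Q s ^ (-η) ≤ (c * x ^ k) ^ (-η) :=
          Real.rpow_le_rpow_of_nonpos (by positivity) h1 (by linarith)
      _ = c ^ (-η) * x ^ (-(k * η)) := by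
          rw [Real.mul_rpow hc.le (by positivity), ← Real.rpow_natCast, ← Real.rpow_mul hx0.le]
          ring_nf
      _ ≤ _ := by
          gcongr ?_ * ?_
          exact Real.rpow_le_rpow_of_exponent_ge hx0 (hxr.le.trans hr1) (by linarith)
  have hright : IntervalIntegrable (fun s => Q s ^ (-η)) volume s₀ (s₀ + r) := by
    have hb := (hbase.comp_sub_right s₀).const_mul (c ^ (-η))
    rw [zero_add, add_comm r] at hb
    refine hb.mono_fun hmeas.aestronglyMeasurable ?_
    rw [Set.uIoc_of_le (by linarith), ← restrict_Ioo_eq_restrict_Ioc]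
    refine ae_restrict_of_forall_mem measurableSet_Ioo fun s hs => ?_
    refine key s (s - s₀) (abs_of_pos (by linarith [hs.1])) (by linarith [hs.1]) (by linarith [hs.2])
  have hleft : IntervalIntegrable (fun s => Q s ^ (-η)) volume (s₀ - r) s₀ := by
    have hb := ((hbase.comp_sub_left s₀).const_mul (c ^ (-η))).symm
    rw [sub_zero] at hb
    refine hb.mono_fun hmeas.aestronglyMeasurable ?_
    rw [Set.uIoc_of_le (by linarith), ← restrict_Ioo_eq_restrict_Ioc]
    refine ae_restrict_of_forall_mem measurableSet_Ioo fun s hs => ?_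
    refine key s (s₀ - s) ?_ (by linarith [hs.2]) (by linarith [hs.1])
    rw [abs_of_neg (by linarith [hs.2])]
    ring
  have := hleft.trans hright
  rw [intervalIntegrable_iff_integrableOn_Ioo_of_le (by linarith)] at this
  exact this

theorem exists_isGauge {P : ℝ → ℂ} (hP : AnalyticOnNhd ℝ P Set.univ) (hp : Function.Periodic P 1)
    {a : ℝ} (ha : P a ≠ 0) : ∃ Λ η, IsGauge (fun s => ‖P s‖) Λ η := by
  have hdiff : ContDiff ℝ ω P := hP.contDiff
  have hcont : Continuous P := hdiff.continuous
  obtain ⟨Λ, hΛ1, hΛ⟩ := exists_norm_le_of_periodic (periodic_deriv hp)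
    (hdiff.continuous_deriv (by simp))
  have hlip : ∀ y z, |‖P y‖ - ‖P z‖| ≤ Λ * |y - z| := fun y z => by
    refine (abs_norm_sub_norm_le _ _).trans ?_
    rw [← Real.norm_eq_abs]
    exact convex_univ.norm_image_sub_le_of_norm_deriv_le
      (fun x _ => (hdiff.differentiable (by simp)).differentiableAt) (fun x _ => hΛ x)
      (Set.mem_univ _) (Set.mem_univ _)
  -- Asking for all smaller exponents as well makes the property stable under unions, so that
  -- compactness yields one common exponent.
  have hint : ∃ η : ℝ, 0 < η ∧ ∀ η' : ℝ, 0 < η' → η' ≤ η →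
      IntegrableOn (fun s => ‖P s‖ ^ (-η')) (Set.Icc 0 1) := by
    refine isCompact_Icc.induction_on (p := fun U => ∃ η : ℝ, 0 < η ∧ ∀ η' : ℝ, 0 < η' → η' ≤ η →
      IntegrableOn (fun s => ‖P s‖ ^ (-η')) U) ⟨1, one_pos, fun _ _ _ => integrableOn_empty⟩ ?_ ?_ ?_
    · rintro U V hUV ⟨η, h0, h⟩
      exact ⟨η, h0, fun η' h1 h2 => (h η' h1 h2).mono_set hUV⟩
    · rintro U V ⟨η₁, h1, h1'⟩ ⟨η₂, h2, h2'⟩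
      exact ⟨min η₁ η₂, lt_min h1 h2, fun η' h3 h4 =>
        (h1' η' h3 (h4.trans (min_le_left _ _))).union (h2' η' h3 (h4.trans (min_le_right _ _)))⟩
    · intro s₀ _
      obtain ⟨k, c, hc, h⟩ := exists_pow_mul_le_norm hP ha s₀
      obtain ⟨r, hr, hrU⟩ := Metric.eventually_nhds_iff_ball.1 h
      have hr' : 0 < min r 1 := by positivity
      refine ⟨Set.Ioo (s₀ - min r 1) (s₀ + min r 1),
        mem_nhdsWithin_of_mem_nhds (Ioo_mem_nhds (by linarith) (by linarith)),
        1 / (2 * (k + 1)), by positivity, fun η' h1 h2 => ?_⟩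
      refine intervalIntegrable_rpow_neg_of_le hcont.norm (fun _ => norm_nonneg _) (k := k) hc hr'
        (min_le_right _ _) h1 ?_ fun s hs => hrU s ?_
      · calc (k : ℝ) * η' ≤ (k + 1) * (1 / (2 * (k + 1))) := by gcongr; linarith
          _ = 1 / 2 := by field_simp
      · rw [Real.ball_eq_Ioo]
        have := min_le_left r 1
        exact ⟨by linarith [hs.1], by linarith [hs.2]⟩
  obtain ⟨η, hη, hI⟩ := hint
  refine ⟨Λ, min η 1, ⟨fun s => by simp only [hp s], fun _ => norm_nonneg _, hΛ1, hlip,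
    by positivity, min_le_right _ _, ?_, ?_⟩⟩
  · have hnull : volume {s | P s = 0} = 0 := by
      refine measure_null_of_locally_null _ fun x _ => ?_
      have h1 := (hP x (Set.mem_univ _)).eventually_eq_zero_or_eventually_ne_zero.resolve_left
        fun h => ha (hP.eqOn_zero_of_preconnected_of_eventuallyEq_zero isPreconnected_univ
          (Set.mem_univ x) h (Set.mem_univ a))
      refine ⟨{x}, ?_, by simp⟩
      rw [eventually_nhdsWithin_iff] at h1
      rw [mem_nhdsWithin_iff_eventually]
      filter_upwards [h1] with s hs hs0
      by_contra hsx
      exact hs hsx hs0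
    filter_upwards [measure_eq_zero_iff_ae_notMem.1 hnull] with s hs
    exact norm_pos_iff.2 hs
  · rw [intervalIntegrable_iff_integrableOn_Icc_of_le zero_le_one]
    exact hI _ (by positivity) (min_le_left _ _)

theorem distNearestInt_nonneg (s : ℝ) : 0 ≤ distNearestInt s :=
  le_min (Int.fract_nonneg s) (sub_nonneg.2 (Int.fract_lt_one s).le)

theorem distNearestInt_le_one (s : ℝ) : distNearestInt s ≤ 1 :=
  (min_le_left _ _).trans (Int.fract_lt_one s).le

theorem distNearestInt_natCast_mul_le (n : ℕ) (s : ℝ) :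
    distNearestInt (n * s) ≤ n * distNearestInt s := by
  have h := distNearestInt_le (n * s) (n * round s)
  refine h.trans_eq ?_
  rw [distNearestInt, ← abs_sub_round_eq_min, Int.cast_mul, Int.cast_natCast, ← mul_sub, abs_mul,
    Nat.abs_cast]

theorem distNearestInt_add_natCast (s : ℝ) (n : ℕ) :
    distNearestInt (s + n) = distNearestInt s := by
  rw [distNearestInt, distNearestInt, Int.fract_add_natCast]

/-- A periodic analytic function with rational zeros is bounded below by a power of the distance
to the rationals with a fixed denominator. -/
theorem exists_distNearestInt_pow_le_norm {F : ℝ → ℂ} (hF : AnalyticOnNhd ℝ F Set.univ)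
    (hp : Function.Periodic F 1) {a : ℝ} (ha : F a ≠ 0)
    (hrat : ∀ s, F s = 0 → ∃ (q : ℕ) (k : ℤ), 0 < q ∧ q * s = k) :
    ∃ (q k : ℕ) (c : ℝ), 0 < q ∧ 0 < c ∧ ∀ s, c * distNearestInt (q * s) ^ k ≤ ‖F s‖ := by
  have hcomp : ∃ (q k : ℕ) (c : ℝ), 0 < q ∧ 0 < c ∧ ∀ s ∈ Set.Icc (0 : ℝ) 1,
      c * distNearestInt (q * s) ^ k ≤ ‖F s‖ := by
    refine isCompact_Icc.induction_on (p := fun U => ∃ (q k : ℕ) (c : ℝ), 0 < q ∧ 0 < c ∧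
      ∀ s ∈ U, c * distNearestInt (q * s) ^ k ≤ ‖F s‖) ⟨1, 0, 1, one_pos, one_pos, by simp⟩ ?_ ?_ ?_
    · rintro U V hUV ⟨q, k, c, h1, h2, h⟩
      exact ⟨q, k, c, h1, h2, fun s hs => h s (hUV hs)⟩
    -- Two local bounds combine with the product of the denominators and the sum of the exponents:
    -- the distance to the integers is at most one and grows at most by the factor `q'` under
    -- multiplication by `q'`.
    · have step : ∀ (q q' k k' : ℕ) (c c' s : ℝ), 0 < q' → 0 < c → c' ≤ c / q' ^ k →
          c * distNearestInt (q * s) ^ k ≤ ‖F s‖ →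
          c' * distNearestInt ((q' * q : ℕ) * s) ^ (k + k') ≤ ‖F s‖ := by
        intro q q' k k' c c' s hq' hc hc' h
        refine le_trans ?_ h
        have hq0 : (0 : ℝ) < q' := by exact_mod_cast hq'
        have d0 := distNearestInt_nonneg ((q' * q : ℕ) * s)
        have d1 : distNearestInt ((q' * q : ℕ) * s) ≤ q' * distNearestInt (q * s) := by
          have := distNearestInt_natCast_mul_le q' (q * s)
          rwa [← mul_assoc, ← Nat.cast_mul] at this
        calc _ ≤ c / q' ^ k * distNearestInt ((q' * q : ℕ) * s) ^ k := by
              refine mul_le_mul hc' ?_ (by positivity) (by positivity)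
              exact pow_le_pow_of_le_one d0 (distNearestInt_le_one _) (Nat.le_add_right _ _)
          _ ≤ c / q' ^ k * (q' * distNearestInt (q * s)) ^ k := by gcongr
          _ = _ := by rw [mul_pow]; field_simp
      rintro U V ⟨q₁, k₁, c₁, h1, h1', h1''⟩ ⟨q₂, k₂, c₂, h2, h2', h2''⟩
      have h1r : (0 : ℝ) < q₁ := by exact_mod_cast h1
      have h2r : (0 : ℝ) < q₂ := by exact_mod_cast h2
      refine ⟨q₂ * q₁, k₁ + k₂, min (c₁ / (q₂ : ℝ) ^ k₁) (c₂ / (q₁ : ℝ) ^ k₂), by positivity,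
        by positivity, ?_⟩
      rintro s (hs | hs)
      · exact step q₁ q₂ k₁ k₂ c₁ _ s h2 h1' (min_le_left _ _) (h1'' s hs)
      · have := step q₂ q₁ k₂ k₁ c₂ _ s h1 h2' (min_le_right (c₁ / (q₂ : ℝ) ^ k₁) _) (h2'' s hs)
        rwa [mul_comm q₁, add_comm k₂] at this
    · intro s₀ _
      by_cases h0 : F s₀ = 0
      · obtain ⟨q, b, hq, hb⟩ := hrat s₀ h0
        obtain ⟨k, c, hc, h⟩ := exists_pow_mul_le_norm hF ha s₀
        have hq0 : (0 : ℝ) < q := by exact_mod_cast hq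
        refine ⟨{s | c * |s - s₀| ^ k ≤ ‖F s‖}, mem_nhdsWithin_of_mem_nhds h, q, k, c / q ^ k, hq,
          by positivity, fun s hs => le_trans ?_ hs⟩
        have h1 : distNearestInt (q * s) ≤ q * |s - s₀| := by
          refine (distNearestInt_le _ b).trans_eq ?_
          rw [← hb, ← mul_sub, abs_mul, Nat.abs_cast]
        calc _ ≤ c / q ^ k * (q * |s - s₀|) ^ k := by
              gcongr
              exact distNearestInt_nonneg _
          _ = _ := by rw [mul_pow]; field_simp
      · have hpos : 0 < ‖F s₀‖ := norm_pos_iff.2 h0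
        refine ⟨{s | ‖F s₀‖ / 2 < ‖F s‖}, mem_nhdsWithin_of_mem_nhds ?_, 1, 0, ‖F s₀‖ / 2, one_pos,
          by positivity, fun s hs => ?_⟩
        · exact (hF s₀ (Set.mem_univ _)).continuousAt.norm.eventually_const_lt (half_lt_self hpos)
        · rw [pow_zero, mul_one]
          exact le_of_lt hs
  obtain ⟨q, k, c, hq, hc, h⟩ := hcomp
  refine ⟨q, k, c, hq, hc, fun s => ?_⟩
  have hper : Function.Periodic (fun s => distNearestInt (q * s)) 1 := fun s => by
    simp only [mul_add, mul_one]
    exact distNearestInt_add_natCast _ q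
  have hfr : ∀ (u : ℝ → ℝ), Function.Periodic u 1 → u s = u (Int.fract s) := fun u hu => by
    have := hu.sub_int_mul_eq (x := s) ⌊s⌋
    rw [mul_one, Int.self_sub_floor] at this
    exact this.symm
  have h1 : distNearestInt (q * s) = distNearestInt (q * Int.fract s) := hfr _ hper
  have h2 : ‖F s‖ = ‖F (Int.fract s)‖ := hfr (fun s => ‖F s‖) fun s => by simp only [hp s]
  rw [h1, h2]
  exact h _ ⟨Int.fract_nonneg s, (Int.fract_lt_one s).le⟩


/-! ### The logarithm of a periodic analytic function -/

/-- Apply `log y ≤ y ^ ε / ε` to `‖z‖` and to its inverse; the argument contributes at most `π`. -/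
theorem norm_log_le_rpow {z : ℂ} {M r ε : ℝ} (hM : ‖z‖ ≤ M) (hr : 0 < r) (hz : r ≤ ‖z‖)
    (hε : 0 < ε) : ‖Complex.log z‖ ≤ M ^ ε / ε + r ^ (-ε) / ε + Real.pi := by
  have hz0 : 0 < ‖z‖ := hr.trans_le hz
  have h1 : Real.log ‖z‖ ≤ M ^ ε / ε :=
    (Real.log_le_rpow_div hz0.le hε).trans (by gcongr)
  have h2 : -Real.log ‖z‖ ≤ r ^ (-ε) / ε := by
    rw [← Real.log_inv]
    refine (Real.log_le_rpow_div (by positivity) hε).trans ?_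
    rw [Real.inv_rpow hz0.le, ← Real.rpow_neg hz0.le]
    gcongr ?_ / ε
    exact Real.rpow_le_rpow_of_nonpos hr hz (by linarith)
  have h3 : 0 ≤ M ^ ε / ε := div_nonneg (Real.rpow_nonneg (hz0.le.trans hM) _) hε.le
  have h4 : 0 ≤ r ^ (-ε) / ε := by positivity
  refine (Complex.norm_le_abs_re_add_abs_im _).trans (add_le_add ?_ ?_)
  · rw [Complex.log_re, abs_le]
    constructor <;> linarith
  · rw [Complex.log_im]
    exact Complex.abs_arg_le_pi z

/-- A real-valued `F` may run along the branch cut without crossing it: where it is negative, `log F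
= log (-F) + i π`. -/
theorem hasDerivAt_log_of_im_eq_zero {F : ℝ → ℂ} {F' : ℂ} {s : ℝ} (hF : HasDerivAt F F' s)
    (hs : F s ≠ 0) (him : ∀ u, (F u).im = 0) :
    HasDerivAt (fun u => Complex.log (F u)) (F' / F s) s := by
  by_cases hslit : F s ∈ Complex.slitPlane
  · exact hF.clog_real hslit
  have hre : (F s).re < 0 := by
    rw [Complex.mem_slitPlane_iff, not_or] at hslit
    refine lt_of_le_of_ne (not_lt.1 hslit.1) fun h => hs (Complex.ext h (him s))
  have hneg : -F s ∈ Complex.slitPlane := Or.inl (by simpa using hre)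
  have h1 := (hF.neg.clog_real hneg).add_const ((Real.pi : ℂ) * Complex.I)
  rw [Pi.neg_apply, neg_div_neg_eq] at h1
  refine h1.congr_of_eventuallyEq ?_
  filter_upwards [(Complex.continuous_re.continuousAt.comp hF.continuousAt).eventually_lt_const hre]
    with u hu
  have e : F u = (((F u).re : ℝ) : ℂ) := Complex.ext rfl (by simpa using him u)
  have hu' : (F u).re < 0 := hu
  simp only [Pi.neg_apply]
  rw [e, ← Complex.ofReal_neg]
  apply Complex.ext
  · rw [Complex.add_re, Complex.log_re, Complex.log_re, Complex.ofReal_neg, norm_neg]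
    simp
  · simp only [Complex.log_im, Complex.add_im, Complex.mul_im, Complex.ofReal_re, Complex.I_im,
      Complex.ofReal_im, Complex.I_re]
    rw [Complex.arg_ofReal_of_neg hu', Complex.arg_ofReal_of_nonneg (by linarith)]
    ring

theorem norm_log_sub_log_le {F : ℝ → ℂ} (hF : Differentiable ℝ F) {M r y z : ℝ}
    (hM : ∀ s, ‖deriv F s‖ ≤ M) (hr : 0 < r) (hlow : ∀ w ∈ Set.uIcc y z, r ≤ ‖F w‖)
    (him : (∀ u, (F u).im = 0) ∨ ∀ w ∈ Set.uIcc y z, (F w).im ≠ 0) :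
    ‖Complex.log (F y) - Complex.log (F z)‖ ≤ M / r * |y - z| := by
  have hM0 : 0 ≤ M := (norm_nonneg _).trans (hM 0)
  have hd : ∀ w ∈ Set.uIcc y z, HasDerivWithinAt (fun u => Complex.log (F u))
      (deriv F w / F w) (Set.uIcc y z) w := by
    intro w hw
    have hw0 : F w ≠ 0 := norm_pos_iff.1 (hr.trans_le (hlow w hw))
    refine HasDerivAt.hasDerivWithinAt ?_
    rcases him with h | h
    · exact hasDerivAt_log_of_im_eq_zero hF.differentiableAt.hasDerivAt hw0 h
    · exact hF.differentiableAt.hasDerivAt.clog_real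
        (Complex.mem_slitPlane_iff.2 (Or.inr (h w hw)))
  rw [← Real.norm_eq_abs]
  refine (convex_uIcc y z).norm_image_sub_le_of_norm_hasDerivWithin_le hd (fun w hw => ?_)
    Set.right_mem_uIcc Set.left_mem_uIcc
  rw [norm_div]
  exact div_le_div₀ hM0 (hM w) hr (hlow w hw)

/-- Finite type applied to `q m`, where `q` is a common denominator for the zeros, gives `‖F (m t)‖
≥ b m ^ (-γ k)`, so the logarithm is smaller than every power of `m`. -/
theorem isSubpoly_log {F : ℝ → ℂ} (hF : AnalyticOnNhd ℝ F Set.univ)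
    (hp : Function.Periodic F 1) {a : ℝ} (ha : F a ≠ 0)
    (hrat : ∀ s, F s = 0 → ∃ (q : ℕ) (k : ℤ), 0 < q ∧ q * s = k) {t K γ : ℝ} (hK : 0 < K)
    (hγ : 0 < γ) (ht : ∀ m : ℤ, m ≠ 0 → K / |(m : ℝ)| ^ γ < distNearestInt (m * t)) :
    IsSubpoly (fun m => ‖Complex.log (F (m * t))‖) := by
  obtain ⟨M, hM1, hM⟩ := exists_norm_le_of_periodic hp (hF.contDiff (n := ω)).continuous
  obtain ⟨q, k, c, hq, hc, h⟩ := exists_distNearestInt_pow_le_norm hF hp ha hrat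
  have hq0 : (0 : ℝ) < q := by exact_mod_cast hq
  intro ε hε
  -- Makes `γ k ε' ≤ ε`; the `+ 1` covers `k = 0`.
  set ε' := ε / (γ * k + 1) with hε'
  have hε'0 : 0 < ε' := by positivity
  have hkε : γ * k * ε' ≤ ε := by
    rw [hε', mul_div_assoc', div_le_iff₀ (by positivity)]
    nlinarith
  set b := c * (K / (q : ℝ) ^ γ) ^ k with hb
  have hb0 : 0 < b := by positivity
  refine ⟨M ^ ε' / ε' + b ^ (-ε') / ε' + Real.pi, fun m hm => ?_⟩
  have hm1 : (1 : ℝ) ≤ m := by exact_mod_cast hm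
  have hm0 : (0 : ℝ) < m := by linarith
  rw [abs_of_nonneg (norm_nonneg _)]
  have hlow : b * (m : ℝ) ^ (-(γ * k)) ≤ ‖F (m * t)‖ := by
    refine le_trans ?_ (h (m * t))
    have h1 := (ht ((q * m : ℕ) : ℤ) (by positivity)).le
    rw [Int.cast_natCast, Nat.abs_cast, Nat.cast_mul, Real.mul_rpow hq0.le hm0.le, mul_assoc] at h1
    calc _ = c * (K / ((q : ℝ) ^ γ * (m : ℝ) ^ γ)) ^ k := by
          rw [hb, Real.rpow_neg hm0.le, Real.rpow_mul hm0.le, Real.rpow_natCast, ← div_div,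
            div_pow (K / (q : ℝ) ^ γ), ← div_eq_mul_inv, mul_div_assoc]
      _ ≤ _ := by gcongr
  refine (norm_log_le_rpow (hM _) (by positivity) hlow hε'0).trans ?_
  have hmε : (1 : ℝ) ≤ (m : ℝ) ^ ε := Real.one_le_rpow hm1 hε.le
  have e1 : (b * (m : ℝ) ^ (-(γ * k))) ^ (-ε') ≤ b ^ (-ε') * (m : ℝ) ^ ε := by
    rw [Real.mul_rpow hb0.le (by positivity), ← Real.rpow_mul hm0.le]
    gcongr
    linarith
  have h0 : 0 ≤ M ^ ε' / ε' := by positivity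
  calc _ ≤ M ^ ε' / ε' * (m : ℝ) ^ ε + b ^ (-ε') * (m : ℝ) ^ ε / ε' + Real.pi * (m : ℝ) ^ ε := by
        gcongr
        · exact le_mul_of_one_le_right h0 hmε
        · exact le_mul_of_one_le_right Real.pi_pos.le hmε
    _ = _ := by ring

/-- Where `G ≠ 0` the branch cut is avoided. Take `G = Im F`, or `G = 1` when `F` is real
throughout; analytic functions have no zero divisors on the line, so `F G` is not identically zero.
-/
theorem exists_analytic_im_factor {F : ℝ → ℂ} (hF : AnalyticOnNhd ℝ F Set.univ)
    (hp : Function.Periodic F 1) {a : ℝ} (ha : F a ≠ 0) :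
    ∃ G : ℝ → ℂ, AnalyticOnNhd ℝ G Set.univ ∧ Function.Periodic G 1 ∧ (∃ b, F b * G b ≠ 0) ∧
      ((∀ u, (F u).im = 0) ∨ ∀ w, G w ≠ 0 → (F w).im ≠ 0) := by
  by_cases him : ∀ u, (F u).im = 0
  · exact ⟨fun _ => 1, analyticOnNhd_const, fun _ => rfl, ⟨a, by simpa using ha⟩, Or.inl him⟩
  · push Not at him
    obtain ⟨a', ha'⟩ := him
    have hG : AnalyticOnNhd ℝ (fun u => (((F u).im : ℝ) : ℂ)) Set.univ := fun x hx =>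
      (Complex.ofRealCLM.analyticAt _).comp ((Complex.imCLM.analyticAt _).comp (hF x hx))
    refine ⟨fun u => (((F u).im : ℝ) : ℂ), hG, fun s => by simp only [hp s], ?_, Or.inr fun w hw => ?_⟩
    · by_contra! hcon
      rcases AnalyticOnNhd.eq_zero_or_eq_zero_of_mul_eq_zero hF hG (fun z _ => hcon z)
        isPreconnected_univ with h | h
      · exact ha (h a (Set.mem_univ _))
      · exact ha' (by simpa using h a' (Set.mem_univ _))
    · simpa using hw

/-- The gauge is `‖F G‖`. Zeros of `G` need not be rational, but the logarithm only jumps there and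
stays bounded, so subpolynomial growth along `m t` involves the zeros of `F` alone. -/
theorem exists_isGauge_isTame_log {F : ℝ → ℂ} (hF : AnalyticOnNhd ℝ F Set.univ)
    (hp : Function.Periodic F 1) {a : ℝ} (ha : F a ≠ 0)
    (hrat : ∀ s, F s = 0 → ∃ (q : ℕ) (k : ℤ), 0 < q ∧ q * s = k) {t K γ : ℝ} (hK : 0 < K)
    (hγ : 0 < γ) (ht : ∀ m : ℤ, m ≠ 0 → K / |(m : ℝ)| ^ γ < distNearestInt (m * t)) :
    ∃ (Q : ℝ → ℝ) (Λ η : ℝ), IsGauge Q Λ η ∧ ∀ φ : ℂ →L[ℝ] ℝ,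
      IsTame Q t (fun s => φ (Complex.log (F s))) := by
  obtain ⟨G, hG, hGp, ⟨b, hb⟩, him⟩ := exists_analytic_im_factor hF hp ha
  obtain ⟨Λ, η, hQ⟩ := exists_isGauge (hF.mul hG) (hp.mul hGp) hb
  have hFd : ContDiff ℝ ω F := hF.contDiff
  obtain ⟨M, hM1, hM⟩ := exists_norm_le_of_periodic hp hFd.continuous
  obtain ⟨M', hM'1, hM'⟩ := exists_norm_le_of_periodic hGp (hG.contDiff (n := ω)).continuous
  obtain ⟨D, hD1, hD⟩ := exists_norm_le_of_periodic (periodic_deriv hp)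
    (hFd.continuous_deriv (by simp))
  have hM0 : 0 < M := by linarith
  have hM'0 : 0 < M' := by linarith
  have hlow : ∀ s, ‖F s * G s‖ / M' ≤ ‖F s‖ := fun s => by
    rw [norm_mul, div_le_iff₀ hM'0]
    exact mul_le_mul_of_nonneg_left (hM' s) (norm_nonneg _)
  have hQM : ∀ s, ‖F s * G s‖ ≤ M * M' := fun s => by
    rw [norm_mul]
    exact mul_le_mul (hM s) (hM' s) (norm_nonneg _) hM0.le
  refine ⟨fun s => ‖F s * G s‖, Λ, η, hQ, fun φ => ⟨fun s => by simp only [hp s], ?_, ?_, ?_, ?_⟩⟩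
  · exact φ.measurable.comp (Complex.measurable_log.comp hFd.continuous.measurable)
  · intro ε hε
    refine ⟨‖φ‖ * (M ^ ε / ε * (M * M') ^ ε + M' ^ ε / ε + Real.pi * (M * M') ^ ε), by positivity,
      fun s hs => ?_⟩
    set x := ‖F s * G s‖ with hx
    have h1 := norm_log_le_rpow (hM s) (by positivity) (hlow s) hε
    have h2 : (x / M') ^ (-ε) = M' ^ ε * x ^ (-ε) := by
      rw [Real.div_rpow hs.le hM'0.le, Real.rpow_neg hM'0.le]
      field_simp
    have h3 : 1 ≤ (M * M') ^ ε * x ^ (-ε) := by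
      rw [Real.rpow_neg hs.le, ← div_eq_mul_inv, one_le_div (by positivity)]
      exact Real.rpow_le_rpow hs.le (hQM s) hε.le
    rw [h2] at h1
    have h0 : 0 ≤ M ^ ε / ε := by positivity
    rw [← Real.norm_eq_abs]
    calc _ ≤ ‖φ‖ * ‖Complex.log (F s)‖ := φ.le_opNorm _
      _ ≤ ‖φ‖ * (M ^ ε / ε * ((M * M') ^ ε * x ^ (-ε)) + M' ^ ε * x ^ (-ε) / ε
          + Real.pi * ((M * M') ^ ε * x ^ (-ε))) := by
          refine mul_le_mul_of_nonneg_left (h1.trans ?_) (norm_nonneg _)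
          gcongr
          · exact le_mul_of_one_le_right h0 h3
          · exact le_mul_of_one_le_right Real.pi_pos.le h3
      _ = _ := by ring
  · refine ⟨‖φ‖ * (D * M'), 1, by positivity, zero_le_one, fun ρ hρ _ y z hyz => ?_⟩
    have h1 := norm_log_sub_log_le (hFd.differentiable (by simp)) hD
      (by positivity : 0 < ρ / M') (y := y) (z := z)
      (fun w hw => (div_le_div_of_nonneg_right (hyz w hw) hM'0.le).trans (hlow w))
      (him.imp_right fun h w hw => h w fun h0 => by
        have := hyz w hw
        rw [h0, mul_zero, norm_zero] at this
        linarith)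
    rw [← map_sub, ← Real.norm_eq_abs]
    calc _ ≤ ‖φ‖ * ‖Complex.log (F y) - Complex.log (F z)‖ := φ.le_opNorm _
      _ ≤ ‖φ‖ * (D / (ρ / M') * |y - z|) := by gcongr
      _ = _ := by
        rw [Real.rpow_neg_one]
        field_simp
  · intro ε hε
    obtain ⟨C, hC⟩ := isSubpoly_log hF hp ha hrat hK hγ ht ε hε
    refine ⟨‖φ‖ * C, fun m hm => ?_⟩
    have := hC m hm
    rw [abs_of_nonneg (norm_nonneg _)] at this
    rw [← Real.norm_eq_abs]
    calc _ ≤ ‖φ‖ * ‖Complex.log (F (m * t))‖ := φ.le_opNorm _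
      _ ≤ ‖φ‖ * (C * (m : ℝ) ^ ε) := by gcongr
      _ = _ := by ring


/-! ### Reduction of the complex limit theorem to characteristic functions -/

theorem prod_map_parts_partition_eq_exp {n : ℕ} (σ : Equiv.Perm (Fin n)) (c : ℕ → ℝ) (α : ℝ) :
    (σ.partition.parts.map (phaseWeight c α)).prod
      = Complex.exp (((α * ∑ m ∈ Finset.Icc 1 n, (cycleCount σ m : ℝ) * c m : ℝ) : ℂ)
          * Complex.I) := by
  have hsub : σ.partition.parts.toFinset ⊆ Finset.Icc 1 n := fun m hm => by
    rw [Multiset.mem_toFinset] at hm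
    refine Finset.mem_Icc.2 ⟨σ.partition.parts_pos hm, ?_⟩
    have := Multiset.single_le_sum (fun _ _ => Nat.zero_le _) _ hm
    rwa [σ.partition.parts_sum, Fintype.card_fin] at this
  rw [Finset.prod_multiset_map_count, Finset.prod_subset hsub fun m _ hm => by
    rw [Multiset.mem_toFinset] at hm
    rw [Multiset.count_eq_zero_of_notMem hm, pow_zero]]
  rw [Finset.mul_sum, Complex.ofReal_sum, Finset.sum_mul, Complex.exp_sum]
  refine Finset.prod_congr rfl fun m _ => ?_
  rw [phaseWeight, ← Complex.exp_nat_mul, cycleCount]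
  congr 1
  push_cast
  ring

theorem ewensWeight_nonneg {θ : ℝ} (hθ : 0 < θ) {n : ℕ} (σ : Equiv.Perm (Fin n)) :
    0 ≤ ewensWeight θ σ :=
  div_nonneg (pow_nonneg hθ.le _) (Finset.prod_nonneg fun i _ => by positivity)

theorem integral_ewensMeasure {θ : ℝ} (hθ : 0 < θ) (n : ℕ) (g : Equiv.Perm (Fin n) → ℂ) :
    ∫ σ, g σ ∂(ewensMeasure θ hθ n) = ∑ σ, (ewensWeight θ σ : ℂ) * g σ := by
  rw [ewensMeasure, integral_finsetSum_measure fun σ _ =>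
    (Integrable.of_finite (μ := Measure.dirac σ)).smul_measure ENNReal.ofReal_ne_top]
  refine Finset.sum_congr rfl fun σ _ => ?_
  rw [integral_smul_measure, integral_dirac, ENNReal.toReal_ofReal (ewensWeight_nonneg hθ σ),
    Complex.real_smul]

/-- The mean of `(φ z) ^ 2` for a real linear form `φ` on `ℂ`, in terms of the means of
`z.re ^ 2`, `z.re * z.im` and `z.im ^ 2`. -/
noncomputable def secondMomentForm (R X Y : ℝ) (φ : ℂ →L[ℝ] ℝ) : ℝ :=
  φ 1 ^ 2 * R + 2 * (φ 1 * φ Complex.I) * X + φ Complex.I ^ 2 * Y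

theorem clm_complex_apply (φ : ℂ →L[ℝ] ℝ) (z : ℂ) :
    φ z = φ 1 * z.re + φ Complex.I * z.im := by
  conv_lhs => rw [show z = z.re • (1 : ℂ) + z.im • Complex.I by simp [Complex.re_add_im]]
  rw [map_add, map_smul, map_smul, smul_eq_mul, smul_eq_mul]
  ring

/-- Nonnegativity of the form is positive semidefiniteness of the matrix with entries `R, X, X, Y`;
the Gaussian law on the plane with this covariance, possibly degenerate, is carried to `ℂ` by an
isometry. -/
theorem exists_isGaussian_complex {R X Y : ℝ}
    (hnn : ∀ φ : ℂ →L[ℝ] ℝ, 0 ≤ secondMomentForm R X Y φ) :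
    ∃ N : Measure ℂ, ∃ _ : IsGaussian N,
      (∀ ξ : ℂ, charFun N ξ = Complex.exp ((-(secondMomentForm R X Y (innerSL ℝ ξ) / 2) : ℝ) : ℂ))
        ∧ cov[Complex.re, Complex.im; N] = X := by
  let S : Matrix (Fin 2) (Fin 2) ℝ := !![R, X; X, Y]
  have hform : ∀ ξ : ℂ, secondMomentForm R X Y (innerSL ℝ ξ)
      = ξ.re ^ 2 * R + 2 * (ξ.re * ξ.im) * X + ξ.im ^ 2 * Y := fun ξ => by
    simp [secondMomentForm, Complex.inner]
  have hS : S.PosSemidef := by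
    refine Matrix.PosSemidef.of_dotProduct_mulVec_nonneg ?_ fun v => ?_
    · ext i j
      fin_cases i <;> fin_cases j <;> simp [S]
    · have := hnn (innerSL ℝ ⟨v 0, v 1⟩)
      rw [hform] at this
      simp [S, Matrix.mulVec, dotProduct, Fin.sum_univ_two] at this ⊢
      linarith
  let e := Complex.orthonormalBasisOneI.repr.symm
  let G : Measure (EuclideanSpace ℝ (Fin 2)) := multivariateGaussian 0 S
  have he : ∀ v, e v = ⟨v 0, v 1⟩ := fun v => by
    apply Complex.ext <;> simp [e]
  refine ⟨G.map e, isGaussian_map (e : EuclideanSpace ℝ (Fin 2) →L[ℝ] ℂ), fun ξ => ?_, ?_⟩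
  · rw [hform, charFun_apply, integral_map (by fun_prop) (by fun_prop)]
    have : ∀ v, inner ℝ (e v) ξ = inner ℝ v (e.symm ξ) := fun v => by
      rw [← e.inner_map_map v, e.apply_symm_apply]
    simp_rw [this]
    rw [← charFun_apply, charFun_multivariateGaussian hS]
    have h0 : (e.symm ξ) 0 = ξ.re := by simp [e]
    have h1 : (e.symm ξ) 1 = ξ.im := by simp [e]
    congr 1
    simp [S, Matrix.mulVec, dotProduct, Fin.sum_univ_two, h0, h1]
    ring
  · rw [covariance_map (by fun_prop) (by fun_prop) (by fun_prop)]
    have := covariance_eval_multivariateGaussian (μ := 0) hS 0 1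
    have h0 : Complex.re ∘ e = fun v => v 0 := funext fun v => by simp [he]
    have h1 : Complex.im ∘ e = fun v => v 1 := funext fun v => by simp [he]
    rw [h0, h1]
    simpa [S] using this

/-- Real and imaginary part are jointly Gaussian, so being uncorrelated suffices for independence.
-/
theorem IsGaussian.indepFun_re_im_iff (N : Measure ℂ) [IsGaussian N] :
    IndepFun Complex.re Complex.im N ↔ cov[Complex.re, Complex.im; N] = 0 := by
  have h : HasGaussianLaw (fun z : ℂ => (z.re, z.im)) N :=
    (IsGaussian.hasGaussianLaw_id (μ := N)).map_fun
      (Complex.equivRealProdCLM : ℂ →L[ℝ] ℝ × ℝ)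
  exact ⟨fun hi => hi.covariance_eq_zero h.fst.memLp_two h.snd.memLp_two,
    fun hc => h.indepFun_of_covariance_eq_zero hc⟩

theorem exists_tendstoInDistribution {θ : ℝ} (hθ : 0 < θ) {a : ℕ → ℂ} {μ : ℂ} {R X Y : ℝ}
    (h1 : ∀ φ : ℂ →L[ℝ] ℝ, HasPowerMean (fun m => φ (a m)) (φ μ))
    (h2 : ∀ φ : ℂ →L[ℝ] ℝ, HasPowerMean (fun m => φ (a m) ^ 2) (secondMomentForm R X Y φ))
    (h4 : ∀ φ : ℂ →L[ℝ] ℝ, ∃ κ, HasPowerMean (fun m => φ (a m) ^ 4) κ)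
    (hs : ∀ φ : ℂ →L[ℝ] ℝ, IsSubpoly (fun m => φ (a m))) :
    ∃ N : Measure ℂ, ∃ _ : IsGaussian N,
      TendstoInDistribution (fun (n : ℕ) (σ : Equiv.Perm (Fin n)) =>
        (∑ m ∈ Finset.Icc 1 n, (cycleCount σ m : ℂ) * a m) / (√(Real.log n) : ℂ)
          - (θ : ℂ) * (√(Real.log n) : ℂ) * μ) atTop id (ewensMeasure θ hθ) N ∧
      cov[Complex.re, Complex.im; N] = θ * X ∧
      (IndepFun Complex.re Complex.im N ↔ cov[Complex.re, Complex.im; N] = 0) := by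
  have hscale : ∀ φ, secondMomentForm (θ * R) (θ * X) (θ * Y) φ
      = θ * secondMomentForm R X Y φ := fun φ => by
    simp only [secondMomentForm]; ring
  obtain ⟨N, hN, hchar, hcov⟩ := exists_isGaussian_complex (R := θ * R) (X := θ * X)
    (Y := θ * Y) fun φ => by
      rw [hscale]
      exact mul_nonneg hθ.le ((sq_nonneg _).trans ((h1 φ).sq_le (h2 φ)))
  refine ⟨N, hN, ⟨fun n => AEMeasurable.of_discrete, aemeasurable_id, ?_⟩, hcov,
    IsGaussian.indepFun_re_im_iff N⟩
  -- Lévy's continuity theorem. The characteristic function at `ξ` is the one-dimensional one of the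
  -- form `innerSL ℝ ξ` at `u = 1`.
  refine ProbabilityMeasure.tendsto_iff_tendsto_charFun.2 fun ξ => ?_
  obtain ⟨κ, hκ⟩ := h4 (innerSL ℝ ξ)
  have hlim := tendsto_exp_mul_ewensMean hθ (h1 (innerSL ℝ ξ)) (h2 _) hκ (hs _) 1
  simp only [ProbabilityMeasure.coe_mk, Measure.map_id]
  rw [hchar, hscale]
  convert hlim using 2 with n
  · rw [charFun_apply, integral_map AEMeasurable.of_discrete (by fun_prop), integral_ewensMeasure,
      ewensMean, Finset.mul_sum]
    refine Finset.sum_congr rfl fun σ _ => ?_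
    rw [prod_map_parts_partition_eq_exp, mul_left_comm, ← Complex.exp_add, ← add_mul,
      ← Complex.ofReal_add]
    congr 5
    rw [real_inner_comm]
    set L := √(Real.log n)
    have : (∑ m ∈ Finset.Icc 1 n, (cycleCount σ m : ℂ) * a m) / (L : ℂ) - (θ : ℂ) * (L : ℂ) * μ
        = (1 / L) • (∑ m ∈ Finset.Icc 1 n, (cycleCount σ m : ℝ) • a m) - (θ * L) • μ := by
      simp only [Complex.real_smul]
      push_cast
      ring
    rw [this, inner_sub_right, inner_smul_right, inner_smul_right, inner_sum]
    simp only [inner_smul_right, innerSL_apply_apply]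
    ring
  · simp


/-! ### Periodic sequences -/

theorem abs_le_of_periodic_nat {c : ℕ → ℝ} {p : ℕ} (hp : 0 < p) (hc : Function.Periodic c p)
    (m : ℕ) : |c m| ≤ ∑ j ∈ Finset.range p, |c j| := by
  rw [← hc.map_mod_nat m]
  exact Finset.single_le_sum (f := fun j => |c j|) (fun j _ => abs_nonneg _)
    (Finset.mem_range.2 (Nat.mod_lt m hp))

/-- The discrepancy `D N` is again periodic, since a full period contributes `p μ`. Hence it is
bounded, and the exponent `1 / 2` is an arbitrary choice. -/
theorem hasPowerMean_of_periodic {c : ℕ → ℝ} {p : ℕ} (hp : 0 < p) (hc : Function.Periodic c p) :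
    HasPowerMean c (1 / p * ∑ m ∈ Finset.Icc 1 p, c m) := by
  set μ := 1 / p * ∑ m ∈ Finset.Icc 1 p, c m with hμ
  let D : ℕ → ℝ := fun N => ∑ m ∈ Finset.Icc 1 N, c m - N * μ
  have hsucc : ∀ N, D (N + 1) = D N + c (N + 1) - μ := fun N => by
    simp only [D]
    rw [Finset.sum_Icc_succ_top (by omega)]
    push_cast
    ring
  have hD : Function.Periodic D p := fun N => by
    induction N with
    | zero =>
      have : (p : ℝ) ≠ 0 := by positivity
      simp only [D, hμ, zero_add]
      field_simp
      simp
    | succ N ih => rw [add_right_comm, hsucc, ih, hsucc, add_right_comm, hc]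
  refine ⟨1 / 2, ∑ j ∈ Finset.range p, |D j|, by norm_num, by norm_num, fun N hN => ?_⟩
  refine (abs_le_of_periodic_nat hp hD N).trans (le_mul_of_one_le_right
    (Finset.sum_nonneg fun j _ => abs_nonneg _) ?_)
  exact Real.one_le_rpow (by exact_mod_cast hN) (by norm_num)

theorem isSubpoly_of_periodic {c : ℕ → ℝ} {p : ℕ} (hp : 0 < p) (hc : Function.Periodic c p) :
    IsSubpoly c := fun ε hε => by
  refine ⟨∑ j ∈ Finset.range p, |c j|, fun m hm => (abs_le_of_periodic_nat hp hc m).trans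
    (le_mul_of_one_le_right (Finset.sum_nonneg fun j _ => abs_nonneg _) ?_)⟩
  exact Real.one_le_rpow (by exact_mod_cast hm) hε.le

theorem sq_clm_complex_apply (φ : ℂ →L[ℝ] ℝ) (z : ℂ) :
    φ z ^ 2 = φ 1 ^ 2 * z.re ^ 2 + 2 * (φ 1 * φ Complex.I) * (z.re * z.im)
      + φ Complex.I ^ 2 * z.im ^ 2 := by
  rw [clm_complex_apply]
  ring

theorem im_sq (z : ℂ) : (z ^ 2).im = 2 * (z.re * z.im) := by
  rw [sq, Complex.mul_im]
  ring

/-! ### The limit theorem at a root of unity -/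

theorem exists_tendstoInDistribution_of_isOfFinOrder {θ : ℝ} (hθ : 0 < θ) (f : Circle → ℂ)
    {x : Circle} (hx : IsOfFinOrder x) :
    ∃ N : Measure ℂ, ∃ _ : IsGaussian N,
      TendstoInDistribution (normalizedLog θ f x) atTop id (ewensMeasure θ hθ) N ∧
      cov[Complex.re, Complex.im; N] = θ / 2 * ((1 / (orderOf x : ℂ)) *
        ∑ m ∈ Finset.Icc 1 (orderOf x), Complex.log (f (x ^ m)) ^ 2).im ∧
      (IndepFun Complex.re Complex.im N ↔ cov[Complex.re, Complex.im; N] = 0) := by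
  have hp : 0 < orderOf x := hx.orderOf_pos
  let a : ℕ → ℂ := fun m => Complex.log (f (x ^ m))
  have ha : ∀ u : ℂ → ℝ, Function.Periodic (fun m => u (a m)) (orderOf x) := fun u m => by
    simp only [a, pow_add, pow_orderOf_eq_one, mul_one]
  have hcast : ∀ z : ℂ, 1 / (orderOf x : ℂ) * z = (1 / (orderOf x : ℝ)) • z := fun z => by
    rw [Complex.real_smul]
    push_cast
    rfl
  let avg : (ℂ → ℝ) → ℝ := fun u => 1 / (orderOf x : ℝ) * ∑ m ∈ Finset.Icc 1 (orderOf x), u (a m)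
  obtain ⟨N, hN, hlim, hcov, hind⟩ := exists_tendstoInDistribution hθ (a := a)
    (μ := logMahler f x) (R := avg fun z => z.re ^ 2) (X := avg fun z => z.re * z.im)
    (Y := avg fun z => z.im ^ 2)
    (fun φ => by
      convert hasPowerMean_of_periodic hp (ha φ) using 1
      rw [logMahler, if_pos hx, hcast, map_smul, map_sum, smul_eq_mul])
    (fun φ => by
      convert hasPowerMean_of_periodic hp (ha fun z => φ z ^ 2) using 1
      have hsq : ∀ m, φ (a m) ^ 2 = _ := fun m => sq_clm_complex_apply φ (a m)
      simp only [secondMomentForm, avg, hsq, Finset.sum_add_distrib,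
        ← Finset.mul_sum]
      ring)
    (fun φ => ⟨_, hasPowerMean_of_periodic hp (ha fun z => φ z ^ 4)⟩)
    (fun φ => isSubpoly_of_periodic hp (ha φ))
  refine ⟨N, hN, hlim, ?_, hind⟩
  rw [hcov, hcast, Complex.smul_im, Complex.im_sum]
  simp only [im_sq, avg, ← Finset.mul_sum, smul_eq_mul, a]
  ring

/-! ### The limit theorem at a point of finite type -/

theorem intervalIntegrable_of_re_im {z : ℝ → ℂ} {a b : ℝ}
    (hre : IntervalIntegrable (fun s => (z s).re) volume a b)
    (him : IntervalIntegrable (fun s => (z s).im) volume a b) :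
    IntervalIntegrable z volume a b :=
  ⟨Integrable.re_im_iff.1 ⟨hre.1, him.1⟩, Integrable.re_im_iff.1 ⟨hre.2, him.2⟩⟩

theorem periodic_comp_circleExp (f : Circle → ℂ) :
    Function.Periodic (fun s : ℝ => f (Circle.exp (2 * Real.pi * s))) 1 := fun s => by
  simp only [mul_add, mul_one, Circle.exp_add_two_pi]

theorem RealAnalyticOnCircle.analyticOnNhd {f : Circle → ℂ} (hf : RealAnalyticOnCircle f) :
    AnalyticOnNhd ℝ (fun s : ℝ => f (Circle.exp (2 * Real.pi * s))) Set.univ := by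
  have h : ContDiff ℝ ω (fun s : ℝ => f (Circle.exp s)) :=
    contMDiff_iff_contDiff.1 (hf.comp contMDiff_circleExp)
  exact contDiff_omega_iff_analyticOnNhd.1 (h.comp (contDiff_const.mul contDiff_id))

theorem exists_mul_eq_of_isOfFinOrder_circleExp {s : ℝ}
    (h : IsOfFinOrder (Circle.exp (2 * Real.pi * s))) : ∃ (q : ℕ) (k : ℤ), 0 < q ∧ q * s = k := by
  obtain ⟨q, hq, h1⟩ := isOfFinOrder_iff_pow_eq_one.1 h
  rw [← Circle.exp_natCast_mul, Circle.exp_eq_one] at h1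
  obtain ⟨k, hk⟩ := h1
  refine ⟨q, k, hq, mul_right_cancel₀ Real.two_pi_pos.ne' ?_⟩
  rw [← hk]
  ring

theorem exists_tendstoInDistribution_of_isFiniteType {θ : ℝ} (hθ : 0 < θ) {f : Circle → ℂ}
    (hf : RealAnalyticOnCircle f) {x : Circle} (hx : ¬ IsOfFinOrder x) (hxt : IsFiniteType x)
    (hz : ∀ z : Circle, f z = 0 → IsOfFinOrder z) :
    IntervalIntegrable (logOnCircle f) volume 0 1 ∧
    IntervalIntegrable (fun s => logOnCircle f s ^ 2) volume 0 1 ∧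
    ∃ N : Measure ℂ, ∃ _ : IsGaussian N,
      TendstoInDistribution (normalizedLog θ f x) atTop id (ewensMeasure θ hθ) N ∧
      cov[Complex.re, Complex.im; N] = θ / 2 * (∫ s in (0 : ℝ)..1, logOnCircle f s ^ 2).im ∧
      (IndepFun Complex.re Complex.im N ↔ cov[Complex.re, Complex.im; N] = 0) := by
  obtain ⟨t, rfl, K, γ, hK, hγ, ht⟩ := hxt
  -- The point where `F` does not vanish is `t` itself: `x` is not a root of unity, hence not a zero
  -- of `f`.
  obtain ⟨Q, Λ, η, hQ, htame⟩ := exists_isGauge_isTame_log hf.analyticOnNhd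
    (periodic_comp_circleExp f) (fun h => hx (hz _ h))
    (fun s hs => exists_mul_eq_of_isOfFinOrder_circleExp (hz _ hs)) hK hγ ht
  change ∀ φ : ℂ →L[ℝ] ℝ, IsTame Q t (fun s => φ (logOnCircle f s)) at htame
  have hre : IsTame Q t (fun s => (logOnCircle f s).re) := htame Complex.reCLM
  have him : IsTame Q t (fun s => (logOnCircle f s).im) := htame Complex.imCLM
  have hrr := (hre.mul hre).intervalIntegrable hQ
  have hri := (hre.mul him).intervalIntegrable hQ
  have hii := (him.mul him).intervalIntegrable hQ
  have hlog : IntervalIntegrable (logOnCircle f) volume 0 1 :=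
    intervalIntegrable_of_re_im (hre.intervalIntegrable hQ) (him.intervalIntegrable hQ)
  have hlog2 : IntervalIntegrable (fun s => logOnCircle f s ^ 2) volume 0 1 := by
    refine intervalIntegrable_of_re_im ?_ ?_
    · simpa only [sq, Complex.mul_re] using hrr.sub hii
    · simpa only [im_sq] using hri.const_mul 2
  refine ⟨hlog, hlog2, ?_⟩
  have hpow : ∀ m : ℕ, Circle.exp (2 * Real.pi * (m * t)) = Circle.exp (2 * Real.pi * t) ^ m :=
    fun m => by rw [← Circle.exp_natCast_mul, mul_left_comm]
  obtain ⟨N, hN, hlim, hcov, hind⟩ := exists_tendstoInDistribution hθ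
    (a := fun m => logOnCircle f (m * t)) (μ := ∫ s in (0 : ℝ)..1, logOnCircle f s)
    (R := ∫ s in (0 : ℝ)..1, (logOnCircle f s).re * (logOnCircle f s).re)
    (X := ∫ s in (0 : ℝ)..1, (logOnCircle f s).re * (logOnCircle f s).im)
    (Y := ∫ s in (0 : ℝ)..1, (logOnCircle f s).im * (logOnCircle f s).im)
    (fun φ => by
      rw [← φ.intervalIntegral_comp_comm hlog]
      exact (htame φ).hasPowerMean hK hγ ht hQ)
    (fun φ => by
      convert ((htame φ).pow two_ne_zero).hasPowerMean hK hγ ht hQ using 1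
      have hsq : ∀ s, φ (logOnCircle f s) ^ 2 = _ := fun s => sq_clm_complex_apply φ _
      simp only [secondMomentForm, hsq, sq (Complex.re _), sq (Complex.im _)]
      rw [intervalIntegral.integral_add ((hrr.const_mul _).add (hri.const_mul _))
        (hii.const_mul _), intervalIntegral.integral_add (hrr.const_mul _) (hri.const_mul _)]
      simp only [intervalIntegral.integral_const_mul])
    (fun φ => ⟨_, ((htame φ).pow four_ne_zero).hasPowerMean hK hγ ht hQ⟩)
    (fun φ => (htame φ).subpoly)
  refine ⟨N, hN, ?_, ?_, hind⟩
  · convert hlim using 3 with n σ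
    simp only [normalizedLog, logClassFun, logMahler, if_neg hx, logOnCircle, hpow]
  -- Since `Im (z ^ 2) = 2 Re z Im z`, the mean of `Re · Im` is half the imaginary part of the
  -- integral, whence `θ / 2`.
  · have := Complex.imCLM.intervalIntegral_comp_comm hlog2
    simp only [Complex.imCLM_apply, im_sq, intervalIntegral.integral_const_mul] at this
    rw [hcov, ← this]
    ring

end EwensCLT

/-! ### The main theorem -/

theorem mainTheorem1 (θ : ℝ) (hθ : 0 < θ) (f : Circle → ℂ)
    (hf : EwensCLT.RealAnalyticOnCircle f) (x : Circle) :
    (¬ IsOfFinOrder x → EwensCLT.IsFiniteType x → (∀ z : Circle, f z = 0 → IsOfFinOrder z) →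
      IntervalIntegrable (EwensCLT.logOnCircle f) volume 0 1 ∧
      IntervalIntegrable (fun s => EwensCLT.logOnCircle f s ^ 2) volume 0 1 ∧
      ∃ N : Measure ℂ, ∃ _ : IsGaussian N,
          TendstoInDistribution (EwensCLT.normalizedLog θ f x) atTop id
            (EwensCLT.ewensMeasure θ hθ) N ∧
          cov[Complex.re, Complex.im; N] =
            θ / 2 * (∫ s in (0 : ℝ)..1, EwensCLT.logOnCircle f s ^ 2).im ∧
          (IndepFun Complex.re Complex.im N ↔ cov[Complex.re, Complex.im; N] = 0)) ∧
    (∀ p : ℕ, 0 < p → orderOf x = p → (∀ m ∈ Finset.Icc 1 p, f (x ^ m) ≠ 0) →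
      ∃ N : Measure ℂ, ∃ _ : IsGaussian N,
          TendstoInDistribution (EwensCLT.normalizedLog θ f x) atTop id
            (EwensCLT.ewensMeasure θ hθ) N ∧
          cov[Complex.re, Complex.im; N] =
            θ / 2 * ((1 / (p : ℂ)) * ∑ m ∈ Finset.Icc 1 p, Complex.log (f (x ^ m)) ^ 2).im ∧
          (IndepFun Complex.re Complex.im N ↔ cov[Complex.re, Complex.im; N] = 0)) := by
  refine ⟨fun hx hxt hz =>
    EwensCLT.exists_tendstoInDistribution_of_isFiniteType hθ hf hx hxt hz, ?_⟩
  rintro p hp rfl -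
  exact EwensCLT.exists_tendstoInDistribution_of_isOfFinOrder hθ f (orderOf_pos_iff.1 hp)
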